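/- Define $$\gamma = 1-\max_{z\in[0,1/4]}\frac{z^3(5-38z+92z^2-80z^3)}{(1-3z+3z^2)^2}=0.986882\ldots$$ There is a function $\varepsilon:\mathbb{N}\to\mathbb{R}$ with $\varepsilon(n)\to 0$ as $n\to\infty$ such that every finite simple graph $G$ with no independent set of size three (that is, $\alpha(G)\le 2$) has a simple minor $H$ with $|V(H)|=\lceil |V(G)|/2\rceil$ and $$|E(H)|\ \ge\ \bigl(\gamma-\varepsilon(|V(G)|)\bigr)\binom{|V(H)|}{2}.$$ Here a simple graph $H$ is a minor of $G$ if there are pairwise disjoint vertex sets $B_w\subseteq V(G)$, $w\in V(H)$, each inducing a non-empty connected subgraph of $G$, such that $G$ has an edge between $B_u$ and $B_w$ whenever $uw\in E(H)$. -/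

import Mathlib

open Filter Topology

/-- `H` is a minor of `G`: there are pairwise disjoint vertex sets of `G`, one for each vertex of
`H`, each inducing a connected (in particular nonempty) subgraph of `G`, such that the sets of any
two adjacent vertices of `H` are joined by an edge of `G`. -/
def SimpleGraph.IsMinor {W V : Type*} (H : SimpleGraph W) (G : SimpleGraph V) : Prop :=
  ∃ B : W → Set V,
    (∀ w, (G.induce (B w)).Connected) ∧
    (∀ u w, u ≠ w → Disjoint (B u) (B w)) ∧
    (∀ u w, H.Adj u w → ∃ x ∈ B u, ∃ y ∈ B w, G.Adj x y)

/-- The function of `z` whose maximum over `[0, 1/4]` is `1 - γ`. -/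
noncomputable def missingDensity (z : ℝ) : ℝ :=
  z ^ 3 * (5 - 38 * z + 92 * z ^ 2 - 80 * z ^ 3) / (1 - 3 * z + 3 * z ^ 2) ^ 2

/-! Let `T = Gᶜ`. It is triangle-free, so `T`-neighbourhoods are cliques of `G` and every `T`-degree
is at most the clique number `q`. A gull (three vertices spanning one `T`-edge, that is, an induced
path of `G`) is connected in `G` and touches every nonempty set disjoint from it, since a vertex
missed by both ends of its `T`-edge would close a `T`-triangle. Used as branch sets, gulls therefore
lose no edges.

Let `C` be a maximum clique and `n = |V|`. If `n ≤ 4q`, the singletons of `C` and about `n/2 - q`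
disjoint gulls outside `C` give an almost complete minor. If `n > 4q`, add about `t = (n - 4q)/2`
disjoint edges of `G` outside `C` and use only `q` gulls: this takes `q + 2t + 3q = n` vertices and
gives `q + t + q = n/2` branch sets. Missing pairs then involve a matching edge. For a random
matching their expected number is bounded through the degree bound `q`; the estimate is worst when
`C` sends out `q²` non-edges, and its main term is then `missingDensity (q/n) * n²/4` ordered pairs.
A second-moment penalty controls the size of the matching, and the relative error is of order
`n^(-1/4)`.

Gulls are supplied by `exists_gullPacking`: up to an additive constant, only a large `T`-independent
set or a large `T`-biclique can obstruct a packing. The vertices missed by a maximum packing span no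
gull, hence form a complete bipartite graph with sides `A`, `B`. If `B` is small, exchanges extend
`A` by one vertex per gull to an independent set. If both sides are large, an alternating-path
argument in the style of König's theorem deletes one vertex per gull and leaves a biclique. When `n
≤ 4q` a biclique on half of the vertices may exist; `exists_complete_minor` then gives a complete
minor by Hall's theorem. -/

/-! ### Gull packings and exchanges -/

section Gull

open scoped Classical

variable {V : Type*} {T : SimpleGraph V} {L : Finset V} {F : Finset (Finset V)}

/-- A three-vertex set spanning exactly one edge. -/
def IsGull (T : SimpleGraph V) (S : Finset V) : Prop :=
  ∃ a b c, T.Adj a b ∧ ¬ T.Adj a c ∧ ¬ T.Adj b c ∧ S = {a, b, c}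

/-- A family of pairwise disjoint gulls inside `L`. -/
structure GullPacking (T : SimpleGraph V) (L : Finset V) (F : Finset (Finset V)) : Prop where
  gull : ∀ S ∈ F, IsGull T S
  sub : ∀ S ∈ F, S ⊆ L
  disj : ∀ S ∈ F, ∀ S' ∈ F, S ≠ S' → Disjoint S S'

/-- The vertices of `L` missed by the family `F`. -/
noncomputable def rest (L : Finset V) (F : Finset (Finset V)) : Finset V := L \ F.biUnion id

/-- A gull packing of maximum cardinality. -/
structure MaxPacking (T : SimpleGraph V) (L : Finset V) (F : Finset (Finset V)) : Prop
    extends GullPacking T L F where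
  max : ∀ F', GullPacking T L F' → F'.card ≤ F.card

lemma mem_rest {v : V} : v ∈ rest L F ↔ v ∈ L ∧ ∀ S ∈ F, v ∉ S := by
  simp [rest]

lemma IsGull.nonempty {S : Finset V} (h : IsGull T S) : S.Nonempty := by
  obtain ⟨a, b, c, -, -, -, rfl⟩ := h
  simp

lemma isGull_of {a b c : V} (h₁ : T.Adj a b) (h₂ : ¬ T.Adj a c) (h₃ : ¬ T.Adj b c) :
    IsGull T {a, b, c} := ⟨a, b, c, h₁, h₂, h₃, rfl⟩

lemma card_gull {a b c : V} (h₁ : T.Adj a b) (h₂ : ¬ T.Adj a c) (h₃ : ¬ T.Adj b c) :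
    ({a, b, c} : Finset V).card = 3 := by
  have h₄ : a ≠ c := fun h => h₃ (h ▸ h₁.symm)
  have h₅ : b ≠ c := fun h => h₂ (h ▸ h₁)
  rw [Finset.card_eq_three]
  exact ⟨a, b, c, h₁.ne, h₄, h₅, rfl⟩

lemma IsGull.card {S : Finset V} (h : IsGull T S) : S.card = 3 := by
  obtain ⟨a, b, c, h₁, h₂, h₃, rfl⟩ := h
  exact card_gull h₁ h₂ h₃

lemma exists_maxPacking (T : SimpleGraph V) (L : Finset V) : ∃ F, MaxPacking T L F := by
  have hne : ((L.powerset.powerset).filter (fun F => GullPacking T L F)).Nonempty :=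
    ⟨∅, by simp; exact ⟨by simp, by simp, by simp⟩⟩
  obtain ⟨F, hF, hmax⟩ := Finset.exists_max_image _ Finset.card hne
  rw [Finset.mem_filter] at hF
  refine ⟨F, hF.2, fun F' hF' => hmax F' ?_⟩
  rw [Finset.mem_filter]
  refine ⟨?_, hF'⟩
  rw [Finset.mem_powerset]
  intro S hS
  exact Finset.mem_powerset.2 (hF'.sub S hS)

lemma MaxPacking.no_gull (hF : MaxPacking T L F) {S : Finset V} (hS : IsGull T S)
    (hsub : S ⊆ rest L F) : False := by
  have hnot : S ∉ F := by
    intro h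
    obtain ⟨x, hx⟩ := hS.nonempty
    exact (mem_rest.1 (hsub hx)).2 S h hx
  have hd : ∀ S' ∈ F, Disjoint S S' := fun S' hS' =>
    Finset.disjoint_left.2 fun x hx => (mem_rest.1 (hsub hx)).2 S' hS'
  have := hF.max (insert S F) ⟨by
      simp only [Finset.mem_insert, forall_eq_or_imp]; exact ⟨hS, hF.gull⟩, by
      simp only [Finset.mem_insert, forall_eq_or_imp]
      exact ⟨fun x hx => (mem_rest.1 (hsub hx)).1, hF.sub⟩, by
      simp only [Finset.mem_insert, forall_eq_or_imp]
      refine ⟨⟨fun h => (h rfl).elim, fun S' h _ => hd S' h⟩, fun S₁ h₁ => ⟨fun _ => (hd _ h₁).symm, hF.disj _ h₁⟩⟩⟩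
  rw [Finset.card_insert_of_notMem hnot] at this
  omega

/-- Trading one member for one gull keeps the cardinality, hence maximality. The explicit new rest
allows exchanges to be chained until a gull appears in it. -/
lemma MaxPacking.exch (hF : MaxPacking T L F) {Q S : Finset V} (hQ : Q ∈ F) (hS : IsGull T S)
    (hsub : S ⊆ Q ∪ rest L F) :
    MaxPacking T L (insert S (F.erase Q)) ∧
      rest L (insert S (F.erase Q)) = (Q ∪ rest L F) \ S := by
  have hd : ∀ S' ∈ F, S' ≠ Q → Disjoint S S' := fun S' hS' hne =>
    Finset.disjoint_left.2 fun x hx hx' => by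
      rcases Finset.mem_union.1 (hsub hx) with h | h
      · exact Finset.disjoint_left.1 (hF.disj _ hS' _ hQ hne) hx' h
      · exact (mem_rest.1 h).2 S' hS' hx'
  have hnot : S ∉ F.erase Q := by
    intro h
    rw [Finset.mem_erase] at h
    obtain ⟨x, hx⟩ := hS.nonempty
    exact Finset.disjoint_left.1 (hd S h.2 h.1) hx hx
  have hpos : 0 < F.card := Finset.card_pos.2 ⟨Q, hQ⟩
  refine ⟨⟨⟨?_, ?_, ?_⟩, ?_⟩, ?_⟩
  · simp only [Finset.mem_insert, forall_eq_or_imp]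
    exact ⟨hS, fun S' h => hF.gull S' (Finset.mem_of_mem_erase h)⟩
  · simp only [Finset.mem_insert, forall_eq_or_imp]
    refine ⟨fun x hx => ?_, fun S' h => hF.sub S' (Finset.mem_of_mem_erase h)⟩
    rcases Finset.mem_union.1 (hsub hx) with h | h
    · exact hF.sub Q hQ h
    · exact (mem_rest.1 h).1
  · simp only [Finset.mem_insert, forall_eq_or_imp, Finset.mem_erase]
    exact ⟨⟨fun h => (h rfl).elim, fun S' h _ => hd S' h.2 h.1⟩,
      fun S₁ h₁ => ⟨fun _ => (hd _ h₁.2 h₁.1).symm, fun S₂ h₂ => hF.disj _ h₁.2 _ h₂.2⟩⟩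
  · intro F' hF'
    rw [Finset.card_insert_of_notMem hnot, Finset.card_erase_of_mem hQ]
    have := hF.max F' hF'
    omega
  · ext x
    rw [Finset.mem_sdiff, Finset.mem_union, mem_rest, mem_rest]
    simp only [Finset.mem_insert, forall_eq_or_imp, Finset.mem_erase]
    constructor
    · rintro ⟨h₁, h₂, h₃⟩
      refine ⟨?_, h₂⟩
      by_cases hx : x ∈ Q
      · exact Or.inl hx
      · refine Or.inr ⟨h₁, fun S' hS' => ?_⟩
        by_cases h : S' = Q
        · rwa [h]
        · exact h₃ S' ⟨h, hS'⟩
    · rintro ⟨h₁ | h₁, h₂⟩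
      · exact ⟨hF.sub Q hQ h₁, h₂, fun S' h h' =>
          Finset.disjoint_left.1 (hF.disj _ h.2 _ hQ h.1) h' h₁⟩
      · exact ⟨h₁.1, h₂, fun S' h => h₁.2 S' h.2⟩

/-- Once one of the two gulls has replaced `Q`, the other lies in the new rest. -/
lemma MaxPacking.no_two (hF : MaxPacking T L F) {Q S S' : Finset V} (hQ : Q ∈ F)
    (hS : IsGull T S) (hS' : IsGull T S') (hd : Disjoint S S')
    (hsub : S ⊆ Q ∪ rest L F) (hsub' : S' ⊆ Q ∪ rest L F) : False := by
  obtain ⟨h₁, h₂⟩ := hF.exch hQ hS hsub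
  refine h₁.no_gull hS' ?_
  rw [h₂]
  intro x hx
  exact Finset.mem_sdiff.2 ⟨hsub' hx, fun h => Finset.disjoint_left.1 hd h hx⟩

lemma MaxPacking.card_rest (hF : MaxPacking T L F) :
    (rest L F).card + 3 * F.card = L.card := by
  have h₁ : F.biUnion id ⊆ L := by
    intro x hx
    simp only [Finset.mem_biUnion, id] at hx
    obtain ⟨S, hS, hx⟩ := hx
    exact hF.sub S hS hx
  have h₂ : (F.biUnion id).card = 3 * F.card := by
    rw [Finset.card_biUnion (t := id) (fun S hS S' hS' h => hF.disj S hS S' hS' h),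
      Finset.sum_congr rfl (f := fun S => (id S).card) (g := fun _ => 3)
        (fun S hS => (hF.gull S hS).card), Finset.sum_const, smul_eq_mul, mul_comm]
  have h₃ := Finset.card_le_card h₁
  rw [rest, Finset.card_sdiff_of_subset h₁, ← h₂]
  omega

/-- `A` and `B` are independent sets with all edges between them. -/
structure IsBiclique (T : SimpleGraph V) (A B : Finset V) : Prop where
  left : ∀ a ∈ A, ∀ a' ∈ A, ¬ T.Adj a a'
  right : ∀ b ∈ B, ∀ b' ∈ B, ¬ T.Adj b b'
  adj : ∀ a ∈ A, ∀ b ∈ B, T.Adj a b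

lemma IsBiclique.symm {A B : Finset V} (h : IsBiclique T A B) : IsBiclique T B A :=
  ⟨h.right, h.left, fun b hb a ha => (h.adj a ha b hb).symm⟩

/-- If `ab` is an edge, every other vertex sees exactly one of `a`, `b`, so the two neighbourhoods
are the sides; a missing cross pair `x`, `y` would give the gull `{x, b, y}`. Without an edge one
side is empty. -/
lemma exists_biclique_of_no_gull (htri : ∀ a b c, T.Adj a b → T.Adj b c → ¬ T.Adj a c) {R : Finset V}
    (hR : ∀ S ⊆ R, ¬ IsGull T S) : ∃ A B, IsBiclique T A B ∧ Disjoint A B ∧ A ∪ B = R := by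
  by_cases hE : ∃ a ∈ R, ∃ b ∈ R, T.Adj a b
  · obtain ⟨a, ha, b, hb, hab⟩ := hE
    refine ⟨R.filter (fun v => T.Adj b v), R.filter (fun v => T.Adj a v), ⟨?_, ?_, ?_⟩, ?_, ?_⟩
    · intro x hx y hy
      rw [Finset.mem_filter] at hx hy
      exact htri x b y hx.2.symm hy.2
    · intro x hx y hy
      rw [Finset.mem_filter] at hx hy
      exact htri x a y hx.2.symm hy.2
    · intro x hx y hy
      rw [Finset.mem_filter] at hx hy
      by_contra h
      refine hR {x, b, y} ?_ (isGull_of hx.2.symm h ?_)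
      · simp [Finset.insert_subset_iff, hx.1, hy.1, hb]
      · exact htri b a y hab.symm hy.2
    · rw [Finset.disjoint_left]
      intro x hx hy
      rw [Finset.mem_filter] at hx hy
      exact htri a b x hab hx.2 hy.2
    · ext x
      rw [Finset.mem_union, Finset.mem_filter, Finset.mem_filter]
      refine ⟨fun h => h.elim And.left And.left, fun hx => ?_⟩
      by_contra! h
      refine hR {a, b, x} ?_ (isGull_of hab (h.2 hx) (h.1 hx))
      simp [Finset.insert_subset_iff, ha, hb, hx]
  · push Not at hE
    exact ⟨R, ∅, ⟨hE, by simp, by simp⟩, by simp, by simp⟩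

end Gull

/-! ### Small side `B`: a large independent set -/

section Alpha

open scoped Classical

variable {V : Type*} {T : SimpleGraph V} {L : Finset V} {F : Finset (Finset V)}

lemma disjoint_triples_one_three {A Q : Finset V} (hAQ : ∀ x ∈ A, x ∉ Q) {a b r r' q q' : V}
    (ha : a ∈ Q) (hb : b ∈ Q) (hr : r ∈ A) (hr' : r' ∈ A) (hq : q ∈ A) (hq' : q' ∈ A)
    (h₁ : a ≠ b) (h₂ : r ≠ q) (h₃ : r ≠ q') (h₄ : r' ≠ q) (h₅ : r' ≠ q') :
    Disjoint ({a, r, r'} : Finset V) {b, q, q'} := by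
  have := hAQ r hr
  have := hAQ r' hr'
  have := hAQ q hq
  have := hAQ q' hq'
  rw [Finset.disjoint_left]
  grind

lemma disjoint_triples_two_one {A Q : Finset V} (hAQ : ∀ x ∈ A, x ∉ Q) {a b c r q q' : V}
    (ha : a ∈ Q) (hb : b ∈ Q) (hc : c ∈ Q) (hr : r ∈ A) (hq : q ∈ A) (hq' : q' ∈ A)
    (h₁ : a ≠ b) (h₂ : c ≠ b) (h₃ : r ≠ q) (h₄ : r ≠ q') :
    Disjoint ({a, r, c} : Finset V) {b, q, q'} := by
  have := hAQ r hr
  have := hAQ q hq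
  have := hAQ q' hq'
  rw [Finset.disjoint_left]
  grind

lemma notMem_of_mem_rest {A Q : Finset V} (hA : A ⊆ rest L F) (hQ : Q ∈ F) :
    ∀ x ∈ A, x ∉ Q := fun _ hx => (mem_rest.1 (hA hx)).2 Q hQ

/-- One end of the edge of a gull in a maximum packing sees at least as much of an independent
part of the rest as the other; the other sees nothing. -/
lemma MaxPacking.anticomplete_aux (htri : ∀ a b c, T.Adj a b → T.Adj b c → ¬ T.Adj a c)
    (hF : MaxPacking T L F) {A : Finset V}
    (hA : A ⊆ rest L F) (hind : ∀ x ∈ A, ∀ y ∈ A, ¬ T.Adj x y) (hcard : 6 ≤ A.card)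
    {a b c : V} (hQ : {a, b, c} ∈ F) (hab : T.Adj a b) (hac : ¬ T.Adj a c) (hbc : ¬ T.Adj b c)
    (hle : (A.filter (T.Adj b)).card ≤ (A.filter (T.Adj a)).card) : ∀ x ∈ A, ¬ T.Adj b x := by
  intro q hq hbq
  have hAQ := notMem_of_mem_rest hA hQ
  have hac' : a ≠ c := fun h => hbc (h ▸ hab.symm)
  have hbc' : b ≠ c := fun h => hac (h ▸ hab)
  have hab' := hab.ne
  have hdisj : ∀ x, T.Adj a x → ¬ T.Adj b x := fun x h₁ h₂ => htri b a x hab.symm h₁ h₂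
  have key : ∀ S S' : Finset V, IsGull T S → IsGull T S' → Disjoint S S' →
      S ⊆ {a, b, c} ∪ A → S' ⊆ {a, b, c} ∪ A → False := fun S S' h₁ h₂ h₃ h₄ h₅ =>
    hF.no_two hQ h₁ h₂ h₃ (h₄.trans (Finset.union_subset_union_right hA))
      (h₅.trans (Finset.union_subset_union_right hA))
  -- Each end of `ab` takes a neighbour and a non-neighbour from the independent set `A`, which
  -- gives two disjoint gulls in `Q ∪ A`.
  have k1 : ∀ r ∈ A, ∀ r' ∈ A, ∀ q' ∈ A, ∀ q ∈ A, T.Adj a r → ¬ T.Adj a r' → T.Adj b q →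
      ¬ T.Adj b q' → r ≠ r' → r ≠ q' → r' ≠ q → r' ≠ q' → q ≠ q' → False := by
    intro r hr r' hr' q' hq' q hq h1 h2 h3 h4 h5 h6 h7 h8 h9
    have := hdisj r h1
    have h10 : r ≠ q := fun h => this (h ▸ h3)
    refine key {a, r, r'} {b, q, q'} (isGull_of h1 h2 (hind _ hr _ hr'))
      (isGull_of h3 h4 (hind _ hq _ hq')) ?_ ?_ ?_
    · exact disjoint_triples_one_three hAQ (by simp) (by simp) hr hr' hq hq' hab' h10 h6 h7 h8
    · simp [Finset.insert_subset_iff, hr, hr']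
    · simp [Finset.insert_subset_iff, hq, hq']
  have hbpos : q ∈ A.filter (T.Adj b) := by simp [hq, hbq]
  -- With two neighbours of `b`, `hle` gives two of `a`; the neighbourhoods are disjoint, so each
  -- end finds its non-neighbour among the neighbours of the other.
  by_cases h2 : 2 ≤ (A.filter (T.Adj b)).card
  · obtain ⟨r', hr', hr'q⟩ := Finset.exists_mem_ne (show 1 < (A.filter (T.Adj b)).card by omega) q
    obtain ⟨r, hr, q', hq', hne⟩ := Finset.one_lt_card.1 (show 1 < (A.filter (T.Adj a)).card by omega)
    simp only [Finset.mem_filter] at hr' hr hq'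
    refine k1 r hr.1 r' hr'.1 q' hq'.1 q hq hr.2 (fun h => hdisj _ h hr'.2) hbq
      (hdisj _ hq'.2) ?_ hne hr'q ?_ ?_
    · rintro rfl; exact hdisj _ hr.2 hr'.2
    · rintro rfl; exact hdisj _ hq'.2 hr'.2
    · rintro rfl; exact hdisj _ hq'.2 hbq
  have hb1 : ∀ x ∈ A, T.Adj b x → x = q := by
    intro x hx hbx
    by_contra hne
    exact h2 (Finset.one_lt_card.2 ⟨x, by simp [hx, hbx], q, hbpos, hne⟩)
  have hapos : 0 < (A.filter (T.Adj a)).card :=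
    lt_of_lt_of_le (Finset.card_pos.2 ⟨q, hbpos⟩) hle
  obtain ⟨r, hr⟩ := Finset.card_pos.1 hapos
  rw [Finset.mem_filter] at hr
  have hrq : r ≠ q := by rintro rfl; exact hdisj _ hr.2 hbq
  by_cases hO : ∃ o ∈ A, o ≠ q ∧ ¬ T.Adj a o
  · obtain ⟨r', hr', hr'q, har'⟩ := hO
    obtain ⟨q', hq', hq'n⟩ := Finset.exists_mem_notMem_of_card_lt_card
      (lt_of_le_of_lt (Finset.card_le_three (a := q) (b := r) (c := r')) (by omega : 3 < A.card))
    simp only [Finset.mem_insert, Finset.mem_singleton, not_or] at hq'n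
    exact k1 r hr.1 r' hr' q' hq' q hq hr.2 har' hbq (fun h => hq'n.1 (hb1 _ hq' h))
      (by rintro rfl; exact har' hr.2) (Ne.symm hq'n.2.1) hr'q (Ne.symm hq'n.2.2) (Ne.symm hq'n.1)
  push Not at hO
  -- Now `b` sees only `q` in `A`, and `a` sees everything except `q`, so `c` has to take part in
  -- one of the two gulls.
  by_cases hc : ∃ r ∈ A, r ≠ q ∧ ¬ T.Adj r c
  · obtain ⟨r, hr, hrq, hrc⟩ := hc
    obtain ⟨r', hr', hr'n⟩ := Finset.exists_mem_notMem_of_card_lt_card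
      (lt_of_le_of_lt (Finset.card_le_two (a := q) (b := r)) (by omega : 2 < A.card))
    simp only [Finset.mem_insert, Finset.mem_singleton, not_or] at hr'n
    refine key {a, r, c} {b, q, r'} (isGull_of (hO r hr hrq) hac hrc)
      (isGull_of hbq (fun h => hr'n.1 (hb1 _ hr' h)) (hind _ hq _ hr')) ?_ ?_ ?_
    · exact disjoint_triples_two_one hAQ (by simp) (by simp) (by simp) hr hq hr' hab' hbc'.symm hrq
        (Ne.symm hr'n.2)
    · simp [Finset.insert_subset_iff, hr]
    · simp [Finset.insert_subset_iff, hq, hr']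
  · push Not at hc
    obtain ⟨r', hr', hr'n⟩ := Finset.exists_mem_notMem_of_card_lt_card
      (lt_of_le_of_lt (Finset.card_le_two (a := q) (b := r)) (by omega : 2 < A.card))
    simp only [Finset.mem_insert, Finset.mem_singleton, not_or] at hr'n
    refine key {c, r, b} {a, r', q} (isGull_of (hc r hr.1 hrq).symm (fun h => hbc h.symm)
      (fun h => hrq (hb1 _ hr.1 h.symm)))
      (isGull_of (hO r' hr' hr'n.1) (fun h => hdisj _ h hbq) (hind _ hr' _ hq)) ?_ ?_ ?_
    · exact disjoint_triples_two_one hAQ (by simp) (by simp) (by simp) hr.1 hr' hq hac'.symm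
        hab'.symm (Ne.symm hr'n.2) hrq
    · simp [Finset.insert_subset_iff, hr.1]
    · simp [Finset.insert_subset_iff, hr', hq]

lemma MaxPacking.exists_edge_rep (htri : ∀ a b c, T.Adj a b → T.Adj b c → ¬ T.Adj a c)
    (hF : MaxPacking T L F) {A : Finset V}
    (hA : A ⊆ rest L F) (hind : ∀ x ∈ A, ∀ y ∈ A, ¬ T.Adj x y) (hcard : 6 ≤ A.card)
    {Q : Finset V} (hQ : Q ∈ F) : ∃ a b c, T.Adj a b ∧ ¬ T.Adj a c ∧ ¬ T.Adj b c ∧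
      Q = {a, b, c} ∧ ∀ x ∈ A, ¬ T.Adj b x := by
  obtain ⟨a, b, c, hab, hac, hbc, rfl⟩ := hF.gull Q hQ
  rcases le_total (A.filter (T.Adj b)).card (A.filter (T.Adj a)).card with h | h
  · exact ⟨a, b, c, hab, hac, hbc, rfl, hF.anticomplete_aux htri hA hind hcard hQ hab hac hbc h⟩
  · have e : ({a, b, c} : Finset V) = {b, a, c} := Finset.insert_comm _ _ _
    refine ⟨b, a, c, hab.symm, hbc, hac, e, ?_⟩
    rw [e] at hQ
    exact hF.anticomplete_aux htri hA hind hcard hQ hab.symm hbc hac h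

/-- `p` lies in the gull `Q`, sees nothing of `A`, and can be exchanged for three vertices of
`A`. -/
def IsSwappable (T : SimpleGraph V) (A Q : Finset V) (p : V) : Prop :=
  p ∈ Q ∧ (∀ x ∈ A, ¬ T.Adj p x) ∧
    3 ≤ (A.filter (fun r => IsGull T (insert r (Q.erase p)))).card

/-- The swappable vertices of a maximum packing extend `A` to a large independent set. -/
lemma MaxPacking.exists_large_indep
    (hF : MaxPacking T L F) {A : Finset V}
    (hA : A ⊆ rest L F) (hind : ∀ x ∈ A, ∀ y ∈ A, ¬ T.Adj x y)
    (hne : A.Nonempty) (hsw : ∀ Q ∈ F, ∃ p, IsSwappable T A Q p) :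
    ∃ I ⊆ L, (∀ x ∈ I, ∀ y ∈ I, ¬ T.Adj x y) ∧ A.card + F.card = I.card := by
  have : ∀ Q, ∃ p, Q ∈ F → IsSwappable T A Q p := by
    intro Q
    by_cases hQ : Q ∈ F
    · obtain ⟨p, hp⟩ := hsw Q hQ
      exact ⟨p, fun _ => hp⟩
    · obtain ⟨x, -⟩ := hne
      exact ⟨x, fun h => (hQ h).elim⟩
  choose p hp using this
  have hinj : Set.InjOn p F := by
    intro Q hQ Q' hQ' h
    by_contra hne
    exact Finset.disjoint_left.1 (hF.disj Q hQ Q' hQ' hne) (hp Q hQ).1 (h ▸ (hp Q' hQ').1)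
  have hAp : Disjoint A (F.image p) := by
    rw [Finset.disjoint_left]
    intro x hx hx'
    obtain ⟨Q, hQ, rfl⟩ := Finset.mem_image.1 hx'
    exact notMem_of_mem_rest hA hQ _ hx (hp Q hQ).1
  refine ⟨A ∪ F.image p, ?_, ?_, ?_⟩
  · refine Finset.union_subset (fun x hx => (mem_rest.1 (hA hx)).1) ?_
    intro x hx
    obtain ⟨Q, hQ, rfl⟩ := Finset.mem_image.1 hx
    exact hF.sub Q hQ (hp Q hQ).1
  -- If `p Q` and `p Q'` were adjacent, exchanging them for distinct `r`, `r'` in `A` would free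
  -- both, and with a third vertex `r''` of `A` they would form a gull in the rest.
  · have hpp : ∀ Q ∈ F, ∀ Q' ∈ F, ¬ T.Adj (p Q) (p Q') := by
      intro Q hQ Q' hQ' hadj
      have hne : Q ≠ Q' := by rintro rfl; exact hadj.ne rfl
      have hQQ := hF.disj Q hQ Q' hQ' hne
      have h3 := (hp Q hQ).2.2
      have h3' := (hp Q' hQ').2.2
      obtain ⟨r, hr⟩ := Finset.card_pos.1 (lt_of_lt_of_le (by norm_num) h3)
      obtain ⟨r', hr', hne'⟩ := Finset.exists_mem_ne (lt_of_lt_of_le (by norm_num) h3') r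
      rw [Finset.mem_filter] at hr hr'
      obtain ⟨r'', hr'', hn⟩ := Finset.exists_mem_notMem_of_card_lt_card
        (lt_of_le_of_lt (Finset.card_le_two (a := r) (b := r')) (lt_of_lt_of_le h3
          (Finset.card_le_card (Finset.filter_subset _ A)) : 2 < A.card))
      simp only [Finset.mem_insert, Finset.mem_singleton, not_or] at hn
      have a1 := notMem_of_mem_rest hA hQ
      have a2 := notMem_of_mem_rest hA hQ'
      have b1 := (hp Q hQ).1
      have b2 := (hp Q' hQ').1
      obtain ⟨h₁, h₂⟩ := hF.exch hQ hr.2 (by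
        intro x hx
        rw [Finset.mem_insert, Finset.mem_erase] at hx
        rcases hx with rfl | hx
        · exact Finset.mem_union_right _ (hA hr.1)
        · exact Finset.mem_union_left _ hx.2)
      have hQ'₁ : Q' ∈ insert (insert r (Q.erase (p Q))) (F.erase Q) := by
        rw [Finset.mem_insert, Finset.mem_erase]
        exact Or.inr ⟨hne.symm, hQ'⟩
      have hnotin : ∀ x ∈ A, x ≠ r → x ∈ rest L (insert (insert r (Q.erase (p Q))) (F.erase Q)) := by
        intro x hx hxr
        rw [h₂, Finset.mem_sdiff]
        refine ⟨Finset.mem_union_right _ (hA hx), ?_⟩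
        rw [Finset.mem_insert, Finset.mem_erase]
        rintro (h | h)
        · exact hxr h
        · exact a1 x hx h.2
      obtain ⟨h₃, h₄⟩ := h₁.exch hQ'₁ hr'.2 (by
        intro x hx
        rw [Finset.mem_insert, Finset.mem_erase] at hx
        rcases hx with rfl | hx
        · exact Finset.mem_union_right _ (hnotin _ hr'.1 hne')
        · exact Finset.mem_union_left _ hx.2)
      refine h₃.no_gull (isGull_of hadj ((hp Q hQ).2.1 r'' hr'') ((hp Q' hQ').2.1 r'' hr'')) ?_
      rw [h₄]
      have c1 : p Q ∉ Q' := fun h => Finset.disjoint_left.1 hQQ b1 h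
      have hpr : p Q ∈ rest L (insert (insert r (Q.erase (p Q))) (F.erase Q)) := by
        rw [h₂, Finset.mem_sdiff, Finset.mem_union, Finset.mem_insert]
        refine ⟨Or.inl b1, ?_⟩
        rintro (h | h)
        · exact a1 r hr.1 (h ▸ b1)
        · exact (Finset.mem_erase.1 h).1 rfl
      have n1 : p Q ≠ r' := fun h => a1 r' hr'.1 (h ▸ b1)
      have n2 : p Q' ≠ r' := fun h => a2 r' hr'.1 (h ▸ b2)
      have n3 := a2 r'' hr''
      have n4 := hnotin r'' hr'' hn.1
      intro x hx
      simp only [Finset.mem_insert, Finset.mem_singleton] at hx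
      rw [Finset.mem_sdiff, Finset.mem_union, Finset.mem_insert, Finset.mem_erase]
      rcases hx with rfl | rfl | rfl
      · exact ⟨Or.inr hpr, by tauto⟩
      · exact ⟨Or.inl b2, by tauto⟩
      · exact ⟨Or.inr n4, by tauto⟩
    intro x hx y hy
    rw [Finset.mem_union] at hx hy
    rcases hx with hx | hx <;> rcases hy with hy | hy
    · exact hind x hx y hy
    · obtain ⟨Q, hQ, rfl⟩ := Finset.mem_image.1 hy
      exact fun h => (hp Q hQ).2.1 x hx h.symm
    · obtain ⟨Q, hQ, rfl⟩ := Finset.mem_image.1 hx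
      exact (hp Q hQ).2.1 y hy
    · obtain ⟨Q, hQ, rfl⟩ := Finset.mem_image.1 hx
      obtain ⟨Q', hQ', rfl⟩ := Finset.mem_image.1 hy
      exact hpp Q hQ Q' hQ'
  · rw [Finset.card_union_of_disjoint hAp, Finset.card_image_of_injOn hinj]

/-- If both `a` and `c` see three common vertices of `A` then `a` can be moved to the side `B`. -/
lemma MaxPacking.false_of_common (htri : ∀ a b c, T.Adj a b → T.Adj b c → ¬ T.Adj a c)
    (hF : MaxPacking T L F) {A B : Finset V} (hAB : IsBiclique T A B) (hd : Disjoint A B)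
    (hR : A ∪ B = rest L F)
    (hmax : ∀ F' A' B', MaxPacking T L F' → IsBiclique T A' B' → Disjoint A' B' →
      A' ∪ B' = rest L F' → A'.card + 1 = A.card → B'.card = B.card + 1 → False)
    {a b c : V} (hQ : {a, b, c} ∈ F) (hab : T.Adj a b) (hac : ¬ T.Adj a c) (hbc : ¬ T.Adj b c)
    (hb : ∀ x ∈ A, ¬ T.Adj b x)
    (h5 : 3 ≤ (A.filter (fun r => T.Adj a r ∧ T.Adj c r)).card) : False := by
  have hA : A ⊆ rest L F := hR ▸ Finset.subset_union_left
  have hAQ := notMem_of_mem_rest hA hQ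
  have hRQ : ∀ x ∈ rest L F, x ∉ ({a, b, c} : Finset V) := notMem_of_mem_rest subset_rfl hQ
  have hac' : a ≠ c := fun h => hbc (h ▸ hab.symm)
  have hbc' : b ≠ c := fun h => hac (h ▸ hab)
  have hab' := hab.ne
  obtain ⟨r, hr⟩ := Finset.card_pos.1 (lt_of_lt_of_le (by norm_num) h5)
  obtain ⟨r₁, hr₁, hne⟩ := Finset.exists_mem_ne (lt_of_lt_of_le (by norm_num) h5) r
  rw [Finset.mem_filter] at hr hr₁
  have hrR := hA hr.1
  -- Replacing the gull by `{c, r, b}` frees `a`. As `a` sees `r₁`, absence of gulls makes it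
  -- complete to `A` without `r`, and absence of triangles makes it anticomplete to `B`. So `a`
  -- joins `B`, against `hmax`.
  obtain ⟨h₃, h₄⟩ := hF.exch hQ (isGull_of hr.2.2 (fun h => hbc h.symm)
    (fun h => hb r hr.1 h.symm)) (by simp [Finset.insert_subset_iff, hrR])
  have hmem : ∀ x, x ∈ rest L (insert {c, r, b} (({a, b, c} : Finset V) |> F.erase)) ↔
      x = a ∨ (x ∈ A ∧ x ≠ r) ∨ x ∈ B := by
    intro x
    rw [h₄, ← hR]
    have e₁ := hAQ r hr.1
    have e₂ : x ∈ A → x ∉ ({a, b, c} : Finset V) := hAQ x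
    have e₃ : x ∈ B → x ∉ ({a, b, c} : Finset V) :=
      fun h => hRQ x (hR ▸ Finset.mem_union_right _ h)
    have e₄ : x ∈ B → x ≠ r := fun h h' => Finset.disjoint_left.1 hd hr.1 (h' ▸ h)
    simp only [Finset.mem_insert, Finset.mem_singleton, not_or, Finset.mem_sdiff,
      Finset.mem_union] at e₁ e₂ e₃ ⊢
    constructor
    · clear * -
      tauto
    · rintro (rfl | h | h)
      · exact ⟨Or.inl (Or.inl rfl), hac', Ne.symm e₁.1, hab'⟩
      · exact ⟨Or.inr (Or.inl h.1), (e₂ h.1).2.2, h.2, (e₂ h.1).2.1⟩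
      · exact ⟨Or.inr (Or.inr h), (e₃ h).2.2, e₄ h, (e₃ h).2.1⟩
  have haA : a ∉ A := fun h => hAQ a h (by simp)
  have haB : a ∉ B := fun h => hRQ a (hR ▸ Finset.mem_union_right _ h) (by simp)
  have haa : ∀ r₂ ∈ A, r₂ ≠ r → T.Adj a r₂ := by
    intro r₂ h₂ hn
    by_contra h
    refine h₃.no_gull (isGull_of hr₁.2.1 h (hAB.left r₁ hr₁.1 r₂ h₂)) ?_
    simp only [Finset.insert_subset_iff, Finset.singleton_subset_iff]
    exact ⟨(hmem _).2 (Or.inl rfl), (hmem _).2 (Or.inr (Or.inl ⟨hr₁.1, hne⟩)),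
      (hmem _).2 (Or.inr (Or.inl ⟨h₂, hn⟩))⟩
  have haB' : ∀ x ∈ B, ¬ T.Adj a x := fun x hx =>
    htri a r₁ x hr₁.2.1 (hAB.adj r₁ hr₁.1 x hx)
  refine hmax _ (A.erase r) (insert a B) h₃ ⟨?_, ?_, ?_⟩ ?_ ?_ ?_ ?_
  · intro x hx y hy
    exact hAB.left x (Finset.mem_of_mem_erase hx) y (Finset.mem_of_mem_erase hy)
  · intro x hx y hy
    rw [Finset.mem_insert] at hx hy
    rcases hx with rfl | hx <;> rcases hy with rfl | hy
    · exact T.irrefl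
    · exact haB' y hy
    · exact fun h => haB' x hx h.symm
    · exact hAB.right x hx y hy
  · intro x hx y hy
    rw [Finset.mem_erase] at hx
    rw [Finset.mem_insert] at hy
    rcases hy with rfl | hy
    · exact (haa x hx.2 hx.1).symm
    · exact hAB.adj x hx.2 y hy
  · rw [Finset.disjoint_insert_right]
    exact ⟨fun h => haA (Finset.mem_of_mem_erase h), hd.mono_left (Finset.erase_subset _ _)⟩
  · ext x
    rw [hmem, Finset.mem_union, Finset.mem_erase, Finset.mem_insert]
    clear * -
    tauto
  · exact Finset.card_erase_add_one hr.1
  · exact Finset.card_insert_of_notMem haB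

/-- In a maximum packing whose rest is a biclique with small side `B` as large as possible, every
gull has a swappable vertex. -/
lemma MaxPacking.exists_swappable (htri : ∀ a b c, T.Adj a b → T.Adj b c → ¬ T.Adj a c)
    (hF : MaxPacking T L F) {A B : Finset V} (hAB : IsBiclique T A B) (hd : Disjoint A B)
    (hR : A ∪ B = rest L F) (hcard : 12 ≤ A.card)
    (hmax : ∀ F' A' B', MaxPacking T L F' → IsBiclique T A' B' → Disjoint A' B' →
      A' ∪ B' = rest L F' → A'.card + 1 = A.card → B'.card = B.card + 1 → False)
    {Q : Finset V} (hQ : Q ∈ F) : ∃ p, IsSwappable T A Q p := by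
  have hA : A ⊆ rest L F := hR ▸ Finset.subset_union_left
  have hAQ := notMem_of_mem_rest hA hQ
  obtain ⟨a, b, c, hab, hac, hbc, rfl, hb⟩ :=
    hF.exists_edge_rep htri hA hAB.left (by omega) hQ
  have hac' : a ≠ c := fun h => hbc (h ▸ hab.symm)
  have hbc' : b ≠ c := fun h => hac (h ▸ hab)
  have hab' := hab.ne
  have eb : ({a, b, c} : Finset V).erase b = {a, c} := by ext x; simp only [Finset.mem_erase, Finset.mem_insert, Finset.mem_singleton]; grind
  have ec : ({a, b, c} : Finset V).erase c = {a, b} := by ext x; simp only [Finset.mem_erase, Finset.mem_insert, Finset.mem_singleton]; grind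
  by_cases h3 : 3 ≤ (A.filter (fun r => ¬ T.Adj a r)).card
  -- `c` is complete or anticomplete to `A`: otherwise exchanging `c` for a vertex missed by `a`
  -- would free a gull `{c, r₁, r₂}`. In the first case `b` is swappable, in the second `c`.
  · have hcA : ∀ r₁ ∈ A, T.Adj c r₁ → ∀ r₂ ∈ A, T.Adj c r₂ := by
      intro r₁ h₁ hc₁ r₂ h₂
      by_contra hc₂
      obtain ⟨r, hr, hn⟩ := Finset.exists_mem_notMem_of_card_lt_card
        (lt_of_le_of_lt (Finset.card_le_two (a := r₁) (b := r₂)) h3)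
      simp only [Finset.mem_insert, Finset.mem_singleton, not_or, Finset.mem_filter] at hn hr
      obtain ⟨h₃, h₄⟩ := hF.exch hQ (isGull_of hab hr.2 (hb r hr.1)) (by
        simp [Finset.insert_subset_iff, hA hr.1])
      refine h₃.no_gull (isGull_of hc₁ hc₂ (hAB.left r₁ h₁ r₂ h₂)) ?_
      rw [h₄]
      have e₁ := hAQ r₁ h₁
      have e₂ := hAQ r₂ h₂
      have e₃ := hAQ r hr.1
      simp only [Finset.mem_insert, Finset.mem_singleton, not_or] at e₁ e₂ e₃
      simp only [Finset.insert_subset_iff, Finset.singleton_subset_iff, Finset.mem_sdiff,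
        Finset.mem_union, Finset.mem_insert, Finset.mem_singleton]
      exact ⟨⟨by simp, by tauto⟩, ⟨Or.inr (hA h₁), by tauto⟩, ⟨Or.inr (hA h₂), by tauto⟩⟩
    by_cases hc : ∃ r₁ ∈ A, T.Adj c r₁
    · obtain ⟨r₁, h₁, hc₁⟩ := hc
      refine ⟨b, by simp, hb, h3.trans (Finset.card_le_card ?_)⟩
      intro r hr
      rw [Finset.mem_filter] at hr ⊢
      refine ⟨hr.1, ?_⟩
      rw [eb]
      exact ⟨r, c, a, (hcA r₁ h₁ hc₁ r hr.1).symm, fun h => hr.2 h.symm, fun h => hac h.symm,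
        by ext x; simp; tauto⟩
    · push Not at hc
      refine ⟨c, by simp, hc, h3.trans (Finset.card_le_card ?_)⟩
      intro r hr
      rw [Finset.mem_filter] at hr ⊢
      refine ⟨hr.1, ?_⟩
      rw [ec]
      exact ⟨a, b, r, hab, hr.2, hb r hr.1, by ext x; simp; tauto⟩
  by_cases h4 : 3 ≤ (A.filter (fun r => T.Adj a r ∧ ¬ T.Adj c r)).card
  · refine ⟨b, by simp, hb, h4.trans (Finset.card_le_card ?_)⟩
    intro r hr
    rw [Finset.mem_filter] at hr ⊢
    refine ⟨hr.1, ?_⟩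
    rw [eb]
    exact ⟨r, a, c, hr.2.1.symm, fun h => hr.2.2 h.symm, hac, rfl⟩
  -- At most two vertices of `A` miss `a` and at most two more see `a` but miss `c`, so at least
  -- eight of the twelve see both.
  exfalso
  refine hF.false_of_common htri hAB hd hR hmax hQ hab hac hbc hb ?_
  have e₁ := Finset.card_filter_add_card_filter_not (s := A) (fun r => T.Adj a r)
  have e₂ := Finset.card_filter_add_card_filter_not (s := A.filter (fun r => T.Adj a r))
    (fun r => T.Adj c r)
  rw [Finset.filter_filter, Finset.filter_filter] at e₂
  omega

end Alpha

/-! ### Both sides large: near vertices, pairs and exchangeable configurations -/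

section Beta

open scoped Classical

variable {V : Type*} {T : SimpleGraph V} {L : Finset V} {F : Finset (Finset V)}

/-- `v` sees all but at most six vertices of `S`. -/
def Near (T : SimpleGraph V) (S : Finset V) (v : V) : Prop :=
  (S.filter (fun u => ¬ T.Adj v u)).card ≤ 6

/-- Six missed and twenty forbidden vertices do not exhaust thirty. -/
lemma Near.exists_adj {S : Finset V} {v : V} (h : Near T S v) (hS : 30 ≤ S.card) {Z : Finset V}
    (hZ : Z.card ≤ 20) : ∃ f ∈ S, f ∉ Z ∧ T.Adj v f := by
  obtain ⟨f, hf, hn⟩ := Finset.exists_mem_notMem_of_card_lt_card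
    (s := Z ∪ S.filter (fun u => ¬ T.Adj v u)) (t := S)
    (lt_of_le_of_lt (Finset.card_union_le _ _) (by unfold Near at h; omega))
  simp only [Finset.mem_union, Finset.mem_filter, not_or, not_and, not_not] at hn
  exact ⟨f, hf, hn.1, hn.2 hf⟩

/-- A large complete bipartite graph spanning the rest of a maximum packing. -/
structure BicliqueRest (T : SimpleGraph V) (L : Finset V) (F : Finset (Finset V))
    (A B : Finset V) : Prop where
  tri : ∀ a b c, T.Adj a b → T.Adj b c → ¬ T.Adj a c
  max : MaxPacking T L F
  bic : IsBiclique T A B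
  disj : Disjoint A B
  union : A ∪ B = rest L F
  cardA : 30 ≤ A.card
  cardB : 30 ≤ B.card

variable {A B : Finset V}

/-- A set of vertices that, together with the rest, contains a gull in many ways. -/
def Robust (T : SimpleGraph V) (A B P : Finset V) : Prop :=
  (∃ w ∈ P, ¬ Near T A w ∧ ¬ Near T B w) ∨
    ∃ x ∈ P, ∃ y ∈ P, Near T B x ∧ Near T A y ∧ ¬ T.Adj x y

lemma Robust.mono {P P' : Finset V} (h : Robust T A B P) (hP : P ⊆ P') : Robust T A B P' := by
  rcases h with ⟨w, hw, h⟩ | ⟨x, hx, y, hy, h⟩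
  · exact Or.inl ⟨w, hP hw, h⟩
  · exact Or.inr ⟨x, hP hx, y, hP hy, h⟩

namespace BicliqueRest

/-- Two vertices near the same large side have a common neighbour there, so an edge between them
would close a triangle. -/
lemma not_adj_of_near (tri : ∀ a b c, T.Adj a b → T.Adj b c → ¬ T.Adj a c) {S : Finset V}
    (hS : 30 ≤ S.card) {x y : V} (hx : Near T S x) (hy : Near T S y) : ¬ T.Adj x y := by
  intro h
  obtain ⟨f, hf, hn, hxf⟩ := hx.exists_adj hS (Z := S.filter (fun u => ¬ T.Adj y u))
    (by unfold Near at hy; omega)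
  simp only [Finset.mem_filter, not_and, not_not] at hn
  exact tri x y f h (hn hf) hxf

variable (H : BicliqueRest T L F A B)
include H

lemma not_both {v : V} (hA : Near T A v) (hB : Near T B v) : False := by
  obtain ⟨a, ha, -, hva⟩ := hA.exists_adj H.cardA (Z := ∅) (by simp)
  obtain ⟨b, hb, -, hvb⟩ := hB.exists_adj H.cardB (Z := ∅) (by simp)
  exact H.tri v a b hva (H.bic.adj a ha b hb) hvb

lemma near_of_memA {v : V} (hv : v ∈ A) : Near T B v := by
  unfold Near
  rw [Finset.filter_false_of_mem]
  · simp
  · intro b hb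
    simpa using H.bic.adj v hv b hb

lemma near_of_memB {v : V} (hv : v ∈ B) : Near T A v := by
  unfold Near
  rw [Finset.filter_false_of_mem]
  · simp
  · intro a ha
    simpa using (H.bic.adj a ha v hv).symm

lemma near_of_rest {v : V} (hv : v ∈ rest L F) : Near T A v ∨ Near T B v := by
  rw [← H.union, Finset.mem_union] at hv
  exact hv.elim (fun h => Or.inr (H.near_of_memA h)) (fun h => Or.inl (H.near_of_memB h))

/-- A far vertex misses more than six vertices on each side, so outside `Z` it misses both ends of
some edge between `A` and `B`. A non-adjacent pair `x`, `y` is completed by a neighbour `f ∈ B` of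
`x`, because `f` and `y` are both near `A`. The allowance of six covers the three vertices of
another gull, or the four that a configuration may have used up. -/
lemma robust_gull {P Z : Finset V} (hP : Robust T A B P) (hZ : Z.card ≤ 6) :
    ∃ S, IsGull T S ∧ S ⊆ P ∪ ((A ∪ B) \ Z) := by
  rcases hP with ⟨w, hw, h₁, h₂⟩ | ⟨x, hx, y, hy, h₁, h₂, h₃⟩
  · unfold Near at h₁ h₂
    obtain ⟨r, hr, hrn⟩ := Finset.exists_mem_notMem_of_card_lt_card (lt_of_le_of_lt hZ (not_le.1 h₁))
    obtain ⟨r', hr', hrn'⟩ :=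
      Finset.exists_mem_notMem_of_card_lt_card (lt_of_le_of_lt hZ (not_le.1 h₂))
    rw [Finset.mem_filter] at hr hr'
    refine ⟨{r, r', w}, isGull_of (H.bic.adj r hr.1 r' hr'.1) (fun h => hr.2 h.symm)
      (fun h => hr'.2 h.symm), ?_⟩
    simp [Finset.insert_subset_iff, hr.1, hr'.1, hw, hrn, hrn']
  · obtain ⟨f, hf, hfn, hxf⟩ := h₁.exists_adj H.cardB (Z := Z) (by omega)
    refine ⟨{x, f, y}, isGull_of hxf h₃ (not_adj_of_near H.tri H.cardA (H.near_of_memB hf) h₂), ?_⟩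
    simp [Finset.insert_subset_iff, hf, hfn, hx, hy]

/-- The second gull can be found avoiding the first, against `no_two`. Applied to singletons, this
shows that no member contains two far vertices. -/
lemma not_two_robust {Q P P' : Finset V} (hQ : Q ∈ F) (hP : P ⊆ Q) (hP' : P' ⊆ Q)
    (hd : Disjoint P P') (h : Robust T A B P) (h' : Robust T A B P') : False := by
  have hRQ : ∀ x ∈ rest L F, x ∉ Q := notMem_of_mem_rest subset_rfl hQ
  obtain ⟨S, hS, hSs⟩ := H.robust_gull h (Z := ∅) (by simp)
  obtain ⟨S', hS', hSs'⟩ := H.robust_gull h' (Z := S) (by rw [hS.card]; omega)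
  rw [H.union] at hSs hSs'
  refine H.max.no_two hQ hS hS' ?_ (hSs.trans ?_) (hSs'.trans ?_)
  · rw [Finset.disjoint_left]
    intro v hv hv'
    have h₁ := hSs hv
    have h₂ := hSs' hv'
    simp only [Finset.mem_union, Finset.mem_sdiff, Finset.notMem_empty, not_false_eq_true,
      and_true] at h₁ h₂
    rcases h₂ with h₂ | h₂
    · rcases h₁ with h₁ | h₁
      · exact Finset.disjoint_left.1 hd h₁ h₂
      · exact hRQ v h₁ (hP' h₂)
    · exact h₂.2 hv
  · exact Finset.union_subset_union hP Finset.sdiff_subset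
  · exact Finset.union_subset_union hP' Finset.sdiff_subset

end BicliqueRest

/-- The functions `x`, `y`, `a` describe each member of the packing without far vertex as a
non-adjacent pair `x`, `y` of vertices near `B` and near `A`, and a spare vertex `a`. -/
def IsPairing (T : SimpleGraph V) (A B : Finset V) (F₀ : Finset (Finset V))
    (x y a : Finset V → V) : Prop :=
  ∀ Q ∈ F₀, Q = {x Q, y Q, a Q} ∧ Near T B (x Q) ∧ Near T A (y Q) ∧ ¬ T.Adj (x Q) (y Q) ∧
    a Q ≠ x Q ∧ a Q ≠ y Q ∧ ((Near T A (a Q) ∧ T.Adj (x Q) (a Q)) ∨ Near T B (a Q))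

lemma IsPairing.x_mem {F₀ : Finset (Finset V)} {x y a : Finset V → V}
    (h : IsPairing T A B F₀ x y a) {Q : Finset V} (hQ : Q ∈ F₀) : x Q ∈ Q :=
  (Finset.ext_iff.1 (h Q hQ).1 _).2 (by simp)

lemma IsPairing.y_mem {F₀ : Finset (Finset V)} {x y a : Finset V → V}
    (h : IsPairing T A B F₀ x y a) {Q : Finset V} (hQ : Q ∈ F₀) : y Q ∈ Q :=
  (Finset.ext_iff.1 (h Q hQ).1 _).2 (by simp)

/-- The members of the packing all of whose vertices are near `A` or near `B`. -/
noncomputable def nearMembers (T : SimpleGraph V) (A B : Finset V) (F : Finset (Finset V)) :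
    Finset (Finset V) := F.filter (fun Q => ∀ w ∈ Q, Near T A w ∨ Near T B w)

/-- Vertices near the same side are non-adjacent, so the edge of the gull has one end near each
side. The third vertex is paired with the end near the other side than itself; the remaining end is
the spare. -/
lemma BicliqueRest.exists_pairing (H : BicliqueRest T L F A B) :
    ∃ x y a, IsPairing T A B (nearMembers T A B F) x y a := by
  have : ∀ Q, ∃ p : V × V × V, Q ∈ nearMembers T A B F → Q = {p.1, p.2.1, p.2.2} ∧ Near T B p.1 ∧
      Near T A p.2.1 ∧ ¬ T.Adj p.1 p.2.1 ∧ p.2.2 ≠ p.1 ∧ p.2.2 ≠ p.2.1 ∧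
      ((Near T A p.2.2 ∧ T.Adj p.1 p.2.2) ∨ Near T B p.2.2) := by
    intro Q
    by_cases hQ : Q ∈ nearMembers T A B F
    · have key : ∀ a b c, T.Adj a b → ¬ T.Adj a c → ¬ T.Adj b c → Q = {a, b, c} → Near T A a →
          Near T B b → ∃ p : V × V × V, Q ∈ nearMembers T A B F → Q = {p.1, p.2.1, p.2.2} ∧ Near T B p.1 ∧
      Near T A p.2.1 ∧ ¬ T.Adj p.1 p.2.1 ∧ p.2.2 ≠ p.1 ∧ p.2.2 ≠ p.2.1 ∧
      ((Near T A p.2.2 ∧ T.Adj p.1 p.2.2) ∨ Near T B p.2.2) := by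
        intro a b c hab hac hbc hQe ha hb
        have hac' : a ≠ c := fun h => hbc (h ▸ hab.symm)
        have hbc' : b ≠ c := fun h => hac (h ▸ hab)
        rcases (Finset.mem_filter.1 hQ).2 c (by simp [hQe]) with hc | hc
        · refine ⟨(b, c, a), fun _ => ⟨?_, hb, hc, hbc, hab.ne, hac', Or.inl ⟨ha, hab.symm⟩⟩⟩
          rw [hQe]
          ext v
          simp only [Finset.mem_insert, Finset.mem_singleton]
          clear * -
          tauto
        · refine ⟨(c, a, b), fun _ => ⟨?_, hc, ha, fun h => hac h.symm, hbc', hab.ne', Or.inr hb⟩⟩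
          rw [hQe]
          ext v
          simp only [Finset.mem_insert, Finset.mem_singleton]
          clear * -
          tauto
      have hQF := (Finset.mem_filter.1 hQ)
      obtain ⟨a, b, c, hab, hac, hbc, hQe⟩ := H.max.gull Q hQF.1
      rcases hQF.2 a (by simp [hQe]) with ha | ha
      · rcases hQF.2 b (by simp [hQe]) with hb | hb
        · exact (BicliqueRest.not_adj_of_near H.tri H.cardA ha hb hab).elim
        · exact key a b c hab hac hbc hQe ha hb
      · rcases hQF.2 b (by simp [hQe]) with hb | hb
        · exact key b a c hab.symm hbc hac (by rw [hQe]; exact Finset.insert_comm _ _ _) hb ha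
        · exact (BicliqueRest.not_adj_of_near H.tri H.cardB ha hb hab).elim
    · obtain ⟨v, -⟩ : A.Nonempty := Finset.card_pos.1 (by have := H.cardA; omega)
      exact ⟨(v, v, v), fun h => (hQ h).elim⟩
  choose p hp using this
  exact ⟨fun Q => (p Q).1, fun Q => (p Q).2.1, fun Q => (p Q).2.2, hp⟩

/-- The near vertices of `L` that are not in one of the chosen pairs. -/
def Uncovered (T : SimpleGraph V) (L A B : Finset V) (F₀ : Finset (Finset V))
    (x y : Finset V → V) (v : V) : Prop :=
  v ∈ L ∧ (Near T A v ∨ Near T B v) ∧ ∀ Q ∈ F₀, v ≠ x Q ∧ v ≠ y Q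

/-- `F'` is a maximum packing missing `u` and most of `A ∪ B` in which the pairs outside `D` still
lie in members and every uncovered vertex near `A` is missed or exchangeable. -/
structure Config (T : SimpleGraph V) (L A B : Finset V) (F₀ : Finset (Finset V))
    (x y a : Finset V → V) (D F' : Finset (Finset V)) (u : V) : Prop where
  max : MaxPacking T L F'
  free : u ∈ rest L F'
  reserve : ((A ∪ B) \ (rest L F').erase u).card ≤ 4
  pairs : ∀ Q ∈ F₀, Q ∉ D → ∃ e, {x Q, y Q, e} ∈ F' ∧ e ≠ x Q ∧ e ≠ y Q ∧
    ((Near T A e ∧ T.Adj (x Q) e) ∨ (e = a Q ∧ Near T B e))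
  unc : ∀ v, Uncovered T L A B F₀ x y v → Near T A v →
    v ∈ rest L F' ∨ ∃ S ∈ F', v ∈ S ∧ Robust T A B (S.erase v)

lemma Config.mono {F₀ D D' F' : Finset (Finset V)} {x y a : Finset V → V} {u : V}
    (h : Config T L A B F₀ x y a D F' u) (hD : D ⊆ D') : Config T L A B F₀ x y a D' F' u :=
  { h with pairs := fun Q hQ hQD => h.pairs Q hQ (fun h' => hQD (hD h')) }

/-- The pair of `Q` can be broken up, making `x Q` free. -/
def Reached (T : SimpleGraph V) (L A B : Finset V) (F₀ : Finset (Finset V))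
    (x y a : Finset V → V) (D : Finset (Finset V)) (Q : Finset V) : Prop :=
  ∃ F' e, Config T L A B F₀ x y a D F' (x Q) ∧ e ∈ rest L F' ∧ e ≠ x Q ∧
    ((Near T A e ∧ T.Adj (x Q) e) ∨ (e = a Q ∧ Near T B e)) ∧
    ((A ∪ B) \ ((rest L F').erase (x Q)).erase e).card ≤ 4

lemma Reached.mono {F₀ D D' : Finset (Finset V)} {x y a : Finset V → V} {Q : Finset V}
    (h : Reached T L A B F₀ x y a D Q) (hD : D ⊆ D') : Reached T L A B F₀ x y a D' Q := by
  obtain ⟨F', e, h₁, h₂⟩ := h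
  exact ⟨F', e, h₁.mono hD, h₂⟩

section

variable {x y a : Finset V → V}

/-- Removing an uncovered vertex from its member leaves either the chosen pair or a far vertex, and
both are robust. -/
lemma IsPairing.uncovered_cases
    (hp : IsPairing T A B (nearMembers T A B F) x y a) {v : V}
    (hv : Uncovered T L A B (nearMembers T A B F) x y v) :
    v ∈ rest L F ∨ ∃ Q ∈ F, v ∈ Q ∧ Robust T A B (Q.erase v) := by
  by_cases h : v ∈ rest L F
  · exact Or.inl h
  · right
    rw [mem_rest] at h
    push Not at h
    obtain ⟨Q, hQ, hvQ⟩ := h hv.1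
    refine ⟨Q, hQ, hvQ, ?_⟩
    by_cases hQn : Q ∈ nearMembers T A B F
    · obtain ⟨h₁, h₂, h₃, h₄, -⟩ := hp Q hQn
      have h₅ := hv.2.2 Q hQn
      refine Or.inr ⟨x Q, ?_, y Q, ?_, h₂, h₃, h₄⟩
      · rw [Finset.mem_erase]
        exact ⟨h₅.1.symm, hp.x_mem hQn⟩
      · rw [Finset.mem_erase]
        exact ⟨h₅.2.symm, hp.y_mem hQn⟩
    · rw [nearMembers, Finset.mem_filter] at hQn
      push Not at hQn
      obtain ⟨w, hw, hw'⟩ := hQn hQ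
      refine Or.inl ⟨w, Finset.mem_erase.2 ⟨?_, hw⟩, hw'⟩
      rintro rfl
      exact hv.2.1.elim hw'.1 hw'.2

/-- A single exchange that frees `u`. Only vertices of the new gull leave the rest, so at most three
vertices of `A ∪ B` are lost. -/
lemma BicliqueRest.config_of_exch (H : BicliqueRest T L F A B)
    (hp : IsPairing T A B (nearMembers T A B F) x y a) {u : V} {Q S : Finset V} (hQ : Q ∈ F)
    (hu : u ∈ Q) (hS : IsGull T S) (hSQ : S ⊆ Q ∪ rest L F) (huS : u ∉ S)
    (hrob : Robust T A B (S ∩ Q))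
    (hvS : ∀ v ∈ Q, Uncovered T L A B (nearMembers T A B F) x y v → Near T A v → v ∉ S)
    (hpair : Q ∈ nearMembers T A B F → ∃ e ∈ B, S = {x Q, y Q, e} ∧ T.Adj (x Q) e) :
    ∃ F', Config T L A B (nearMembers T A B F) x y a ∅ F' u ∧
      ((A ∪ B) \ (rest L F').erase u).card ≤ 3 := by
  obtain ⟨h₁, h₂⟩ := H.max.exch hQ hS hSQ
  have hRQ : ∀ x ∈ rest L F, x ∉ Q := notMem_of_mem_rest subset_rfl hQ
  have hres : ((A ∪ B) \ (rest L (insert S (F.erase Q))).erase u).card ≤ 3 := by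
    rw [← hS.card, h₂, H.union]
    refine Finset.card_le_card fun v hv => ?_
    rw [Finset.mem_sdiff, Finset.mem_erase, Finset.mem_sdiff, Finset.mem_union] at hv
    by_contra hvS
    exact hv.2 ⟨fun h => hRQ v hv.1 (h ▸ hu), Or.inr hv.1, hvS⟩
  refine ⟨_, ⟨h₁, ?_, hres.trans (by norm_num), ?_, ?_⟩, hres⟩
  · rw [h₂, Finset.mem_sdiff, Finset.mem_union]
    exact ⟨Or.inl hu, huS⟩
  · intro Q' hQ' _
    by_cases hQQ : Q' = Q
    · subst hQQ
      obtain ⟨e, he, hSe, hadj⟩ := hpair hQ'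
      have heQ : e ∉ Q' := hRQ e (H.union ▸ Finset.mem_union_right _ he)
      rw [(hp Q' hQ').1] at heQ
      simp only [Finset.mem_insert, Finset.mem_singleton, not_or] at heQ
      exact ⟨e, by rw [← hSe]; exact Finset.mem_insert_self _ _, heQ.1, heQ.2.1,
        Or.inl ⟨H.near_of_memB he, hadj⟩⟩
    · obtain ⟨g₁, g₂, g₃, g₄, g₅, g₆, g₇⟩ := hp Q' hQ'
      refine ⟨a Q', ?_, g₅, g₆, ?_⟩
      · rw [← g₁, Finset.mem_insert, Finset.mem_erase]
        exact Or.inr ⟨hQQ, (Finset.mem_filter.1 hQ').1⟩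
      · exact g₇.imp id fun h => ⟨rfl, h⟩
  · intro v hv hvA
    rcases hp.uncovered_cases hv with hvR | ⟨Q', hQ', hvQ', hrob'⟩
    · by_cases hvS' : v ∈ S
      · refine Or.inr ⟨S, Finset.mem_insert_self _ _, hvS', hrob.mono fun z hz => ?_⟩
        rw [Finset.mem_inter] at hz
        exact Finset.mem_erase.2 ⟨fun h => hRQ v hvR (h ▸ hz.2), hz.1⟩
      · left
        rw [h₂, Finset.mem_sdiff, Finset.mem_union]
        exact ⟨Or.inr hvR, hvS'⟩
    · by_cases hQQ : Q' = Q
      · subst hQQ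
        left
        rw [h₂, Finset.mem_sdiff, Finset.mem_union]
        exact ⟨Or.inl hvQ', hvS v hvQ' hv hvA⟩
      · exact Or.inr ⟨Q', Finset.mem_insert_of_mem (Finset.mem_erase.2 ⟨hQQ, hQ'⟩), hvQ', hrob'⟩

/-- If `u` is missed already, nothing has to be done. In a near member a vertex of `B` takes its
place beside the pair. A member with a far vertex is replaced by a gull made of that vertex and two
vertices of the rest. -/
lemma BicliqueRest.exists_config (H : BicliqueRest T L F A B)
    (hp : IsPairing T A B (nearMembers T A B F) x y a) {u : V}
    (hu : Uncovered T L A B (nearMembers T A B F) x y u) :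
    ∃ F', Config T L A B (nearMembers T A B F) x y a ∅ F' u ∧
      ((A ∪ B) \ (rest L F').erase u).card ≤ 3 := by
  by_cases huR : u ∈ rest L F
  · have hres : ((A ∪ B) \ (rest L F).erase u).card ≤ 3 := by
      rw [H.union]
      refine (Finset.card_le_card (t := {u}) fun v hv => ?_).trans (by simp)
      rw [Finset.mem_sdiff, Finset.mem_erase] at hv
      rw [Finset.mem_singleton]
      by_contra h
      exact hv.2 ⟨h, hv.1⟩
    refine ⟨F, ⟨H.max, huR, hres.trans (by norm_num), fun Q hQ _ => ?_, fun v hv _ =>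
      hp.uncovered_cases hv⟩, hres⟩
    obtain ⟨g₁, g₂, g₃, g₄, g₅, g₆, g₇⟩ := hp Q hQ
    exact ⟨a Q, g₁ ▸ (Finset.mem_filter.1 hQ).1, g₅, g₆, g₇.imp id fun h => ⟨rfl, h⟩⟩
  · have := huR
    rw [mem_rest] at this
    push Not at this
    obtain ⟨Q, hQ, huQ⟩ := this hu.1
    have hRQ : ∀ x ∈ rest L F, x ∉ Q := notMem_of_mem_rest subset_rfl hQ
    by_cases hQn : Q ∈ nearMembers T A B F
    · obtain ⟨g₁, g₂, g₃, g₄, g₅, g₆, g₇⟩ := hp Q hQn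
      obtain ⟨f, hf, -, hxf⟩ := g₂.exists_adj H.cardB (Z := ∅) (by simp)
      have hfR : f ∈ rest L F := H.union ▸ Finset.mem_union_right _ hf
      have hxQ := hp.x_mem hQn
      have hyQ := hp.y_mem hQn
      refine H.config_of_exch hp hQ huQ (S := {x Q, f, y Q}) (isGull_of hxf g₄
        (not_adj_of_near H.tri H.cardA (H.near_of_memB hf) g₃)) ?_ ?_ ?_ ?_ ?_
      · simp [Finset.insert_subset_iff, hfR, hxQ, hyQ]
      · have := hu.2.2 Q hQn
        simp only [Finset.mem_insert, Finset.mem_singleton, not_or]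
        exact ⟨this.1, fun h => huR (h ▸ hfR), this.2⟩
      · exact Or.inr ⟨x Q, by simp [hxQ], y Q, by simp [hyQ], g₂, g₃, g₄⟩
      · intro v hvQ hv hvA hvS
        have := hv.2.2 Q hQn
        simp only [Finset.mem_insert, Finset.mem_singleton] at hvS
        rcases hvS with h | h | h
        · exact this.1 h
        · exact hRQ f hfR (h ▸ hvQ)
        · exact this.2 h
      · refine fun _ => ⟨f, hf, ?_, hxf⟩
        rw [Finset.pair_comm]
    · have hQn' := hQn
      rw [nearMembers, Finset.mem_filter] at hQn'
      push Not at hQn'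
      obtain ⟨w, hw, hwA, hwB⟩ := hQn' hQ
      have hwn : ∀ v, Uncovered T L A B (nearMembers T A B F) x y v → v ≠ w := by
        rintro v hv rfl
        exact hv.2.1.elim hwA hwB
      obtain ⟨S, hS, hSs⟩ := H.robust_gull (P := {w}) (Z := ∅)
        (Or.inl ⟨w, by simp, hwA, hwB⟩) (by simp)
      have hSs' : ∀ v ∈ S, v = w ∨ v ∈ rest L F := by
        intro v hv
        have := hSs hv
        rw [H.union] at this
        simpa using this
      have hwS : w ∈ S := by
        by_contra hwS
        exact H.max.no_gull hS fun v hv => (hSs' v hv).resolve_left fun h => hwS (h ▸ hv)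
      refine H.config_of_exch hp hQ huQ hS ?_ ?_ ?_ ?_ ?_
      · intro v hv
        rw [Finset.mem_union]
        exact (hSs' v hv).imp (fun h => by rw [h]; exact hw) id
      · exact fun h => (hSs' u h).elim (hwn u hu) huR
      · exact Or.inl ⟨w, by simp [hwS, hw], hwA, hwB⟩
      · exact fun v hvQ hv _ hvS => (hSs' v hvS).elim (hwn v hv) fun h => hRQ v h hvQ
      · exact fun h => (hQn h).elim

/-- One step of an alternating path: `{u, y Q, f}` replaces the member containing the pair of `Q`,
freeing `x Q` and its companion `e`. The spent vertices `u` and `f` are already discounted in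
`hres`, so the bound four survives chains of any length. -/
lemma BicliqueRest.reached_mem (H : BicliqueRest T L F A B)
    (hp : IsPairing T A B (nearMembers T A B F) x y a) {D F' : Finset (Finset V)} {u f : V}
    (hC : Config T L A B (nearMembers T A B F) x y a D F' u) (hu : Near T B u)
    {Q : Finset V} (hQ : Q ∈ nearMembers T A B F) (hQD : Q ∉ D) (huy : ¬ T.Adj u (y Q))
    (hf : f ∈ rest L F') (hg : IsGull T {u, y Q, f})
    (hres : ((A ∪ B) \ ((rest L F').erase u).erase f).card ≤ 4) :
    Reached T L A B (nearMembers T A B F) x y a (insert Q D) Q := by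
  obtain ⟨e, hSF, hex, hey, he⟩ := hC.pairs Q hQ hQD
  obtain ⟨g₁, g₂, g₃, g₄, g₅, g₆, g₇⟩ := hp Q hQ
  have hRS := notMem_of_mem_rest (subset_refl (rest L F')) hSF
  have hxy : x Q ≠ y Q := fun h => H.not_both g₃ (h ▸ g₂)
  obtain ⟨h₁, h₂⟩ := hC.max.exch hSF hg (by
    simp [Finset.insert_subset_iff, hC.free, hf])
  have hmem : ∀ z, z ∈ rest L (insert {u, y Q, f} (F'.erase {x Q, y Q, e})) ↔
      z = x Q ∨ z = e ∨ (z ∈ rest L F' ∧ z ≠ u ∧ z ≠ f) := by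
    intro z
    rw [h₂, Finset.mem_sdiff, Finset.mem_union]
    have e₁ := hRS z
    have e₂ := hRS u hC.free
    have e₃ := hRS f hf
    simp only [Finset.mem_insert, Finset.mem_singleton, not_or] at e₁ e₂ e₃ ⊢
    constructor
    · clear * -
      tauto
    · rintro (rfl | rfl | h)
      · exact ⟨Or.inl (Or.inl rfl), Ne.symm e₂.1, hxy, Ne.symm e₃.1⟩
      · exact ⟨Or.inl (Or.inr (Or.inr rfl)), Ne.symm e₂.2.2, hey, Ne.symm e₃.2.2⟩
      · exact ⟨Or.inr h.1, h.2.1, (e₁ h.1).2.1, h.2.2⟩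
  have hres' : ((A ∪ B) \ ((rest L (insert {u, y Q, f} (F'.erase {x Q, y Q, e}))).erase
      (x Q)).erase e).card ≤ 4 := by
    refine (Finset.card_le_card fun z hz => ?_).trans hres
    rw [Finset.mem_sdiff, Finset.mem_erase, Finset.mem_erase] at hz ⊢
    refine ⟨hz.1, fun h => hz.2 ?_⟩
    have e₁ := hRS z h.2.2
    simp only [Finset.mem_insert, Finset.mem_singleton, not_or] at e₁
    exact ⟨e₁.2.2, e₁.1, (hmem z).2 (Or.inr (Or.inr ⟨h.2.2, h.2.1, h.1⟩))⟩
  refine ⟨_, e, ⟨h₁, (hmem _).2 (Or.inl rfl), ?_, ?_, ?_⟩, (hmem _).2 (Or.inr (Or.inl rfl)), hex, he,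
    hres'⟩
  · refine (Finset.card_le_card fun z hz => ?_).trans hres'
    rw [Finset.mem_sdiff] at hz ⊢
    exact ⟨hz.1, fun h => hz.2 (Finset.mem_of_mem_erase h)⟩
  · intro Q' hQ' hQD'
    rw [Finset.mem_insert, not_or] at hQD'
    obtain ⟨e', hSF', hr⟩ := hC.pairs Q' hQ' hQD'.2
    refine ⟨e', ?_, hr⟩
    rw [Finset.mem_insert, Finset.mem_erase]
    -- The pair of `Q'` is not broken up: if the two members coincided, `x Q'` and `y Q'` would both
    -- equal `e`, a vertex near both sides.
    refine Or.inr ⟨fun hEq => ?_, hSF'⟩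
    obtain ⟨k₁, k₂, k₃, -⟩ := hp Q' hQ'
    have hdis := H.max.disj Q' (Finset.mem_filter.1 hQ').1 Q (Finset.mem_filter.1 hQ).1 hQD'.1
    have c₁ : x Q' ∉ Q := Finset.disjoint_left.1 hdis (hp.x_mem hQ')
    have c₂ : y Q' ∉ Q := Finset.disjoint_left.1 hdis (hp.y_mem hQ')
    have d₁ : x Q' ∈ ({x Q, y Q, e} : Finset V) := hEq ▸ by simp
    have d₂ : y Q' ∈ ({x Q, y Q, e} : Finset V) := hEq ▸ by simp
    rw [g₁] at c₁ c₂
    simp only [Finset.mem_insert, Finset.mem_singleton, not_or] at c₁ c₂ d₁ d₂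
    have d₃ : x Q' = e := (d₁.resolve_left c₁.1).resolve_left c₁.2.1
    have d₄ : y Q' = e := (d₂.resolve_left c₂.1).resolve_left c₂.2.1
    exact H.not_both k₃ (d₄ ▸ d₃ ▸ k₂)
  · intro v hv hvA
    have hvQ := hv.2.2 Q hQ
    rcases hC.unc v hv hvA with hvR | ⟨S, hS, hvS, hrob⟩
    · have hvu : v ≠ u := fun h => H.not_both hvA (h ▸ hu)
      by_cases hvf : v = f
      · refine Or.inr ⟨_, Finset.mem_insert_self _ _, by simp [hvf],
          Or.inr ⟨u, ?_, y Q, ?_, hu, g₃, huy⟩⟩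
        · simp [hvu.symm]
        · simp [hvQ.2.symm]
      · exact Or.inl ((hmem v).2 (Or.inr (Or.inr ⟨hvR, hvu, hvf⟩)))
    · by_cases hSS : S = {x Q, y Q, e}
      · left
        rw [hSS] at hvS
        simp only [Finset.mem_insert, Finset.mem_singleton] at hvS
        exact (hmem v).2 (Or.inr (Or.inl ((hvS.resolve_left hvQ.1).resolve_left hvQ.2)))
      · exact Or.inr ⟨S, Finset.mem_insert_of_mem (Finset.mem_erase.2 ⟨hSS, hS⟩), hvS, hrob⟩

/-- The end of an alternating path. If `u` missed `v`, a neighbour `f ∈ B` of `u` would give the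
gull `{u, f, v}`. When `v` is not free, robustness provides a gull avoiding `u` and `v` that
replaces the member of `v`; then `{u, f, v}` lies in the new rest. -/
lemma BicliqueRest.adj_of_config (H : BicliqueRest T L F A B)
    {D F' : Finset (Finset V)} {u v : V}
    (hC : Config T L A B (nearMembers T A B F) x y a D F' u) (hu : Near T B u)
    (hv : Uncovered T L A B (nearMembers T A B F) x y v) (hvA : Near T A v) : T.Adj u v := by
  by_contra hadj
  have hfar : ∀ z ∈ A ∪ B, z ∉ (A ∪ B) \ (rest L F').erase u → z ∈ (rest L F').erase u := by
    intro z hz hz'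
    rw [Finset.mem_sdiff, not_and, not_not] at hz'
    exact hz' hz
  have hcard := hC.reserve
  have hgull : ∀ f ∈ B, T.Adj u f → IsGull T {u, f, v} := fun f hf huf =>
    isGull_of huf hadj (not_adj_of_near H.tri H.cardA (H.near_of_memB hf) hvA)
  rcases hC.unc v hv hvA with hvR | ⟨S, hS, hvS, hrob⟩
  · obtain ⟨f, hf, hfn, huf⟩ := hu.exists_adj H.cardB
      (Z := (A ∪ B) \ (rest L F').erase u) (by omega)
    have := Finset.mem_of_mem_erase (hfar f (Finset.mem_union_right _ hf) hfn)
    refine hC.max.no_gull (hgull f hf huf) ?_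
    simp [Finset.insert_subset_iff, this, hvR, hC.free]
  · obtain ⟨S₁, hS₁, hs⟩ := H.robust_gull hrob (Z := (A ∪ B) \ (rest L F').erase u) (by omega)
    have hs' : ∀ z ∈ S₁, (z ≠ v ∧ z ∈ S) ∨ z ∈ (rest L F').erase u := by
      intro z hz
      have := hs hz
      rw [Finset.mem_union, Finset.mem_erase, Finset.mem_sdiff] at this
      exact this.imp id fun h => hfar z h.1 h.2
    have hRS := notMem_of_mem_rest (subset_refl (rest L F')) hS
    obtain ⟨h₁, h₂⟩ := hC.max.exch hS hS₁ (by
      intro z hz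
      rw [Finset.mem_union]
      exact (hs' z hz).imp And.right Finset.mem_of_mem_erase)
    obtain ⟨f, hf, hfn, huf⟩ := hu.exists_adj H.cardB
      (Z := (A ∪ B) \ (rest L F').erase u ∪ S₁)
      (by
        have := Finset.card_union_le ((A ∪ B) \ (rest L F').erase u) S₁
        rw [hS₁.card] at this
        omega)
    rw [Finset.mem_union, not_or] at hfn
    have hfR := Finset.mem_of_mem_erase (hfar f (Finset.mem_union_right _ hf) hfn.1)
    refine h₁.no_gull (hgull f hf huf) ?_
    rw [h₂]
    simp only [Finset.insert_subset_iff, Finset.singleton_subset_iff, Finset.mem_sdiff,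
      Finset.mem_union]
    refine ⟨⟨Or.inr hC.free, fun h => ?_⟩, ⟨Or.inr hfR, hfn.2⟩, ⟨Or.inl hvS, fun h => ?_⟩⟩
    · rcases hs' u h with h | h
      · exact hRS u hC.free h.2
      · exact (Finset.mem_erase.1 h).1 rfl
    · rcases hs' v h with h | h
      · exact h.1 rfl
      · exact hRS v (Finset.mem_of_mem_erase h) hvS

end

end Beta

/-! ### The König-type closure argument and the packing theorem -/

section Closure

open scoped Classical

variable {V : Type*} {T : SimpleGraph V} {L : Finset V} {F : Finset (Finset V)} {A B : Finset V}
  {x y a : Finset V → V}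

lemma IsPairing.uncovered_spare (H : BicliqueRest T L F A B)
    (hp : IsPairing T A B (nearMembers T A B F) x y a) {Q : Finset V}
    (hQ : Q ∈ nearMembers T A B F) :
    Uncovered T L A B (nearMembers T A B F) x y (a Q) := by
  have haQ : a Q ∈ Q := (Finset.ext_iff.1 (hp Q hQ).1 _).2 (by simp)
  have hQF := Finset.mem_filter.1 hQ
  refine ⟨H.max.sub Q hQF.1 haQ, hQF.2 _ haQ, fun Q' hQ' => ?_⟩
  by_cases h : Q' = Q
  · subst h
    exact ⟨(hp Q' hQ).2.2.2.2.1, (hp Q' hQ).2.2.2.2.2.1⟩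
  · have hd := Finset.disjoint_left.1 (H.max.disj Q' (Finset.mem_filter.1 hQ').1 Q hQF.1 h)
    exact ⟨fun h => hd (hp.x_mem hQ') (h ▸ haQ), fun h => hd (hp.y_mem hQ') (h ▸ haQ)⟩

/-- The start of an alternating path: freeing `u` costs at most three vertices of `A ∪ B` and the
completing vertex `f` one more, whence the bound four. -/
lemma BicliqueRest.reached_of_uncovered (H : BicliqueRest T L F A B)
    (hp : IsPairing T A B (nearMembers T A B F) x y a) {D : Finset (Finset V)} {u : V}
    (hu : Uncovered T L A B (nearMembers T A B F) x y u) (huB : Near T B u)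
    {Q : Finset V} (hQ : Q ∈ nearMembers T A B F) (hQD : Q ∉ D) (huy : ¬ T.Adj u (y Q)) :
    Reached T L A B (nearMembers T A B F) x y a (insert Q D) Q := by
  obtain ⟨F', hC, hres⟩ := H.exists_config hp hu
  obtain ⟨f, hf, hfn, huf⟩ := huB.exists_adj H.cardB
    (Z := (A ∪ B) \ (rest L F').erase u) (by omega)
  have hfR : f ∈ (rest L F').erase u := by
    by_contra h
    exact hfn (Finset.mem_sdiff.2 ⟨Finset.mem_union_right _ hf, h⟩)
  refine H.reached_mem hp (hC.mono (Finset.empty_subset D)) huB hQ hQD huy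
    (Finset.mem_of_mem_erase hfR) ?_ ?_ (f := f)
  · refine ⟨u, f, y Q, huf, huy, not_adj_of_near H.tri H.cardA (H.near_of_memB hf) (hp Q hQ).2.2.1,
      ?_⟩
    rw [Finset.pair_comm]
  · have h₁ : (A ∪ B) \ ((rest L F').erase u).erase f ⊆
        insert f ((A ∪ B) \ (rest L F').erase u) := by
      intro z hz
      rw [Finset.mem_sdiff, Finset.mem_erase] at hz
      rw [Finset.mem_insert, Finset.mem_sdiff]
      by_cases h : z = f
      · exact Or.inl h
      · exact Or.inr ⟨hz.1, fun h' => hz.2 ⟨h, h'⟩⟩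
    have := (Finset.card_le_card h₁).trans (Finset.card_insert_le _ _)
    omega

/-- The companion `e` freed with `x Q'` completes the next gull, so nothing new is taken from `A ∪
B`. This fails only when `e` is the spare, near `B` and not adjacent to `y Q`; but the spare is
uncovered, so it starts a fresh path reaching `Q`. -/
lemma BicliqueRest.reached_of_reached (H : BicliqueRest T L F A B)
    (hp : IsPairing T A B (nearMembers T A B F) x y a) {D : Finset (Finset V)} {Q Q' : Finset V}
    (hQ' : Q' ∈ nearMembers T A B F)
    (hr : Reached T L A B (nearMembers T A B F) x y a D Q')
    (hQ : Q ∈ nearMembers T A B F) (hQD : Q ∉ D) (hxy : ¬ T.Adj (x Q') (y Q)) :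
    Reached T L A B (nearMembers T A B F) x y a (insert Q D) Q := by
  obtain ⟨F', e, hC, heR, hex, he, hres⟩ := hr
  obtain ⟨-, hx', -⟩ := hp Q' hQ'
  obtain ⟨-, -, hy, -⟩ := hp Q hQ
  rcases he with ⟨heA, hadj⟩ | ⟨rfl, heB⟩
  · refine H.reached_mem hp hC hx' hQ hQD hxy heR ?_ hres
    refine ⟨x Q', e, y Q, hadj, hxy, not_adj_of_near H.tri H.cardA heA hy, ?_⟩
    rw [Finset.pair_comm]
  · by_cases hay : T.Adj (a Q') (y Q)
    · refine H.reached_mem hp hC hx' hQ hQD hxy heR ?_ hres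
      refine ⟨a Q', y Q, x Q', hay, not_adj_of_near H.tri H.cardB heB hx', fun h => hxy h.symm, ?_⟩
      ext z
      simp only [Finset.mem_insert, Finset.mem_singleton]
      clear * -
      tauto
    · exact H.reached_of_uncovered hp (hp.uncovered_spare H hQ') heB hQ hQD hay

/-- A maximum packing whose rest is a biclique with two large sides yields a biclique avoiding only
one vertex per member of the packing. -/
lemma BicliqueRest.exists_large_biclique (H : BicliqueRest T L F A B) :
    ∃ X Y : Finset V, X ⊆ L ∧ Y ⊆ L ∧ X.Nonempty ∧ Y.Nonempty ∧
      (∀ u ∈ X, ∀ v ∈ Y, T.Adj u v) ∧ L.card ≤ X.card + Y.card + F.card := by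
  obtain ⟨x, y, a, hp⟩ := H.exists_pairing
  have hne : ((nearMembers T A B F).powerset.filter
      (fun D => ∀ Q ∈ D, Reached T L A B (nearMembers T A B F) x y a D Q)).Nonempty :=
    ⟨∅, by simp⟩
  -- `D` is a largest set of members reached within itself; by `Reached.mono`, no member outside `D`
  -- is reached on being added to it.
  obtain ⟨D, hD, hDmax⟩ := Finset.exists_max_image _ Finset.card hne
  rw [Finset.mem_filter, Finset.mem_powerset] at hD
  have hclosed : ∀ Q ∈ nearMembers T A B F, Q ∉ D →
      ¬ Reached T L A B (nearMembers T A B F) x y a (insert Q D) Q := by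
    intro Q hQ hQD hr
    have := hDmax (insert Q D) (by
      rw [Finset.mem_filter, Finset.mem_powerset]
      refine ⟨Finset.insert_subset hQ hD.1, ?_⟩
      simp only [Finset.mem_insert, forall_eq_or_imp]
      exact ⟨hr, fun Q' hQ' => (hD.2 Q' hQ').mono (Finset.subset_insert _ _)⟩)
    rw [Finset.card_insert_of_notMem hQD] at this
    omega
  have hw : ∀ Q, ∃ w, Q ∈ F → Q ∉ nearMembers T A B F →
      w ∈ Q ∧ ¬ Near T A w ∧ ¬ Near T B w := by
    intro Q
    by_cases hQ : Q ∈ F ∧ Q ∉ nearMembers T A B F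
    · have := hQ.2
      rw [nearMembers, Finset.mem_filter] at this
      push Not at this
      obtain ⟨w, hw⟩ := this hQ.1
      exact ⟨w, fun _ _ => hw⟩
    · exact ⟨x Q, fun h h' => (hQ ⟨h, h'⟩).elim⟩
  choose w hw using hw
  -- The deleted vertex, as in König's theorem: `y` for a reached pair, `x` for an unreached one,
  -- and the far vertex in a member that has one.
  let d : Finset V → V := fun Q =>
    if Q ∈ nearMembers T A B F then (if Q ∈ D then y Q else x Q) else w Q
  have hdQ : ∀ Q ∈ F, d Q ∈ Q := by
    intro Q hQ
    simp only [d]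
    split_ifs with h₁ h₂
    · exact hp.y_mem h₁
    · exact hp.x_mem h₁
    · exact (hw Q hQ h₁).1
  have hnear : ∀ v ∈ L \ F.image d, Near T A v ∨ Near T B v := by
    intro v hv
    rw [Finset.mem_sdiff] at hv
    by_contra hfar
    have hvR : v ∉ rest L F := fun h => hfar (H.near_of_rest h)
    rw [mem_rest] at hvR
    push Not at hvR hfar
    obtain ⟨Q, hQ, hvQ⟩ := hvR hv.1
    have hQn : Q ∉ nearMembers T A B F := fun h =>
      ((Finset.mem_filter.1 h).2 v hvQ).elim hfar.1 hfar.2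
    obtain ⟨h₁, h₂⟩ := hw Q hQ hQn
    have hvw : v ≠ w Q := by
      rintro rfl
      exact hv.2 (Finset.mem_image.2 ⟨Q, hQ, by simp [d, hQn]⟩)
    exact H.not_two_robust hQ (P := {v}) (P' := {w Q}) (by simpa using hvQ) (by simpa using h₁)
      (by simpa using hvw) (Or.inl ⟨v, by simp, hfar⟩) (Or.inl ⟨w Q, by simp, h₂⟩)
  have hR : ∀ v ∈ rest L F, v ∈ L \ F.image d := by
    intro v hv
    rw [Finset.mem_sdiff]
    refine ⟨(mem_rest.1 hv).1, fun h => ?_⟩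
    obtain ⟨Q, hQ, rfl⟩ := Finset.mem_image.1 h
    exact (mem_rest.1 hv).2 Q hQ (hdQ Q hQ)
  have hposA : A.Nonempty := Finset.card_pos.1 (by have := H.cardA; omega)
  have hposB : B.Nonempty := Finset.card_pos.1 (by have := H.cardB; omega)
  refine ⟨(L \ F.image d).filter (Near T B), (L \ F.image d).filter (Near T A),
    (Finset.filter_subset _ _).trans Finset.sdiff_subset,
    (Finset.filter_subset _ _).trans Finset.sdiff_subset, ?_, ?_, ?_, ?_⟩
  · obtain ⟨v, hv⟩ := hposA
    exact ⟨v, Finset.mem_filter.2 ⟨hR v (H.union ▸ Finset.mem_union_left _ hv), H.near_of_memA hv⟩⟩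
  · obtain ⟨v, hv⟩ := hposB
    exact ⟨v, Finset.mem_filter.2 ⟨hR v (H.union ▸ Finset.mem_union_right _ hv), H.near_of_memB hv⟩⟩
  · intro u hu v hv
    rw [Finset.mem_filter, Finset.mem_sdiff] at hu hv
    have hu' : Uncovered T L A B (nearMembers T A B F) x y u ∨
        ∃ Q ∈ nearMembers T A B F, Q ∈ D ∧ u = x Q := by
      by_cases h : ∃ Q ∈ nearMembers T A B F, u = x Q
      · obtain ⟨Q, hQ, rfl⟩ := h
        refine Or.inr ⟨Q, hQ, ?_, rfl⟩
        by_contra hQD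
        exact hu.1.2 (Finset.mem_image.2 ⟨Q, (Finset.mem_filter.1 hQ).1, by simp [d, hQ, hQD]⟩)
      · push Not at h
        refine Or.inl ⟨hu.1.1, Or.inr hu.2, fun Q hQ => ⟨h Q hQ, ?_⟩⟩
        rintro rfl
        exact H.not_both (hp Q hQ).2.2.1 hu.2
    have hv' : Uncovered T L A B (nearMembers T A B F) x y v ∨
        ∃ Q ∈ nearMembers T A B F, Q ∉ D ∧ v = y Q := by
      by_cases h : ∃ Q ∈ nearMembers T A B F, v = y Q
      · obtain ⟨Q, hQ, rfl⟩ := h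
        refine Or.inr ⟨Q, hQ, ?_, rfl⟩
        intro hQD
        exact hv.1.2 (Finset.mem_image.2 ⟨Q, (Finset.mem_filter.1 hQ).1, by simp [d, hQ, hQD]⟩)
      · push Not at h
        refine Or.inl ⟨hv.1.1, Or.inl hv.2, fun Q hQ => ⟨?_, h Q hQ⟩⟩
        rintro rfl
        exact H.not_both hv.2 (hp Q hQ).2.1
    -- A surviving `u` can be freed, so it sees every uncovered `v` near `A`. If it missed a
    -- surviving `y Q`, then `Q` would be reached, against the choice of `D`.
    rcases hv' with hv' | ⟨Q, hQ, hQD, rfl⟩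
    · rcases hu' with hu' | ⟨Q', hQ', hQ'D, rfl⟩
      · obtain ⟨F', hC, -⟩ := H.exists_config hp hu'
        exact H.adj_of_config hC hu.2 hv' hv.2
      · obtain ⟨F', e, hC, -⟩ := hD.2 Q' hQ'D
        exact H.adj_of_config hC hu.2 hv' hv.2
    · by_contra hadj
      rcases hu' with hu' | ⟨Q', hQ', hQ'D, rfl⟩
      · exact hclosed Q hQ hQD (H.reached_of_uncovered hp hu' hu.2 hQ hQD hadj)
      · exact hclosed Q hQ hQD (H.reached_of_reached hp hQ' (hD.2 Q' hQ'D) hQ hQD hadj)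
  · have h₁ : (L \ F.image d).card ≤ ((L \ F.image d).filter (Near T B)).card +
        ((L \ F.image d).filter (Near T A)).card := by
      refine (Finset.card_le_card fun v hv => ?_).trans (Finset.card_union_le _ _)
      rw [Finset.mem_union, Finset.mem_filter, Finset.mem_filter]
      exact (hnear v hv).symm.imp (fun h => ⟨hv, h⟩) (fun h => ⟨hv, h⟩)
    have h₂ := Finset.le_card_sdiff (F.image d) L
    have h₃ := Finset.card_image_le (s := F) (f := d)
    omega

/-- Packing gulls in a triangle-free graph without large independent sets and bicliques. -/
theorem exists_gullPacking (tri : ∀ a b c, T.Adj a b → T.Adj b c → ¬ T.Adj a c) {k : ℕ}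
    (hL : 3 * k ≤ L.card)
    (hind : ∀ I ⊆ L, (∀ u ∈ I, ∀ v ∈ I, ¬ T.Adj u v) → I.card + 2 * k ≤ L.card)
    (hbic : ∀ X ⊆ L, ∀ Y ⊆ L, X.Nonempty → Y.Nonempty → (∀ u ∈ X, ∀ v ∈ Y, T.Adj u v) →
      X.card + Y.card + k ≤ L.card) :
    ∃ F, GullPacking T L F ∧ F.card ≤ k ∧ k ≤ F.card + 40 := by
  by_cases hex : ∃ F, MaxPacking T L F ∧ k ≤ F.card + 40
  · obtain ⟨F, hF, hk⟩ := hex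
    obtain ⟨F', hF', hc⟩ := Finset.exists_subset_card_eq (s := F) (n := min k F.card)
      (min_le_right _ _)
    exact ⟨F', ⟨fun S hS => hF.gull S (hF' hS), fun S hS => hF.sub S (hF' hS),
      fun S hS S' hS' => hF.disj S (hF' hS) S' (hF' hS')⟩, by omega, by omega⟩
  · exfalso
    push Not at hex
    -- The smaller side `B` of the rest is taken as large as possible over all maximum packings;
    -- this supplies `hmax` in `exists_swappable`.
    let P : ℕ → Prop := fun b => ∃ F A B, MaxPacking T L F ∧ IsBiclique T A B ∧ Disjoint A B ∧
      A ∪ B = rest L F ∧ B.card ≤ A.card ∧ B.card = b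
    have hP : ∃ b, P b := by
      obtain ⟨F, hF⟩ := exists_maxPacking T L
      obtain ⟨A, B, hAB, hd, hu⟩ := exists_biclique_of_no_gull tri
        (fun S hS hg => hF.no_gull hg hS)
      rcases le_total B.card A.card with h | h
      · exact ⟨_, F, A, B, hF, hAB, hd, hu, h, rfl⟩
      · exact ⟨_, F, B, A, hF, hAB.symm, hd.symm, by rw [Finset.union_comm, hu], h, rfl⟩
    have hPb : ∀ b, P b → b ≤ L.card := by
      rintro b ⟨F, A, B, -, -, -, hu, -, rfl⟩
      refine Finset.card_le_card fun v hv => ?_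
      exact (mem_rest.1 (hu ▸ Finset.mem_union_right A hv)).1
    obtain ⟨b, hb⟩ := hP
    have hPb' := Nat.findGreatest_spec (P := P) (hPb b hb) hb
    have hmaxb : ∀ b, P b → b ≤ Nat.findGreatest P L.card := fun b hb =>
      Nat.le_findGreatest (hPb b hb) hb
    obtain ⟨F, A, B, hF, hAB, hd, hu, hle, hBb⟩ := hPb'
    have hs := hex F hF
    have hcard := hF.card_rest
    rw [← hu, Finset.card_union_of_disjoint hd] at hcard
    -- The rest has more than 120 vertices. If `|B| ≥ 30` there is a biclique on at least `|L| - |F|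
    -- > |L| - k` vertices; otherwise an independent set of size `|L| - 2|F| - |B| > |L| - 2k`.
    by_cases hB : 30 ≤ B.card
    · obtain ⟨X, Y, hX, hY, hXn, hYn, hXY, hc⟩ :=
        BicliqueRest.exists_large_biclique ⟨tri, hF, hAB, hd, hu, by omega, hB⟩
      have := hbic X hX Y hY hXn hYn hXY
      omega
    · have hA : A ⊆ rest L F := hu ▸ Finset.subset_union_left
      obtain ⟨I, hI, hIi, hIc⟩ := hF.exists_large_indep hA hAB.left
        (Finset.card_pos.1 (by omega)) (fun Q hQ => hF.exists_swappable tri hAB hd hu (by omega)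
        (fun F' A' B' h₁ h₂ h₃ h₄ h₅ h₆ => by
          have := hmaxb (B.card + 1) ⟨F', A', B', h₁, h₂, h₃, h₄, by omega, h₆⟩
          omega) hQ)
      have := hind I hI hIi
      omega

end Closure

/-! ### Branch sets, and complete minors from bicliques of the complement -/

section Assembly

open scoped Classical

variable {V : Type*} {G : SimpleGraph V}

/-- The two vertex sets are joined by an edge. -/
def Touches (G : SimpleGraph V) (S S' : Finset V) : Prop := ∃ u ∈ S, ∃ v ∈ S', G.Adj u v

lemma Touches.symm {S S' : Finset V} (h : Touches G S S') : Touches G S' S := by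
  obtain ⟨u, hu, v, hv, h⟩ := h
  exact ⟨v, hv, u, hu, h.symm⟩

/-- Pairwise disjoint connected vertex sets. -/
structure BranchSets (G : SimpleGraph V) (B : Finset (Finset V)) : Prop where
  conn : ∀ S ∈ B, (G.induce (S : Set V)).Connected
  disj : ∀ S ∈ B, ∀ S' ∈ B, S ≠ S' → Disjoint S S'

/-- The ordered pairs of distinct members of the family not joined by an edge. -/
noncomputable def badPairs (G : SimpleGraph V) (B : Finset (Finset V)) :
    Finset (Finset V × Finset V) :=
  (B ×ˢ B).filter (fun p => p.1 ≠ p.2 ∧ ¬ Touches G p.1 p.2)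

lemma connected_induce_singleton (v : V) :
    (G.induce (({v} : Finset V) : Set V)).Connected := by
  rw [Finset.coe_singleton]
  have : Unique ↥({v} : Set V) := Set.uniqueSingleton v
  exact ⟨SimpleGraph.Preconnected.of_subsingleton⟩

lemma connected_induce_pair {u v : V} (h : G.Adj u v) :
    (G.induce (({u, v} : Finset V) : Set V)).Connected := by
  rw [Finset.coe_pair]
  exact G.induce_pair_connected_of_adj h

lemma IsGull.connected {S : Finset V} (h : IsGull Gᶜ S) :
    (G.induce (S : Set V)).Connected := by
  obtain ⟨a, b, c, hab, hac, hbc, rfl⟩ := h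
  have hac' : a ≠ c := fun h => hbc (h ▸ hab.symm)
  have hbc' : b ≠ c := fun h => hac (h ▸ hab)
  rw [SimpleGraph.compl_adj] at hac hbc
  have h₁ : G.Adj a c := by
    by_contra h
    exact hac ⟨hac', h⟩
  have h₂ : G.Adj b c := by
    by_contra h
    exact hbc ⟨hbc', h⟩
  have e : ((({a, b, c} : Finset V)) : Set V) = {a, c} ∪ {c, b} := by
    ext x
    simp only [Finset.coe_insert, Finset.coe_singleton, Set.mem_insert_iff, Set.mem_singleton_iff,
      Set.mem_union]
    clear * -
    tauto
  rw [e]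
  exact SimpleGraph.induce_union_connected (G.induce_pair_connected_of_adj h₁).preconnected
    (G.induce_pair_connected_of_adj h₂.symm).preconnected ⟨c, by simp, by simp⟩

/-- A vertex `v` with no `G`-edge to `a` or `b` would form a triangle of `Gᶜ` with the edge `ab`. -/
lemma IsGull.touches (tri : ∀ a b c, Gᶜ.Adj a b → Gᶜ.Adj b c → ¬ Gᶜ.Adj a c)
    {S S' : Finset V} (h : IsGull Gᶜ S) (hS' : S'.Nonempty) (hd : Disjoint S S') :
    Touches G S S' := by
  obtain ⟨a, b, c, hab, -, -, rfl⟩ := h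
  obtain ⟨v, hv⟩ := hS'
  have hav : a ≠ v := fun h => Finset.disjoint_left.1 hd (by simp) (h ▸ hv)
  have hbv : b ≠ v := fun h => Finset.disjoint_left.1 hd (by simp) (h ▸ hv)
  by_contra h
  refine tri a b v hab ?_ ?_
  · rw [SimpleGraph.compl_adj]
    exact ⟨hbv, fun h' => h ⟨b, by simp, v, hv, h'⟩⟩
  · rw [SimpleGraph.compl_adj]
    exact ⟨hav, fun h' => h ⟨a, by simp, v, hv, h'⟩⟩

lemma BranchSets.nonempty {B : Finset (Finset V)} (hB : BranchSets G B) {S : Finset V}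
    (hS : S ∈ B) : S.Nonempty := by
  obtain ⟨x⟩ := (hB.conn S hS).nonempty
  exact ⟨x.1, x.2⟩

lemma BranchSets.exists_card_eq [Fintype V] {B : Finset (Finset V)} (hB : BranchSets G B) {m : ℕ}
    (hm : m ≤ B.card + (Finset.univ \ B.biUnion id).card) :
    ∃ B', BranchSets G B' ∧ B'.card = m ∧ (B' \ B).card ≤ m - B.card := by
  rcases le_total m B.card with h | h
  · obtain ⟨B', hB', hc⟩ := Finset.exists_subset_card_eq h
    refine ⟨B', ⟨fun S hS => hB.conn S (hB' hS),
      fun S hS S' hS' => hB.disj S (hB' hS) S' (hB' hS')⟩, hc, ?_⟩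
    rw [Finset.sdiff_eq_empty_iff_subset.2 hB']
    simp
  · obtain ⟨W, hW, hc⟩ := Finset.exists_subset_card_eq
      (show m - B.card ≤ (Finset.univ \ B.biUnion id).card by omega)
    have hWB : ∀ v ∈ W, ∀ S ∈ B, v ∉ S := by
      intro v hv S hS hvS
      have := Finset.mem_sdiff.1 (hW hv)
      exact this.2 (Finset.mem_biUnion.2 ⟨S, hS, hvS⟩)
    have hdis : Disjoint B (W.image (fun v => ({v} : Finset V))) := by
      rw [Finset.disjoint_left]
      intro S hS hS'
      obtain ⟨v, hv, rfl⟩ := Finset.mem_image.1 hS'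
      exact hWB v hv _ hS (by simp)
    have hWc : (W.image (fun v => ({v} : Finset V))).card = m - B.card := by
      rw [Finset.card_image_of_injective _ Finset.singleton_injective, hc]
    refine ⟨B ∪ W.image (fun v => {v}), ⟨?_, ?_⟩, ?_, ?_⟩
    · intro S hS
      rcases Finset.mem_union.1 hS with h | h
      · exact hB.conn S h
      · obtain ⟨v, hv, rfl⟩ := Finset.mem_image.1 h
        exact connected_induce_singleton v
    · intro S hS S' hS' hne
      rcases Finset.mem_union.1 hS with h | h <;> rcases Finset.mem_union.1 hS' with h' | h'
      · exact hB.disj S h S' h' hne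
      · obtain ⟨v, hv, rfl⟩ := Finset.mem_image.1 h'
        exact Finset.disjoint_singleton_right.2 (hWB v hv S h)
      · obtain ⟨v, hv, rfl⟩ := Finset.mem_image.1 h
        exact Finset.disjoint_singleton_left.2 (hWB v hv S' h')
      · obtain ⟨v, hv, rfl⟩ := Finset.mem_image.1 h
        obtain ⟨v', hv', rfl⟩ := Finset.mem_image.1 h'
        rw [Finset.disjoint_singleton]
        exact fun h => hne (by rw [h])
    · rw [Finset.card_union_of_disjoint hdis, hWc]
      omega
    · rw [Finset.union_sdiff_left, ← hWc]
      exact Finset.card_le_card Finset.sdiff_subset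

/-- Disjoint connected vertex sets, topped up with singletons, give a minor on `m` vertices. -/
lemma BranchSets.exists_minor [Fintype V] {B : Finset (Finset V)} (hB : BranchSets G B) {m : ℕ}
    (hm : m ≤ B.card + (Finset.univ \ B.biUnion id).card) :
    ∃ H : SimpleGraph (Fin m), H.IsMinor G ∧
      m * (m - 1) ≤ 2 * H.edgeSet.ncard + (badPairs G B).card + 2 * (m * (m - B.card)) := by
  obtain ⟨C, hC, hCm, hCB⟩ := hB.exists_card_eq hm
  let e : Fin m ≃ C := (Fintype.equivFinOfCardEq (by simpa using hCm)).symm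
  let H : SimpleGraph (Fin m) :=
    { Adj := fun i j => i ≠ j ∧ Touches G (e i).1 (e j).1
      symm := ⟨fun i j h => ⟨h.1.symm, h.2.symm⟩⟩
      loopless := ⟨fun i h => h.1 rfl⟩ }
  refine ⟨H, ⟨fun i => ((e i).1 : Set V), fun i => hC.conn _ (e i).2, fun i j hij => ?_,
    fun i j hij => ?_⟩, ?_⟩
  · rw [Finset.disjoint_coe]
    refine hC.disj _ (e i).2 _ (e j).2 fun h => hij ?_
    exact e.injective (Subtype.ext h)
  · obtain ⟨-, u, hu, v, hv, h⟩ := hij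
    exact ⟨u, hu, v, hv, h⟩
  · have h₁ : 2 * H.edgeSet.ncard =
        ((Finset.univ : Finset (Fin m × Fin m)).filter (fun p => H.Adj p.1 p.2)).card := by
      rw [← SimpleGraph.coe_edgeFinset, Set.ncard_coe_finset,
        ← H.sum_degrees_eq_twice_card_edges, Finset.card_filter, Fintype.sum_prod_type]
      refine Finset.sum_congr rfl fun i _ => ?_
      rw [← SimpleGraph.card_neighborFinset_eq_degree, SimpleGraph.neighborFinset_eq_filter,
        Finset.card_filter]
    have h₂ : (Finset.univ : Finset (Fin m)).offDiag.card = m * (m - 1) := by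
      rw [Finset.offDiag_card, Finset.card_univ, Fintype.card_fin, Nat.mul_sub_one]
    have h₃ : ((Finset.univ : Finset (Fin m)).offDiag.filter (fun p => ¬ H.Adj p.1 p.2)).card ≤
        (badPairs G B).card + 2 * (m * (m - B.card)) := by
      let φ : Fin m × Fin m → Finset V × Finset V := fun p => ((e p.1).1, (e p.2).1)
      have hφ : Function.Injective φ := by
        rintro ⟨i, j⟩ ⟨i', j'⟩ h
        simp only [φ, Prod.mk.injEq] at h
        exact Prod.ext (e.injective (Subtype.ext h.1)) (e.injective (Subtype.ext h.2))
      rw [← Finset.card_image_of_injective _ hφ]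
      -- A missing ordered pair is an old one or has one of the at most `m - |B|` added singletons
      -- in some coordinate.
      have hsub : ((Finset.univ : Finset (Fin m)).offDiag.filter
          (fun p => ¬ H.Adj p.1 p.2)).image φ ⊆
          badPairs G B ∪ ((C \ B) ×ˢ C ∪ C ×ˢ (C \ B)) := by
        intro q hq
        obtain ⟨⟨i, j⟩, hp, rfl⟩ := Finset.mem_image.1 hq
        rw [Finset.mem_filter, Finset.mem_offDiag] at hp
        simp only [φ, badPairs, Finset.mem_union, Finset.mem_filter, Finset.mem_product,
          Finset.mem_sdiff]
        have hi := (e i).2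
        have hj := (e j).2
        have hne : (e i).1 ≠ (e j).1 := fun h => hp.1.2.2 (e.injective (Subtype.ext h))
        have hT : ¬ Touches G (e i).1 (e j).1 := fun h => hp.2 ⟨hp.1.2.2, h⟩
        by_cases hi' : (e i).1 ∈ B
        · by_cases hj' : (e j).1 ∈ B
          · exact Or.inl ⟨⟨hi', hj'⟩, hne, hT⟩
          · exact Or.inr (Or.inr ⟨hi, hj, hj'⟩)
        · exact Or.inr (Or.inl ⟨⟨hi, hi'⟩, hj⟩)
      refine (Finset.card_le_card hsub).trans ?_
      refine (Finset.card_union_le _ _).trans (Nat.add_le_add_left ?_ _)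
      refine (Finset.card_union_le _ _).trans ?_
      rw [Finset.card_product, Finset.card_product, hCm]
      nlinarith
    have h₄ := Finset.card_filter_add_card_filter_not (s := (Finset.univ : Finset (Fin m)).offDiag)
      (fun p => H.Adj p.1 p.2)
    have h₅ : ((Finset.univ : Finset (Fin m)).offDiag.filter (fun p => H.Adj p.1 p.2)).card ≤
        ((Finset.univ : Finset (Fin m × Fin m)).filter (fun p => H.Adj p.1 p.2)).card :=
      Finset.card_le_card (Finset.filter_subset_filter _ (Finset.subset_univ _))
    omega

/-- The vertices `f s` make the edges `{s, f s}` touch one another, and the vertices `s` make them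
touch the singletons of `A`. -/
lemma exists_minor_of_matched_clique [Fintype V] {A : Finset V} {n : ℕ}
    (hA : ∀ u ∈ A, ∀ v ∈ A, u ≠ v → G.Adj u v) {S : Finset V} {f : S → V}
    (hf : Function.Injective f) (hS : ∀ s : S, G.Adj s (f s))
    (hAS : ∀ u ∈ A, ∀ s ∈ S, G.Adj u s) (hff : ∀ s s' : S, f s ≠ f s' → G.Adj (f s) (f s'))
    (hdA : ∀ s : S, f s ∉ A) (hdS : ∀ s : S, f s ∉ S) (hn : n = A.card + S.card) :
    ∃ H : SimpleGraph (Fin n), H.IsMinor G ∧ n * (n - 1) ≤ 2 * H.edgeSet.ncard := by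
  let g : S → Finset V := fun s => {s.1, f s}
  have hAS' : ∀ s : S, s.1 ∉ A := fun s h => (hAS _ h _ s.2).ne rfl
  have hg : Function.Injective g := by
    intro s s' h
    have : s.1 ∈ g s' := h ▸ by simp [g]
    simp only [g, Finset.mem_insert, Finset.mem_singleton] at this
    rcases this with h | h
    · exact Subtype.ext h
    · exact (hdS s' (h ▸ s.2)).elim
  let B₁ := A.image (fun v => ({v} : Finset V))
  let B₂ := (Finset.univ : Finset S).image g
  have hdis : Disjoint B₁ B₂ := by
    rw [Finset.disjoint_left]
    intro X hX hX'
    obtain ⟨v, hv, rfl⟩ := Finset.mem_image.1 hX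
    obtain ⟨s, -, h⟩ := Finset.mem_image.1 hX'
    have : s.1 ∈ ({v} : Finset V) := h ▸ by simp [g]
    rw [Finset.mem_singleton] at this
    exact hAS' s (this ▸ hv)
  have hcard : (B₁ ∪ B₂).card = n := by
    rw [Finset.card_union_of_disjoint hdis, Finset.card_image_of_injective _
      Finset.singleton_injective, Finset.card_image_of_injective _ hg, Finset.card_univ,
      Fintype.card_coe, hn]
  have hB : BranchSets G (B₁ ∪ B₂) := by
    refine ⟨fun X hX => ?_, fun X hX X' hX' hne => ?_⟩
    · rcases Finset.mem_union.1 hX with h | h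
      · obtain ⟨v, hv, rfl⟩ := Finset.mem_image.1 h
        exact connected_induce_singleton v
      · obtain ⟨s, -, rfl⟩ := Finset.mem_image.1 h
        exact connected_induce_pair (hS s)
    · have h12 : ∀ v ∈ A, ∀ s : S, Disjoint ({v} : Finset V) (g s) := by
        intro v hv s
        rw [Finset.disjoint_singleton_left]
        simp only [g, Finset.mem_insert, Finset.mem_singleton, not_or]
        exact ⟨fun h => hAS' s (h ▸ hv), fun h => hdA s (h ▸ hv)⟩
      rcases Finset.mem_union.1 hX with h | h <;> rcases Finset.mem_union.1 hX' with h' | h'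
      · obtain ⟨v, hv, rfl⟩ := Finset.mem_image.1 h
        obtain ⟨v', hv', rfl⟩ := Finset.mem_image.1 h'
        rw [Finset.disjoint_singleton]
        exact fun h => hne (by rw [h])
      · obtain ⟨v, hv, rfl⟩ := Finset.mem_image.1 h
        obtain ⟨s, -, rfl⟩ := Finset.mem_image.1 h'
        exact h12 v hv s
      · obtain ⟨v, hv, rfl⟩ := Finset.mem_image.1 h'
        obtain ⟨s, -, rfl⟩ := Finset.mem_image.1 h
        exact (h12 v hv s).symm
      · obtain ⟨s, -, rfl⟩ := Finset.mem_image.1 h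
        obtain ⟨s', -, rfl⟩ := Finset.mem_image.1 h'
        have hss : s ≠ s' := fun h => hne (by rw [h])
        simp only [g, Finset.disjoint_insert_left, Finset.mem_insert, Finset.mem_singleton, not_or,
          Finset.disjoint_singleton_left]
        exact ⟨⟨fun h => hss (Subtype.ext h), fun h => hdS s' (h ▸ s.2)⟩,
          fun h => hdS s (h ▸ s'.2), fun h => hss (hf h)⟩
  obtain ⟨H, hH, hc⟩ := hB.exists_minor (m := n) (by omega)
  refine ⟨H, hH, ?_⟩
  have hbad : badPairs G (B₁ ∪ B₂) = ∅ := by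
    rw [badPairs, Finset.filter_eq_empty_iff]
    rintro ⟨X, X'⟩ hp ⟨hne, hT⟩
    rw [Finset.mem_product] at hp
    refine hT ?_
    rcases Finset.mem_union.1 hp.1 with h | h <;> rcases Finset.mem_union.1 hp.2 with h' | h'
    · obtain ⟨v, hv, rfl⟩ := Finset.mem_image.1 h
      obtain ⟨v', hv', rfl⟩ := Finset.mem_image.1 h'
      exact ⟨v, by simp, v', by simp, hA v hv v' hv' (fun h => hne (by rw [h]))⟩
    · obtain ⟨v, hv, rfl⟩ := Finset.mem_image.1 h
      obtain ⟨s, -, rfl⟩ := Finset.mem_image.1 h'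
      exact ⟨v, by simp, s, by simp [g], hAS v hv s s.2⟩
    · obtain ⟨v, hv, rfl⟩ := Finset.mem_image.1 h'
      obtain ⟨s, -, rfl⟩ := Finset.mem_image.1 h
      exact ⟨s, by simp [g], v, by simp, (hAS v hv s s.2).symm⟩
    · obtain ⟨s, -, rfl⟩ := Finset.mem_image.1 h
      obtain ⟨s', -, rfl⟩ := Finset.mem_image.1 h'
      exact ⟨f s, by simp [g], f s', by simp [g], hff s s' fun h => hne (by rw [hf h])⟩
  rw [hbad, hcard] at hc
  simpa using hc

/-- Two sets without edges of `G` between them that cover half of the vertices give a complete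
minor. -/
lemma exists_complete_minor [Fintype V]
    (tri : ∀ a b c, Gᶜ.Adj a b → Gᶜ.Adj b c → ¬ Gᶜ.Adj a c) {m : ℕ}
    (hm : 2 * m ≤ Fintype.card V + 1) {A₀ B₀ : Finset V} (hA₀ : A₀.Nonempty) (hB₀ : B₀.Nonempty)
    (hAB₀ : ∀ a ∈ A₀, ∀ b ∈ B₀, Gᶜ.Adj a b) (hc₀ : m ≤ A₀.card + B₀.card) :
    ∃ H : SimpleGraph (Fin m), H.IsMinor G ∧ m * (m - 1) ≤ 2 * H.edgeSet.ncard := by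
  let P := ((Finset.univ : Finset (Finset V × Finset V)).filter (fun p => p.1.Nonempty ∧
    p.2.Nonempty ∧ ∀ a ∈ p.1, ∀ b ∈ p.2, Gᶜ.Adj a b))
  -- The biclique is chosen with the most vertices; this maximality yields Hall's condition below.
  obtain ⟨⟨A, B⟩, hAB, hmax⟩ := Finset.exists_max_image P (fun p => p.1.card + p.2.card)
    ⟨(A₀, B₀), by simp only [P, Finset.mem_filter]; exact ⟨Finset.mem_univ _, hA₀, hB₀, hAB₀⟩⟩
  have hc := hmax (A₀, B₀) (by
    simp only [P, Finset.mem_filter]; exact ⟨Finset.mem_univ _, hA₀, hB₀, hAB₀⟩)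
  simp only [P, Finset.mem_filter, Finset.mem_univ, true_and] at hAB hmax hc
  obtain ⟨hA, hB, hAB⟩ := hAB
  let R := Finset.univ \ (A ∪ B)
  let RA := R.filter (fun s => ∀ a ∈ A, ¬ Gᶜ.Adj s a)
  let RB := R.filter (fun s => ∀ b ∈ B, ¬ Gᶜ.Adj s b)
  have hdis : Disjoint A B := Finset.disjoint_left.2 fun v hv hv' => (hAB v hv v hv').ne rfl
  -- A vertex with `Gᶜ`-neighbours in both sides would close a triangle.
  have hcover : R ⊆ RA ∪ RB := by
    intro s hs
    rw [Finset.mem_union, Finset.mem_filter, Finset.mem_filter]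
    by_contra! h
    obtain ⟨a, ha, hsa⟩ := h.1 hs
    obtain ⟨b, hb, hsb⟩ := h.2 hs
    exact tri s a b hsa (hAB a ha b hb) hsb
  have hcount : Fintype.card V ≤ A.card + B.card + RA.card + RB.card := by
    have h₁ := (Finset.card_le_card hcover).trans (Finset.card_union_le _ _)
    have h₂ : R.card + (A ∪ B).card = Fintype.card V := by
      rw [← Finset.card_univ]
      exact Finset.card_sdiff_add_card_eq_card (Finset.subset_univ _)
    rw [Finset.card_union_of_disjoint hdis] at h₂
    omega
  have key : ∀ A B : Finset V, A.Nonempty → B.Nonempty → (∀ a ∈ A, ∀ b ∈ B, Gᶜ.Adj a b) →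
      (∀ A' B' : Finset V, A'.Nonempty → B'.Nonempty → (∀ a ∈ A', ∀ b ∈ B', Gᶜ.Adj a b) →
        A'.card + B'.card ≤ A.card + B.card) → ∀ S : Finset V, (∀ s ∈ S, s ∉ A ∧ s ∉ B) →
      (∀ s ∈ S, ∀ a ∈ A, ¬ Gᶜ.Adj s a) → m ≤ A.card + S.card → m ≤ A.card + B.card →
      ∃ H : SimpleGraph (Fin m), H.IsMinor G ∧ m * (m - 1) ≤ 2 * H.edgeSet.ncard := by
    clear! A B A₀ B₀
    intro A B hA hB hAB hmax S hSd hSA hmS hmB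
    have gadj : ∀ u v, u ≠ v → ¬ Gᶜ.Adj u v → G.Adj u v := by
      intro u v h h'
      by_contra h''
      exact h' ((SimpleGraph.compl_adj _ _ _).2 ⟨h, h''⟩)
    have hAA : ∀ u ∈ A, ∀ v ∈ A, u ≠ v → G.Adj u v := by
      intro u hu v hv huv
      obtain ⟨b, hb⟩ := hB
      exact gadj u v huv (tri u b v (hAB u hu b hb) (hAB v hv b hb).symm)
    have hBB : ∀ u ∈ B, ∀ v ∈ B, u ≠ v → G.Adj u v := by
      intro u hu v hv huv
      obtain ⟨a, ha⟩ := hA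
      exact gadj u v huv (tri u a v (hAB a ha u hu).symm (hAB a ha v hv))
    have hdis : ∀ v ∈ A, v ∉ B := fun v hv hv' => (hAB v hv v hv').ne rfl
    rcases le_total m A.card with h | h
    · obtain ⟨A', hA', hc⟩ := Finset.exists_subset_card_eq h
      exact exists_minor_of_matched_clique (S := ∅) (f := fun s => s.1)
        (fun u hu v hv => hAA u (hA' hu) v (hA' hv)) Subtype.val_injective (fun s => (Finset.notMem_empty _ s.2).elim)
        (by simp) (fun s => (Finset.notMem_empty _ s.2).elim) (fun s => (Finset.notMem_empty _ s.2).elim) (fun s => (Finset.notMem_empty _ s.2).elim)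
        (by simp [hc])
    · obtain ⟨S', hS', hc⟩ := Finset.exists_subset_card_eq (show m - A.card ≤ S.card by omega)
      -- If `X` violated Hall's condition, moving `X` to the side of `A` and deleting its
      -- `G`-neighbours from `B` would give a larger biclique.
      have hall : ∀ X : Finset S', X.card ≤ (X.biUnion (fun s => B.filter (G.Adj s))).card := by
        intro X
        by_contra! hlt
        let N := X.biUnion (fun s => B.filter (G.Adj s))
        have hN : N ⊆ B := by
          intro v hv
          obtain ⟨s, -, hv⟩ := Finset.mem_biUnion.1 hv
          exact (Finset.mem_filter.1 hv).1
        have hXc : X.card ≤ B.card := by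
          have := Finset.card_le_univ X
          rw [Fintype.card_coe] at this
          omega
        have hBN : (B \ N).Nonempty := by
          rw [← Finset.card_pos, Finset.card_sdiff_of_subset hN]
          have : N.card < X.card := hlt
          omega
        have hXd : Disjoint A (X.map (Function.Embedding.subtype _)) := by
          rw [Finset.disjoint_left]
          intro v hv hv'
          obtain ⟨s, -, rfl⟩ := Finset.mem_map.1 hv'
          exact (hSd s.1 (hS' s.2)).1 hv
        have := hmax (A ∪ X.map (Function.Embedding.subtype _)) (B \ N)
          (hA.mono Finset.subset_union_left) hBN (by
            intro u hu b hb
            rw [Finset.mem_sdiff] at hb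
            rcases Finset.mem_union.1 hu with hu | hu
            · exact hAB u hu b hb.1
            · obtain ⟨s, hs, rfl⟩ := Finset.mem_map.1 hu
              by_contra hsb
              refine hb.2 (Finset.mem_biUnion.2 ⟨s, hs, Finset.mem_filter.2 ⟨hb.1, ?_⟩⟩)
              exact gadj s.1 b (fun h => (hSd s.1 (hS' s.2)).2 (h ▸ hb.1)) hsb)
        rw [Finset.card_union_of_disjoint hXd, Finset.card_map, Finset.card_sdiff_of_subset hN]
          at this
        have h₁ : N.card < X.card := hlt
        have h₂ := Finset.card_le_card hN
        omega
      obtain ⟨f, hf, hfB⟩ := (Finset.all_card_le_biUnion_card_iff_exists_injective _).1 hall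
      simp only [Finset.mem_filter] at hfB
      refine exists_minor_of_matched_clique hAA hf (fun s => (hfB s).2) ?_
        (fun s s' h => hBB _ (hfB s).1 _ (hfB s').1 h) (fun s h => hdis _ h (hfB s).1)
        (fun s h => (hSd _ (hS' h)).2 (hfB s).1) (by omega)
      intro u hu s hs
      exact gadj u s (fun h => (hSd s (hS' hs)).1 (h ▸ hu)) fun h => hSA s (hS' hs) u hu h.symm
  have hRm : ∀ s ∈ R, s ∉ A ∧ s ∉ B := by
    intro s hs
    simpa [R] using hs
  have hmax' : ∀ A' B' : Finset V, A'.Nonempty → B'.Nonempty →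
      (∀ a ∈ A', ∀ b ∈ B', Gᶜ.Adj a b) → A'.card + B'.card ≤ A.card + B.card :=
    fun A' B' h₁ h₂ h₃ => hmax (A', B') ⟨h₁, h₂, h₃⟩
  by_cases h : m ≤ A.card + RA.card
  · exact key A B hA hB hAB hmax' RA (fun s hs => hRm s (Finset.mem_filter.1 hs).1)
      (fun s hs => (Finset.mem_filter.1 hs).2) h (hc₀.trans hc)
  · refine key B A hB hA (fun b hb a ha => (hAB a ha b hb).symm)
      (fun A' B' h₁ h₂ h₃ => by rw [add_comm B.card]; exact hmax' A' B' h₁ h₂ h₃) RB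
      (fun s hs => (hRm s (Finset.mem_filter.1 hs).1).symm)
      (fun s hs => (Finset.mem_filter.1 hs).2) ?_ (by rw [add_comm]; exact hc₀.trans hc)
    -- As `|A| + |RA| ≤ m - 1`, the count leaves `|B| + |RB| ≥ n + 1 - m ≥ m`.
    omega

end Assembly

/-! ### Averaging over permutations -/

section Averaging

open scoped Classical

/-- By transitivity the orbit sum does not depend on its base point; summing it over all base points
and exchanging the sums gives the identity. -/
lemma card_mul_sum_smul {Γ X : Type*} [Group Γ] [Fintype Γ] [Fintype X] [MulAction Γ X]
    [MulAction.IsPretransitive Γ X] (f : X → ℝ) (x : X) :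
    (Fintype.card X : ℝ) * ∑ g : Γ, f (g • x) = Fintype.card Γ * ∑ z, f z := by
  have h : ∀ z : X, ∑ g : Γ, f (g • z) = ∑ g : Γ, f (g • x) := by
    intro z
    obtain ⟨h, rfl⟩ := MulAction.exists_smul_eq Γ x z
    simp_rw [← mul_smul]
    exact Fintype.sum_equiv (Equiv.mulRight h) _ _ fun g => rfl
  calc (Fintype.card X : ℝ) * ∑ g : Γ, f (g • x) = ∑ z : X, ∑ g : Γ, f (g • z) := by
        rw [Finset.sum_congr rfl fun z _ => h z, Finset.sum_const, nsmul_eq_mul, Finset.card_univ]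
    _ = ∑ g : Γ, ∑ z : X, f (g • z) := Finset.sum_comm
    _ = ∑ _g : Γ, ∑ z : X, f z := Finset.sum_congr rfl fun g _ =>
        Fintype.sum_equiv (MulAction.toPerm g) _ _ fun z => rfl
    _ = Fintype.card Γ * ∑ z, f z := by rw [Finset.sum_const, nsmul_eq_mul, Finset.card_univ]

variable {α : Type*} [Fintype α]

lemma sum_perm_embedding {k : ℕ} (f : (Fin k ↪ α) → ℝ) (x : Fin k ↪ α) :
    ∑ σ : Equiv.Perm α, f (σ • x) =
      Fintype.card (Equiv.Perm α) * ((∑ z, f z) / Fintype.card (Fin k ↪ α)) := by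
  have := Equiv.Perm.isMultiplyPretransitive α k
  have h := card_mul_sum_smul (Γ := Equiv.Perm α) f x
  have h0 : (Fintype.card (Fin k ↪ α) : ℝ) ≠ 0 := by
    have : Nonempty (Fin k ↪ α) := ⟨x⟩
    exact_mod_cast Fintype.card_ne_zero
  field_simp
  linarith

/-- Some family of `P` disjoint ordered pairs does at least as well as a uniformly random one. -/
lemma exists_pairs_le_average (f : α → α → ℝ) (g : α → α → α → α → ℝ) {P : ℕ}
    (hP : 2 * P ≤ Fintype.card α) :
    ∃ p q : Fin P → α, Function.Injective (Sum.elim p q) ∧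
      ∑ i, f (p i) (q i) + ∑ ij ∈ (Finset.univ : Finset (Fin P)).offDiag,
        g (p ij.1) (q ij.1) (p ij.2) (q ij.2) ≤
      P * ((∑ z : Fin 2 ↪ α, f (z 0) (z 1)) / Fintype.card (Fin 2 ↪ α)) +
      (P * (P - 1)) * ((∑ z : Fin 4 ↪ α, g (z 0) (z 1) (z 2) (z 3)) /
        Fintype.card (Fin 4 ↪ α)) := by
  -- One fixed family of disjoint pairs is moved by all permutations of `α`, which makes each pair,
  -- and each two distinct pairs, uniformly distributed.
  obtain ⟨ι⟩ : Nonempty (Fin P ⊕ Fin P ↪ α) := by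
    apply Function.Embedding.nonempty_of_card_le
    simpa [two_mul] using hP
  have hι := ι.injective
  have h2 : ∀ i : Fin P, ∑ σ : Equiv.Perm α, f (σ (ι (Sum.inl i))) (σ (ι (Sum.inr i))) =
      Fintype.card (Equiv.Perm α) *
        ((∑ z : Fin 2 ↪ α, f (z 0) (z 1)) / Fintype.card (Fin 2 ↪ α)) := by
    intro i
    let x : Fin 2 ↪ α := ⟨![ι (Sum.inl i), ι (Sum.inr i)], by
      intro a b hab
      fin_cases a <;> fin_cases b <;> simp_all⟩
    exact sum_perm_embedding (fun z : Fin 2 ↪ α => f (z 0) (z 1)) x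
  have h4 : ∀ ij ∈ (Finset.univ : Finset (Fin P)).offDiag, ∑ σ : Equiv.Perm α,
      g (σ (ι (Sum.inl ij.1))) (σ (ι (Sum.inr ij.1))) (σ (ι (Sum.inl ij.2)))
        (σ (ι (Sum.inr ij.2))) =
      Fintype.card (Equiv.Perm α) *
        ((∑ z : Fin 4 ↪ α, g (z 0) (z 1) (z 2) (z 3)) / Fintype.card (Fin 4 ↪ α)) := by
    rintro ⟨i, j⟩ hij
    have hij : i ≠ j := (Finset.mem_offDiag.1 hij).2.2
    have hji := hij.symm
    let x : Fin 4 ↪ α := ⟨![ι (Sum.inl i), ι (Sum.inr i), ι (Sum.inl j), ι (Sum.inr j)], by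
      intro a b hab
      fin_cases a <;> fin_cases b <;> simp_all⟩
    exact sum_perm_embedding (fun z : Fin 4 ↪ α => g (z 0) (z 1) (z 2) (z 3)) x
  have hsum : ∑ σ : Equiv.Perm α, (∑ i, f (σ (ι (Sum.inl i))) (σ (ι (Sum.inr i))) +
      ∑ ij ∈ (Finset.univ : Finset (Fin P)).offDiag, g (σ (ι (Sum.inl ij.1)))
        (σ (ι (Sum.inr ij.1))) (σ (ι (Sum.inl ij.2))) (σ (ι (Sum.inr ij.2)))) ≤
      ∑ _σ : Equiv.Perm α, (P * ((∑ z : Fin 2 ↪ α, f (z 0) (z 1)) / Fintype.card (Fin 2 ↪ α)) +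
      (P * (P - 1)) * ((∑ z : Fin 4 ↪ α, g (z 0) (z 1) (z 2) (z 3)) /
        Fintype.card (Fin 4 ↪ α))) := by
    rw [Finset.sum_add_distrib, Finset.sum_comm, Finset.sum_comm (s := Finset.univ) (t := Finset.offDiag _),
      Finset.sum_congr rfl fun i _ => h2 i, Finset.sum_congr rfl h4]
    simp only [Finset.sum_const, nsmul_eq_mul, Finset.card_univ, Fintype.card_fin,
      Finset.offDiag_card]
    rw [Nat.cast_sub (Nat.le_mul_self P)]
    push_cast
    apply le_of_eq
    ring
  obtain ⟨σ, -, hσ⟩ := Finset.exists_le_of_sum_le (s := (Finset.univ : Finset (Equiv.Perm α)))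
    ⟨1, Finset.mem_univ _⟩ hsum
  refine ⟨fun i => σ (ι (Sum.inl i)), fun i => σ (ι (Sum.inr i)), ?_, hσ⟩
  have : Sum.elim (fun i => σ (ι (Sum.inl i))) (fun i => σ (ι (Sum.inr i))) = σ ∘ ι := by
    ext s
    cases s <;> rfl
  rw [this]
  exact σ.injective.comp hι

lemma sum_embedding_two (h : α → α → ℝ) (h0 : ∀ a, h a a = 0) :
    ∑ z : Fin 2 ↪ α, h (z 0) (z 1) = ∑ a, ∑ b, h a b := by
  have hφ : Function.Injective (fun z : Fin 2 ↪ α => (z 0, z 1)) := by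
    intro z z' hz
    simp only [Prod.mk.injEq] at hz
    ext i
    fin_cases i <;> simp [hz]
  rw [← Fintype.sum_prod_type' (f := h), ← Finset.sum_image (g := fun z : Fin 2 ↪ α => (z 0, z 1))
    (f := fun p : α × α => h p.1 p.2) (fun a _ b _ hab => hφ hab)]
  refine Finset.sum_subset (Finset.subset_univ _) ?_
  rintro ⟨a, b⟩ - hn
  by_cases hab : a = b
  · simp only [hab, h0]
  · refine (hn (Finset.mem_image.2 ⟨⟨![a, b], ?_⟩, Finset.mem_univ _, rfl⟩)).elim
    intro i j hij
    fin_cases i <;> fin_cases j <;> simp_all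

lemma sum_embedding_four_le (h : α → α → α → α → ℝ) (h0 : ∀ a b c d, 0 ≤ h a b c d) :
    ∑ z : Fin 4 ↪ α, h (z 0) (z 1) (z 2) (z 3) ≤ ∑ a, ∑ b, ∑ c, ∑ d, h a b c d := by
  have hφ : Function.Injective (fun z : Fin 4 ↪ α => (z 0, z 1, z 2, z 3)) := by
    intro z z' hz
    simp only [Prod.mk.injEq] at hz
    ext i
    fin_cases i <;> simp [hz]
  have e : ∑ a, ∑ b, ∑ c, ∑ d, h a b c d = ∑ p : α × α × α × α, h p.1 p.2.1 p.2.2.1 p.2.2.2 := by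
    simp only [Fintype.sum_prod_type]
  rw [e, ← Finset.sum_image (g := fun z : Fin 4 ↪ α => (z 0, z 1, z 2, z 3))
    (f := fun p : α × α × α × α => h p.1 p.2.1 p.2.2.1 p.2.2.2) (fun a _ b _ hab => hφ hab)]
  exact Finset.sum_le_univ_sum_of_nonneg fun p => h0 _ _ _ _

lemma card_embedding_two : (Fintype.card (Fin 2 ↪ α) : ℝ) =
    Fintype.card α * (Fintype.card α - 1) := by
  rw [Fintype.card_embedding_eq, Fintype.card_fin, Nat.cast_descFactorial_two]

lemma card_embedding_four (h : 4 ≤ Fintype.card α) : (Fintype.card (Fin 4 ↪ α) : ℝ) =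
    Fintype.card α * (Fintype.card α - 1) * (Fintype.card α - 2) * (Fintype.card α - 3) := by
  rw [Fintype.card_embedding_eq, Fintype.card_fin]
  simp only [Nat.descFactorial, Nat.sub_zero]
  push_cast [show 3 ≤ Fintype.card α by omega, show 2 ≤ Fintype.card α by omega,
    show 1 ≤ Fintype.card α by omega]
  ring

end Averaging

/-! ### Concentration by a second-moment penalty -/

section Matching

open scoped Classical

/-- The variance estimate behind the concentration of the number of selected pairs. -/
lemma variance_bound {v g P μ : ℝ} (hv : 6 ≤ v) (hP : 0 ≤ P) (hPv : 2 * P ≤ v)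
    (hg : 0 ≤ g) (hg' : g ≤ v * (v - 1)) (hμ : μ = P * (g / (v * (v - 1)))) :
    μ * (1 - 2 * μ) + P * (P - 1) * (g ^ 2 / (v * (v - 1) * (v - 2) * (v - 3))) + μ ^ 2 ≤
      2 * v := by
  have h0 : 0 < v := by linarith
  have h1 : 0 < v - 1 := by linarith
  have h2 : 0 < v - 2 := by linarith
  have h3 : 0 < v - 3 := by linarith
  have hr0 : 0 ≤ g / (v * (v - 1)) := by positivity
  have hr1 : g / (v * (v - 1)) ≤ 1 := (div_le_one (by positivity)).2 hg'
  have hμ0 : 0 ≤ μ := by rw [hμ]; positivity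
  have hμ1 : μ ≤ v / 2 := by rw [hμ]; nlinarith
  -- Since `2P ≤ v`, one has `P (P - 1) ≤ P² (v - 2)/v`, which absorbs a factor of the four-point
  -- normalisation.
  have key : P * (P - 1) * (g ^ 2 / (v * (v - 1) * (v - 2) * (v - 3))) ≤
      μ ^ 2 * ((v - 1) / (v - 3)) := by
    have e : P * (P - 1) * (g ^ 2 / (v * (v - 1) * (v - 2) * (v - 3))) =
        (P * (P - 1)) * ((g / (v * (v - 1))) ^ 2 * (v / (v - 2)) * ((v - 1) / (v - 3))) := by
      field_simp
    have e' : μ ^ 2 * ((v - 1) / (v - 3)) =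
        (P ^ 2 * ((v - 2) / v)) * ((g / (v * (v - 1))) ^ 2 * (v / (v - 2)) * ((v - 1) / (v - 3))) := by
      rw [hμ]
      field_simp
    rw [e, e']
    refine mul_le_mul_of_nonneg_right ?_ (by positivity)
    rw [mul_div_assoc', le_div_iff₀ h0]
    nlinarith [mul_nonneg hP (sub_nonneg.2 hPv)]
  have h5 : μ ^ 2 * ((v - 1) / (v - 3)) ≤ μ ^ 2 + v := by
    rw [mul_div_assoc', div_le_iff₀ h3]
    nlinarith [mul_nonneg (sub_nonneg.2 hμ1) hμ0, mul_nonneg h0.le (sub_nonneg.2 hv)]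
  nlinarith

variable {α : Type*} [Fintype α]

/-- Among families of `P` disjoint ordered pairs there is one in which the pairs satisfying `E`
have small cost, and whose number is close to its expectation. -/
lemma exists_pairs_concentrated (E : α → α → Prop) (hE : ∀ a, ¬ E a a) (c : α → α → ℝ)
    (hc : ∀ a b, 0 ≤ c a b) (D : α → α → α → α → ℝ) (hD : ∀ a b a' b', 0 ≤ D a b a' b')
    {P : ℕ} (hP : 2 * P ≤ Fintype.card α) (h6 : 6 ≤ Fintype.card α) {v g μ lam : ℝ}
    (hv : v = Fintype.card α) (hg : g = ∑ a, ∑ b, if E a b then (1 : ℝ) else 0)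
    (hg' : g ≤ v * (v - 1))
    (hμ : μ = P * (g / (v * (v - 1)))) (hlam : 0 ≤ lam) :
    ∃ p q : Fin P → α, Function.Injective (Sum.elim p q) ∧ ∃ I : Finset (Fin P),
      (∀ i, i ∈ I ↔ E (p i) (q i)) ∧
      ∑ i ∈ I, c (p i) (q i) + (∑ ij ∈ I.offDiag, D (p ij.1) (q ij.1) (p ij.2) (q ij.2)) +
        lam * (I.card - μ) ^ 2 ≤
      P * ((∑ a, ∑ b, c a b) / (v * (v - 1))) +
      P * (P - 1) * ((∑ a, ∑ b, ∑ a', ∑ b', D a b a' b') /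
        (v * (v - 1) * (v - 2) * (v - 3))) + lam * (2 * v) := by
  have hv6 : 6 ≤ v := by rw [hv]; exact_mod_cast h6
  have hPv : 2 * (P : ℝ) ≤ v := by rw [hv]; exact_mod_cast hP
  have hP0 : (0 : ℝ) ≤ P := Nat.cast_nonneg _
  -- With `N = |I|`, the penalty is `lam * (N (1 - 2μ) + N (N - 1) + μ²)`: the linear part is
  -- charged to selected pairs, the quadratic part to ordered pairs of them, and `μ²` is constant.
  obtain ⟨p, q, hpq, h⟩ := exists_pairs_le_average
    (fun a b => if E a b then c a b + lam * (1 - 2 * μ) else 0)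
    (fun a b a' b' => if E a b ∧ E a' b' then D a b a' b' + lam else 0) hP
  refine ⟨p, q, hpq, Finset.univ.filter (fun i => E (p i) (q i)), fun i => by simp, ?_⟩
  set I := Finset.univ.filter (fun i => E (p i) (q i)) with hI
  rw [← Finset.sum_filter, ← Finset.sum_filter] at h
  have hoff : (Finset.univ.offDiag.filter
      (fun ij : Fin P × Fin P => E (p ij.1) (q ij.1) ∧ E (p ij.2) (q ij.2))) = I.offDiag := by
    ext ⟨i, j⟩
    simp only [hI, Finset.mem_filter, Finset.mem_offDiag, Finset.mem_univ, true_and]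
    clear * -
    tauto
  rw [hoff, Finset.sum_add_distrib, Finset.sum_add_distrib, Finset.sum_const, Finset.sum_const,
    nsmul_eq_mul, nsmul_eq_mul, Finset.offDiag_card, Nat.cast_sub (Nat.le_mul_self _)] at h
  rw [sum_embedding_two (fun a b => if E a b then c a b + lam * (1 - 2 * μ) else 0)
    (fun a => by simp [hE]), card_embedding_two, card_embedding_four (by omega), ← hv] at h
  have hf : ∑ a, ∑ b, (if E a b then c a b + lam * (1 - 2 * μ) else 0) ≤
      (∑ a, ∑ b, c a b) + lam * (1 - 2 * μ) * g := by
    rw [hg, Finset.mul_sum, ← Finset.sum_add_distrib]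
    refine Finset.sum_le_sum fun a _ => ?_
    rw [Finset.mul_sum, ← Finset.sum_add_distrib]
    refine Finset.sum_le_sum fun b _ => ?_
    have := hc a b
    split_ifs <;> linarith
  have hgg : ∑ z : Fin 4 ↪ α, (if E (z 0) (z 1) ∧ E (z 2) (z 3)
        then D (z 0) (z 1) (z 2) (z 3) + lam else 0) ≤
      (∑ a, ∑ b, ∑ a', ∑ b', D a b a' b') + lam * g ^ 2 := by
    refine (sum_embedding_four_le
      (fun a b a' b' => if E a b ∧ E a' b' then D a b a' b' + lam else 0) ?_).trans ?_
    · intro a b a' b'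
      have := hD a b a' b'
      split_ifs <;> linarith
    · have e : g ^ 2 = ∑ a, ∑ b, ∑ a', ∑ b',
          (if E a b then (1 : ℝ) else 0) * (if E a' b' then (1 : ℝ) else 0) := by
        simp only [← Finset.mul_sum, ← hg, ← Finset.sum_mul, pow_two]
      rw [e]
      simp only [Finset.mul_sum, ← Finset.sum_add_distrib]
      refine Finset.sum_le_sum fun a _ => Finset.sum_le_sum fun b _ =>
        Finset.sum_le_sum fun a' _ => Finset.sum_le_sum fun b' _ => ?_
      have := hD a b a' b'
      by_cases h1 : E a b <;> by_cases h2 : E a' b' <;> simp [h1, h2, this]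
  have h1 : 0 < v - 1 := by linarith
  have h2 : 0 < v - 2 := by linarith
  have h3 : 0 < v - 3 := by linarith
  have h0 : 0 < v := by linarith
  have hg0 : 0 ≤ g := by
    rw [hg]
    exact Finset.sum_nonneg fun a _ => Finset.sum_nonneg fun b _ => by split_ifs <;> norm_num
  have hvar := variance_bound hv6 hP0 hPv hg0 hg' hμ
  have hf' := mul_le_mul_of_nonneg_left
    (div_le_div_of_nonneg_right hf (show 0 ≤ v * (v - 1) by positivity)) hP0
  have hPP : (0 : ℝ) ≤ P * (P - 1) := by
    rcases Nat.eq_zero_or_pos P with h | h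
    · simp [h]
    · have : (1 : ℝ) ≤ P := by exact_mod_cast h
      exact mul_nonneg hP0 (by linarith)
  have hg'' := mul_le_mul_of_nonneg_left
    (div_le_div_of_nonneg_right hgg (show 0 ≤ v * (v - 1) * (v - 2) * (v - 3) by positivity)) hPP
  rw [add_div, mul_add] at hf' hg''
  have e1 : (P : ℝ) * (lam * (1 - 2 * μ) * g / (v * (v - 1))) = lam * (μ * (1 - 2 * μ)) := by
    rw [hμ]; ring
  rw [e1] at hf'
  rw [mul_div_assoc, mul_left_comm] at hg''
  have hvar' := mul_le_mul_of_nonneg_left hvar hlam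
  push_cast at h
  linarith
end Matching

/-! ### Counting non-edges around a random matching -/

section GraphMatching

open scoped Classical

variable {V : Type*} {G : SimpleGraph V}

/-- The number of pairs in `A × B` that are non-adjacent and distinct. -/
noncomputable def nonEdges (G : SimpleGraph V) (A B : Finset V) : ℕ :=
  ∑ a ∈ A, (B.filter (Gᶜ.Adj a)).card

lemma nonEdges_eq_sum (A B : Finset V) :
    (nonEdges G A B : ℝ) = ∑ a ∈ A, ∑ b ∈ B, if Gᶜ.Adj a b then (1 : ℝ) else 0 := by
  simp [nonEdges, Finset.sum_boole]

lemma nonEdges_comm (A B : Finset V) : nonEdges G A B = nonEdges G B A := by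
  have h : (nonEdges G A B : ℝ) = nonEdges G B A := by
    rw [nonEdges_eq_sum, nonEdges_eq_sum, Finset.sum_comm]
    simp only [SimpleGraph.adj_comm]
  exact_mod_cast h

lemma nonEdges_add_le [Fintype V] {C W : Finset V} (hCW : Disjoint C W) {q : ℕ}
    (hdeg : ∀ u, (Finset.univ.filter (Gᶜ.Adj u)).card ≤ q) :
    nonEdges G W W + nonEdges G C W ≤ q * W.card := by
  rw [nonEdges_comm C W, nonEdges, nonEdges, ← Finset.sum_add_distrib, mul_comm]
  refine (Finset.sum_le_card_nsmul _ _ q fun a _ => ?_).trans_eq (smul_eq_mul ..)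
  rw [← Finset.card_union_of_disjoint (Finset.disjoint_filter_filter hCW.symm)]
  refine (Finset.card_le_card fun b hb => ?_).trans (hdeg a)
  simp only [Finset.mem_union, Finset.mem_filter, Finset.mem_univ, true_and] at hb ⊢
  exact hb.elim (·.2) (·.2)

lemma nonEdges_le [Fintype V] (C W : Finset V) {q : ℕ}
    (hdeg : ∀ u, (Finset.univ.filter (Gᶜ.Adj u)).card ≤ q) :
    nonEdges G C W ≤ C.card * q :=
  (Finset.sum_le_card_nsmul _ _ q fun a _ =>
    (Finset.card_le_card (Finset.filter_subset_filter _ (Finset.subset_univ _))).trans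
      (hdeg a)).trans_eq (smul_eq_mul ..)

lemma sum_adj_eq (W : Finset V) :
    ∑ a ∈ W, ∑ b ∈ W, (if G.Adj a b then (1 : ℝ) else 0) =
      W.card * (W.card - 1) - nonEdges G W W := by
  rw [nonEdges_eq_sum, eq_sub_iff_add_eq, ← Finset.sum_add_distrib, ← nsmul_eq_mul]
  refine Finset.sum_eq_card_nsmul fun a ha => ?_
  rw [← Finset.sum_add_distrib, eq_sub_iff_add_eq, ← Finset.sum_erase_add _ _ ha]
  have h : ∀ b ∈ W.erase a, (if G.Adj a b then (1 : ℝ) else 0) +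
      (if Gᶜ.Adj a b then 1 else 0) = 1 := by
    intro b hb
    have hab : a ≠ b := (Finset.ne_of_mem_erase hb).symm
    by_cases h : G.Adj a b <;> simp [SimpleGraph.compl_adj, h, hab]
  rw [Finset.sum_congr rfl h]
  simp only [Finset.sum_const, nsmul_eq_mul, mul_one, SimpleGraph.irrefl, if_false, add_zero]
  rw [Finset.card_erase_of_mem ha, Nat.cast_sub (Finset.card_pos.2 ⟨a, ha⟩)]
  simp

/-- Counted from `c`, the sum is that of the squared `Gᶜ`-degrees into `W`, each degree being at
most `q`. -/
lemma sum_common_le [Fintype V] (C W : Finset V) {q : ℕ}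
    (hdeg : ∀ u, (Finset.univ.filter (Gᶜ.Adj u)).card ≤ q) :
    ∑ a ∈ W, ∑ b ∈ W, ((C.filter (fun c => Gᶜ.Adj c a ∧ Gᶜ.Adj c b)).card : ℝ) ≤
      q * nonEdges G C W := by
  have e : ∑ a ∈ W, ∑ b ∈ W, ((C.filter (fun c => Gᶜ.Adj c a ∧ Gᶜ.Adj c b)).card : ℝ) =
      ∑ c ∈ C, ((W.filter (Gᶜ.Adj c)).card : ℝ) * (W.filter (Gᶜ.Adj c)).card := by
    calc _ = ∑ a ∈ W, ∑ b ∈ W, ∑ c ∈ C,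
          (if Gᶜ.Adj c a then (1 : ℝ) else 0) * (if Gᶜ.Adj c b then 1 else 0) := by
          refine Finset.sum_congr rfl fun a _ => Finset.sum_congr rfl fun b _ => ?_
          rw [← Finset.sum_boole]
          refine Finset.sum_congr rfl fun c _ => ?_
          by_cases h1 : Gᶜ.Adj c a <;> by_cases h2 : Gᶜ.Adj c b <;> simp only [h1, h2] <;> simp
      _ = ∑ c ∈ C, ∑ a ∈ W, ∑ b ∈ W,
          (if Gᶜ.Adj c a then (1 : ℝ) else 0) * (if Gᶜ.Adj c b then 1 else 0) := by
          rw [Finset.sum_comm (s := C)]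
          exact Finset.sum_congr rfl fun a _ => Finset.sum_comm
      _ = _ := by
          refine Finset.sum_congr rfl fun c _ => ?_
          rw [← Finset.sum_mul_sum, Finset.sum_boole]
  rw [e, nonEdges, Nat.cast_sum, Finset.mul_sum]
  refine Finset.sum_le_sum fun c _ => mul_le_mul_of_nonneg_right ?_ (Nat.cast_nonneg _)
  exact_mod_cast (Finset.card_le_card (Finset.filter_subset_filter _
    (Finset.subset_univ _))).trans (hdeg c)

/-- Dropping the condition on `b b'` leaves a path `b, a', a, b'` of `Gᶜ`: given its middle edge,
each end has at most `q` choices. -/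
lemma sum_quad_le [Fintype V] (W : Finset V) {q : ℕ}
    (hdeg : ∀ u, (Finset.univ.filter (Gᶜ.Adj u)).card ≤ q) :
    ∑ a ∈ W, ∑ b ∈ W, ∑ a' ∈ W, ∑ b' ∈ W,
      (if Gᶜ.Adj a a' ∧ Gᶜ.Adj a b' ∧ Gᶜ.Adj b a' ∧ Gᶜ.Adj b b' then (1 : ℝ) else 0) ≤
      (q : ℝ) ^ 2 * nonEdges G W W := by
  have hd : ∀ u, ∑ w ∈ W, (if Gᶜ.Adj u w then (1 : ℝ) else 0) ≤ q := by
    intro u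
    rw [Finset.sum_boole]
    exact_mod_cast (Finset.card_le_card (Finset.filter_subset_filter _
      (Finset.subset_univ _))).trans (hdeg u)
  have hd0 : ∀ u, 0 ≤ ∑ w ∈ W, (if Gᶜ.Adj u w then (1 : ℝ) else 0) := fun u =>
    Finset.sum_nonneg fun w _ => by split_ifs <;> norm_num
  calc _ ≤ ∑ a ∈ W, ∑ b ∈ W, ∑ a' ∈ W, ∑ b' ∈ W, (if Gᶜ.Adj a a' then (1 : ℝ) else 0) *
        ((if Gᶜ.Adj a' b then 1 else 0) * (if Gᶜ.Adj a b' then 1 else 0)) := by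
        refine Finset.sum_le_sum fun a _ => Finset.sum_le_sum fun b _ =>
          Finset.sum_le_sum fun a' _ => Finset.sum_le_sum fun b' _ => ?_
        simp only [Gᶜ.adj_comm b a']
        by_cases h1 : Gᶜ.Adj a a' <;> by_cases h2 : Gᶜ.Adj a b' <;>
          by_cases h3 : Gᶜ.Adj a' b <;> by_cases h4 : Gᶜ.Adj b b' <;> simp [h1, h2, h3, h4]
    _ = ∑ a ∈ W, ∑ a' ∈ W, (if Gᶜ.Adj a a' then (1 : ℝ) else 0) *
        ((∑ b ∈ W, if Gᶜ.Adj a' b then 1 else 0) * (∑ b' ∈ W, if Gᶜ.Adj a b' then 1 else 0)) := by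
        refine Finset.sum_congr rfl fun a _ => ?_
        rw [Finset.sum_comm]
        refine Finset.sum_congr rfl fun a' _ => ?_
        simp only [← Finset.mul_sum, ← Finset.sum_mul]
    _ ≤ ∑ a ∈ W, ∑ a' ∈ W, (if Gᶜ.Adj a a' then (1 : ℝ) else 0) * ((q : ℝ) * q) := by
        refine Finset.sum_le_sum fun a _ => Finset.sum_le_sum fun a' _ => ?_
        refine mul_le_mul_of_nonneg_left
          (mul_le_mul (hd _) (hd _) (hd0 _) (Nat.cast_nonneg _)) ?_
        split_ifs <;> norm_num
    _ = _ := by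
        simp only [← Finset.sum_mul, ← nonEdges_eq_sum]
        ring

lemma not_touches_pair {a b a' b' : V} (h : Disjoint ({a, b} : Finset V) {a', b'}) :
    ¬ Touches G {a, b} {a', b'} ↔
      Gᶜ.Adj a a' ∧ Gᶜ.Adj a b' ∧ Gᶜ.Adj b a' ∧ Gᶜ.Adj b b' := by
  have h1 : a ≠ a' ∧ a ≠ b' ∧ b ≠ a' ∧ b ≠ b' := by
    simp only [Finset.disjoint_left, Finset.mem_insert, Finset.mem_singleton] at h
    refine ⟨?_, ?_, ?_, ?_⟩ <;> rintro rfl <;> simp at h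
  simp [Touches, SimpleGraph.compl_adj, h1, and_assoc]

lemma not_touches_singleton_pair {c a b : V} (ha : c ≠ a) (hb : c ≠ b) :
    ¬ Touches G {c} {a, b} ↔ Gᶜ.Adj c a ∧ Gᶜ.Adj c b := by
  simp [Touches, SimpleGraph.compl_adj, ha, hb]

/-- A random matching of edges inside `W`, with few missing connections to the singletons of `C`
and among itself. -/
lemma exists_matching [Fintype V] {C W : Finset V} (hCW : Disjoint C W) {q : ℕ}
    (hdeg : ∀ u, (Finset.univ.filter (Gᶜ.Adj u)).card ≤ q) (h6 : 6 ≤ W.card) {P : ℕ}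
    (hP : 2 * P ≤ W.card) {v g μ lam : ℝ} (hv : v = W.card)
    (hg : g = v * (v - 1) - nonEdges G W W) (hμ : μ = P * (g / (v * (v - 1))))
    (hlam : 0 ≤ lam) :
    ∃ M : Finset (Finset V), BranchSets G M ∧ (∀ S ∈ M, S ⊆ W ∧ S.card = 2) ∧
      2 * (((C ×ˢ M).filter (fun p => ¬ Touches G {p.1} p.2)).card : ℝ) + (badPairs G M).card +
        lam * (M.card - μ) ^ 2 ≤
      2 * P * (q * nonEdges G C W / (v * (v - 1))) +
      P * (P - 1) * (q ^ 2 * nonEdges G W W / (v * (v - 1) * (v - 2) * (v - 3))) +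
      lam * (2 * v) := by
  have hv6 : 6 ≤ v := by rw [hv]; exact_mod_cast h6
  have hcard : Fintype.card W = W.card := Fintype.card_coe W
  obtain ⟨p, q', hpq, I, hI, h⟩ := exists_pairs_concentrated (α := W)
    (fun a b => G.Adj a.1 b.1) (fun a => G.irrefl)
    (fun a b => 2 * ((C.filter (fun c => Gᶜ.Adj c a ∧ Gᶜ.Adj c b)).card : ℝ))
    (fun a b => by positivity)
    (fun a b a' b' => if Gᶜ.Adj a.1 a'.1 ∧ Gᶜ.Adj a.1 b'.1 ∧ Gᶜ.Adj b.1 a'.1 ∧ Gᶜ.Adj b.1 b'.1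
      then 1 else 0) (fun a b a' b' => by split_ifs <;> norm_num)
    (P := P) (by omega) (by omega) (v := v) (g := g) (μ := μ) (lam := lam)
    (by rw [hv, hcard])
    (by
      rw [hg, hv, ← sum_adj_eq, ← Finset.sum_coe_sort]
      refine Finset.sum_congr rfl fun a _ => ?_
      rw [← Finset.sum_coe_sort])
    (by rw [hg]; linarith [Nat.cast_nonneg (α := ℝ) (nonEdges G W W)]) hμ hlam
  have hpp : ∀ i j, p i = p j → i = j := fun i j hij => by
    simpa using hpq (show Sum.elim p q' (Sum.inl i) = Sum.elim p q' (Sum.inl j) from hij)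
  have hqq : ∀ i j, q' i = q' j → i = j := fun i j hij => by
    simpa using hpq (show Sum.elim p q' (Sum.inr i) = Sum.elim p q' (Sum.inr j) from hij)
  have hpq' : ∀ i j, p i ≠ q' j := fun i j hij => by
    simpa using hpq (show Sum.elim p q' (Sum.inl i) = Sum.elim p q' (Sum.inr j) from hij)
  let S : Fin P → Finset V := fun i => {(p i).1, (q' i).1}
  have hS : ∀ i j, i ≠ j → Disjoint (S i) (S j) := by
    intro i j hij
    simp only [S, Finset.disjoint_left, Finset.mem_insert, Finset.mem_singleton, not_or]
    rintro a (rfl | rfl)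
    · exact ⟨fun h => hij (hpp _ _ (Subtype.ext h)), fun h => hpq' _ _ (Subtype.ext h)⟩
    · exact ⟨fun h => hpq' _ _ (Subtype.ext h.symm), fun h => hij (hqq _ _ (Subtype.ext h))⟩
  have hSinj : Function.Injective S := by
    intro i j hij
    by_contra hne
    have := hS i j hne
    rw [hij, disjoint_self] at this
    simp [S] at this
  have hSW : ∀ i, S i ⊆ W := by
    intro i
    simp only [S, Finset.insert_subset_iff, Finset.singleton_subset_iff]
    exact ⟨(p i).2, (q' i).2⟩
  refine ⟨I.image S, ⟨?_, ?_⟩, ?_, ?_⟩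
  · intro s hs
    obtain ⟨i, hi, rfl⟩ := Finset.mem_image.1 hs
    exact connected_induce_pair ((hI i).1 hi)
  · intro s hs s' hs' hne
    obtain ⟨i, hi, rfl⟩ := Finset.mem_image.1 hs
    obtain ⟨j, hj, rfl⟩ := Finset.mem_image.1 hs'
    exact hS i j fun h => hne (h ▸ rfl)
  · intro s hs
    obtain ⟨i, hi, rfl⟩ := Finset.mem_image.1 hs
    exact ⟨hSW i, Finset.card_pair fun h => hpq' _ _ (Subtype.ext h)⟩
  · have hc1 : (((C ×ˢ I.image S).filter (fun p => ¬ Touches G {p.1} p.2)).card : ℝ) =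
        ∑ i ∈ I, ((C.filter (fun c => Gᶜ.Adj c (p i) ∧ Gᶜ.Adj c (q' i))).card : ℝ) := by
      rw [← Finset.sum_boole, Finset.sum_product_right, Finset.sum_image fun i _ j _ h => hSinj h]
      refine Finset.sum_congr rfl fun i _ => ?_
      rw [Finset.sum_boole]
      congr 2
      refine Finset.filter_congr fun c hc => not_touches_singleton_pair ?_ ?_
      · rintro rfl
        exact Finset.disjoint_left.1 hCW hc (p i).2
      · rintro rfl
        exact Finset.disjoint_left.1 hCW hc (q' i).2
    have hc2 : ((badPairs G (I.image S)).card : ℝ) = ∑ ij ∈ I.offDiag,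
        (if Gᶜ.Adj (p ij.1).1 (p ij.2).1 ∧ Gᶜ.Adj (p ij.1).1 (q' ij.2).1 ∧
          Gᶜ.Adj (q' ij.1).1 (p ij.2).1 ∧ Gᶜ.Adj (q' ij.1).1 (q' ij.2).1
      then (1 : ℝ) else 0) := by
      rw [Finset.sum_boole]
      have e : badPairs G (I.image S) = (I.offDiag.filter fun ij =>
          Gᶜ.Adj (p ij.1).1 (p ij.2).1 ∧ Gᶜ.Adj (p ij.1).1 (q' ij.2).1 ∧
          Gᶜ.Adj (q' ij.1).1 (p ij.2).1 ∧ Gᶜ.Adj (q' ij.1).1 (q' ij.2).1).image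
          (fun ij => (S ij.1, S ij.2)) := by
        ext ⟨s, s'⟩
        simp only [badPairs, Finset.mem_filter, Finset.mem_product, Finset.mem_image,
          Finset.mem_offDiag, Prod.mk.injEq, Prod.exists]
        constructor
        · rintro ⟨⟨⟨i, hi, rfl⟩, j, hj, rfl⟩, hne, ht⟩
          have hij : i ≠ j := fun h => hne (h ▸ rfl)
          exact ⟨i, j, ⟨⟨hi, hj, hij⟩, (not_touches_pair (hS i j hij)).1 ht⟩, rfl, rfl⟩
        · rintro ⟨i, j, ⟨⟨hi, hj, hij⟩, ht⟩, rfl, rfl⟩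
          exact ⟨⟨⟨i, hi, rfl⟩, j, hj, rfl⟩, fun h => hij (hSinj h),
            (not_touches_pair (hS i j hij)).2 ht⟩
      rw [e, Finset.card_image_of_injOn]
      rintro ⟨i, j⟩ - ⟨i', j'⟩ - hij
      simp only [Prod.mk.injEq] at hij
      rw [hSinj hij.1, hSinj hij.2]
    rw [hc1, hc2, Finset.card_image_of_injective _ hSinj]
    rw [← Finset.mul_sum] at h
    refine h.trans ?_
    have hPP : (0 : ℝ) ≤ P * (P - 1) := by
      rcases Nat.eq_zero_or_pos P with h | h
      · simp [h]
      · have : (1 : ℝ) ≤ P := by exact_mod_cast h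
        exact mul_nonneg (by linarith) (by linarith)
    have h1 : 0 < v - 1 := by linarith
    have h2 : 0 < v - 2 := by linarith
    have h3 : 0 < v - 3 := by linarith
    have h0 : 0 < v := by linarith
    have hA := sum_common_le (G := G) C W hdeg
    have hB := sum_quad_le (G := G) W hdeg
    rw [← Finset.sum_coe_sort W] at hA hB
    simp_rw [← Finset.sum_coe_sort W] at hA hB
    refine add_le_add (add_le_add ?_ ?_) le_rfl
    · simp only [← Finset.mul_sum]
      rw [mul_div_assoc, mul_left_comm, ← mul_assoc]
      exact mul_le_mul_of_nonneg_left
        (div_le_div_of_nonneg_right hA (by positivity)) (by positivity)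
    · exact mul_le_mul_of_nonneg_left
        (div_le_div_of_nonneg_right hB (by positivity)) hPP

end GraphMatching

/-! ### Assembling the minor; the case of a large clique -/

section Construction

open scoped Classical

variable {V : Type*} {G : SimpleGraph V}

lemma card_biUnion_id_eq {B : Finset (Finset V)} {r : ℕ} (hr : ∀ S ∈ B, S.card = r)
    (hd : ∀ S ∈ B, ∀ S' ∈ B, S ≠ S' → Disjoint S S') : (B.biUnion id).card = B.card * r := by
  rw [Finset.card_biUnion (t := id) fun S hS S' hS' hne => hd S hS S' hS' hne]
  exact (Finset.sum_congr rfl hr).trans (by simp)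

/-- The singletons of a clique, a matching and a packing of gulls give a dense minor. -/
lemma exists_minor_of_packing [Fintype V]
    (tri : ∀ a b c, Gᶜ.Adj a b → Gᶜ.Adj b c → ¬ Gᶜ.Adj a c) {C : Finset V}
    (hC : ∀ u ∈ C, ∀ v ∈ C, ¬ Gᶜ.Adj u v) {M : Finset (Finset V)} (hM : BranchSets G M)
    (hMC : ∀ S ∈ M, S ⊆ Finset.univ \ C ∧ S.card = 2) {F : Finset (Finset V)}
    (hF : GullPacking Gᶜ ((Finset.univ \ C) \ M.biUnion id) F) {m : ℕ}
    (hm : m + M.card + 2 * F.card ≤ Fintype.card V) :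
    ∃ H : SimpleGraph (Fin m), H.IsMinor G ∧
      m * (m - 1) ≤ 2 * H.edgeSet.ncard +
        (2 * ((C ×ˢ M).filter (fun p => ¬ Touches G {p.1} p.2)).card + (badPairs G M).card) +
        2 * (m * (m - (C.card + M.card + F.card))) := by
  have hCM : ∀ S ∈ M, Disjoint C S := fun S hS =>
    Finset.disjoint_of_subset_right (hMC S hS).1 Finset.disjoint_sdiff
  have hCF : ∀ S ∈ F, Disjoint C S := fun S hS =>
    Finset.disjoint_of_subset_right ((hF.sub S hS).trans Finset.sdiff_subset)
      Finset.disjoint_sdiff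
  have hMF : ∀ S ∈ M, ∀ S' ∈ F, Disjoint S S' := fun S hS S' hS' =>
    Finset.disjoint_of_subset_right (hF.sub S' hS')
      (Finset.disjoint_of_subset_left (Finset.subset_biUnion_of_mem id hS)
        Finset.disjoint_sdiff)
  have hMne : ∀ S ∈ M, S.Nonempty := fun S hS => hM.nonempty hS
  have hFne : ∀ S ∈ F, S.Nonempty := fun S hS =>
    Finset.card_pos.1 (by rw [(hF.gull S hS).card]; norm_num)
  set S₁ : Finset (Finset V) := C.image fun v => {v} with hS₁
  have hS₁c : S₁.card = C.card := Finset.card_image_of_injective _ Finset.singleton_injective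
  have hd₁ : ∀ S ∈ S₁, ∀ S', Disjoint C S' → Disjoint S S' := by
    intro S hS S' h
    obtain ⟨v, hv, rfl⟩ := Finset.mem_image.1 hS
    exact Finset.disjoint_singleton_left.2 (Finset.disjoint_left.1 h hv)
  have hdj₁ : ∀ S ∈ S₁, ∀ S' ∈ S₁, S ≠ S' → Disjoint S S' := by
    intro S hS S' hS' hne
    obtain ⟨v, hv, rfl⟩ := Finset.mem_image.1 hS
    obtain ⟨v', hv', rfl⟩ := Finset.mem_image.1 hS'
    rw [Finset.disjoint_singleton]
    exact fun h => hne (by rw [h])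
  have hne₁ : ∀ S ∈ S₁, S.Nonempty := by
    intro S hS
    obtain ⟨v, hv, rfl⟩ := Finset.mem_image.1 hS
    exact Finset.singleton_nonempty v
  set B := S₁ ∪ M ∪ F with hB
  have hBne : ∀ S ∈ B, S.Nonempty := by
    intro S hS
    simp only [hB, Finset.mem_union] at hS
    rcases hS with (h | h) | h
    exacts [hne₁ S h, hMne S h, hFne S h]
  have hBS : BranchSets G B := by
    refine ⟨fun S hS => ?_, fun S hS S' hS' hne => ?_⟩
    · simp only [hB, Finset.mem_union] at hS
      rcases hS with (h | h) | h
      · obtain ⟨v, -, rfl⟩ := Finset.mem_image.1 h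
        exact connected_induce_singleton v
      · exact hM.conn S h
      · exact (hF.gull S h).connected
    · simp only [hB, Finset.mem_union] at hS hS'
      rcases hS with (h | h) | h <;> rcases hS' with (h' | h') | h'
      · exact hdj₁ S h S' h' hne
      · exact hd₁ S h S' (hCM S' h')
      · exact hd₁ S h S' (hCF S' h')
      · exact (hd₁ S' h' S (hCM S h)).symm
      · exact hM.disj S h S' h' hne
      · exact hMF S h S' h'
      · exact (hd₁ S' h' S (hCF S h)).symm
      · exact (hMF S' h' S h).symm
      · exact hF.disj S h S' h' hne
  have hdis₁ : Disjoint S₁ M := Finset.disjoint_left.2 fun S h h' =>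
    (hne₁ S h).ne_empty (disjoint_self.1 (hd₁ S h S (hCM S h')))
  have hdis₂ : Disjoint (S₁ ∪ M) F := Finset.disjoint_left.2 fun S h h' => by
    rcases Finset.mem_union.1 h with h | h
    · exact (hne₁ S h).ne_empty (disjoint_self.1 (hd₁ S h S (hCF S h')))
    · exact (hMne S h).ne_empty (disjoint_self.1 (hMF S h S h'))
  have hBc : B.card = C.card + M.card + F.card := by
    rw [hB, Finset.card_union_of_disjoint hdis₂, Finset.card_union_of_disjoint hdis₁, hS₁c]
  have hU : (B.biUnion id).card ≤ C.card + M.card * 2 + F.card * 3 := by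
    rw [hB, Finset.union_biUnion, Finset.union_biUnion]
    refine (Finset.card_union_le _ _).trans (add_le_add ((Finset.card_union_le _ _).trans
      (add_le_add ?_ ?_)) ?_)
    · refine Finset.card_le_card fun v hv => ?_
      obtain ⟨S, hS, hvS⟩ := Finset.mem_biUnion.1 hv
      obtain ⟨u, hu, rfl⟩ := Finset.mem_image.1 hS
      exact (Finset.mem_singleton.1 hvS) ▸ hu
    · exact (card_biUnion_id_eq (fun S hS => (hMC S hS).2) hM.disj).le
    · exact (card_biUnion_id_eq (fun S hS => (hF.gull S hS).card) hF.disj).le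
  have hrest : (Finset.univ \ B.biUnion id).card + (B.biUnion id).card = Fintype.card V := by
    rw [Finset.card_sdiff_add_card_eq_card (Finset.subset_univ _), Finset.card_univ]
  obtain ⟨H, hH, h⟩ := hBS.exists_minor (m := m) (by omega)
  refine ⟨H, hH, h.trans ?_⟩
  rw [hBc]
  -- Gulls touch everything and the singletons come from a clique, so every missing pair involves a
  -- matching edge. Pairs of a singleton and an edge occur in both orders.
  have hbad : badPairs G B ⊆
      (((C ×ˢ M).filter (fun p => ¬ Touches G {p.1} p.2)).image (fun p => ({p.1}, p.2)) ∪
      ((C ×ˢ M).filter (fun p => ¬ Touches G {p.1} p.2)).image (fun p => (p.2, {p.1}))) ∪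
      badPairs G M := by
    rintro ⟨S, S'⟩ hp
    obtain ⟨hp, hne, ht⟩ := Finset.mem_filter.1 hp
    obtain ⟨hS, hS'⟩ := Finset.mem_product.1 hp
    have hd := hBS.disj S hS S' hS' hne
    have hSF : S ∉ F := fun h => ht ((hF.gull S h).touches tri (hBne S' hS') hd)
    have hSF' : S' ∉ F := fun h =>
      ht ((hF.gull S' h).touches tri (hBne S hS) hd.symm).symm
    simp only [hB, Finset.mem_union, hSF, hSF', or_false] at hS hS'
    simp only [Finset.mem_union, Finset.mem_image, Finset.mem_filter, Finset.mem_product,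
      Prod.mk.injEq, Prod.exists]
    rcases hS with h | h <;> rcases hS' with h' | h'
    · exfalso
      obtain ⟨u, hu, rfl⟩ := Finset.mem_image.1 h
      obtain ⟨v, hv, rfl⟩ := Finset.mem_image.1 h'
      refine hC u hu v hv ((SimpleGraph.compl_adj _ _ _).2 ⟨fun h => hne (by rw [h]), fun h =>
        ht ⟨u, by simp, v, by simp, h⟩⟩)
    · obtain ⟨u, hu, rfl⟩ := Finset.mem_image.1 h
      exact Or.inl (Or.inl ⟨u, S', ⟨⟨hu, h'⟩, ht⟩, rfl, rfl⟩)
    · obtain ⟨u, hu, rfl⟩ := Finset.mem_image.1 h'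
      exact Or.inl (Or.inr ⟨u, S, ⟨⟨hu, h⟩, fun h => ht h.symm⟩, rfl, rfl⟩)
    · exact Or.inr (Finset.mem_filter.2 ⟨Finset.mem_product.2 ⟨h, h'⟩, hne, ht⟩)
  have hbc := Finset.card_le_card hbad
  have h1 := Finset.card_union_le
    (((C ×ˢ M).filter (fun p => ¬ Touches G {p.1} p.2)).image (fun p => (({p.1} : Finset V), p.2)) ∪
      ((C ×ˢ M).filter (fun p => ¬ Touches G {p.1} p.2)).image (fun p => (p.2, {p.1})))
      (badPairs G M)
  have h2 := Finset.card_union_le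
    (((C ×ˢ M).filter (fun p => ¬ Touches G {p.1} p.2)).image (fun p => (({p.1} : Finset V), p.2)))
    (((C ×ˢ M).filter (fun p => ¬ Touches G {p.1} p.2)).image (fun p => (p.2, {p.1})))
  have h3 := Finset.card_image_le (s := (C ×ˢ M).filter (fun p => ¬ Touches G {p.1} p.2))
    (f := fun p => (({p.1} : Finset V), p.2))
  have h4 := Finset.card_image_le (s := (C ×ˢ M).filter (fun p => ¬ Touches G {p.1} p.2))
    (f := fun p => (p.2, ({p.1} : Finset V)))
  omega

/-- A maximum clique, described through the complement graph. -/
lemma exists_max_clique [Fintype V] (G : SimpleGraph V) :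
    ∃ C : Finset V, (∀ u ∈ C, ∀ v ∈ C, ¬ Gᶜ.Adj u v) ∧
      ∀ I : Finset V, (∀ u ∈ I, ∀ v ∈ I, ¬ Gᶜ.Adj u v) → I.card ≤ C.card := by
  obtain ⟨C, hC, h⟩ := Finset.exists_max_image
    (Finset.univ.filter fun I : Finset V => ∀ u ∈ I, ∀ v ∈ I, ¬ Gᶜ.Adj u v) Finset.card
    ⟨∅, by simp⟩
  simp only [Finset.mem_filter, Finset.mem_univ, true_and] at hC h
  exact ⟨C, hC, h⟩

/-- Neighbourhoods in a triangle-free graph are independent. -/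
lemma card_neighbors_le [Fintype V]
    (tri : ∀ a b c, Gᶜ.Adj a b → Gᶜ.Adj b c → ¬ Gᶜ.Adj a c) {q : ℕ}
    (hmax : ∀ I : Finset V, (∀ u ∈ I, ∀ v ∈ I, ¬ Gᶜ.Adj u v) → I.card ≤ q) (u : V) :
    (Finset.univ.filter (Gᶜ.Adj u)).card ≤ q := by
  refine hmax _ fun a ha b hb => ?_
  simp only [Finset.mem_filter, Finset.mem_univ, true_and] at ha hb
  exact tri a u b ha.symm hb

/-- If the clique number is at least a quarter of the order, there is an almost complete minor. -/
lemma exists_minor_of_large_clique [Fintype V]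
    (tri : ∀ a b c, Gᶜ.Adj a b → Gᶜ.Adj b c → ¬ Gᶜ.Adj a c) {C : Finset V}
    (hC : ∀ u ∈ C, ∀ v ∈ C, ¬ Gᶜ.Adj u v)
    (hmax : ∀ I : Finset V, (∀ u ∈ I, ∀ v ∈ I, ¬ Gᶜ.Adj u v) → I.card ≤ C.card)
    (h4 : Fintype.card V ≤ 4 * C.card) {m : ℕ} (hm : Fintype.card V ≤ 2 * m)
    (hm' : 2 * m ≤ Fintype.card V + 1) :
    ∃ H : SimpleGraph (Fin m), H.IsMinor G ∧ m * (m - 1) ≤ 2 * H.edgeSet.ncard + 82 * m := by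
  by_cases hbic : ∃ X Y : Finset V, X.Nonempty ∧ Y.Nonempty ∧
      (∀ u ∈ X, ∀ v ∈ Y, Gᶜ.Adj u v) ∧ m ≤ X.card + Y.card
  · obtain ⟨X, Y, hX, hY, hXY, hc⟩ := hbic
    obtain ⟨H, hH, h⟩ := exists_complete_minor tri hm' hX hY hXY hc
    exact ⟨H, hH, by omega⟩
  · push Not at hbic
    have hLc : (Finset.univ \ C).card + C.card = Fintype.card V := by
      rw [Finset.card_sdiff_add_card_eq_card (Finset.subset_univ _), Finset.card_univ]
    -- The truncated difference covers cliques on more than half of the vertices. Otherwise the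
    -- conditions on `k` follow from `n ≤ 4|C|`, from the maximality of `C` and from the absence of
    -- a biclique on `m` vertices.
    obtain ⟨F, hF, hFk, hkF⟩ := exists_gullPacking tri (L := Finset.univ \ C)
      (k := Fintype.card V / 2 - C.card) (by omega)
      (fun I hIL hI => by
        have := hmax I hI
        have := Finset.card_le_card hIL
        omega)
      (fun X hX Y hY hXn hYn hXY => by
        have := hbic X Y hXn hYn hXY
        have h1 := Finset.card_le_card hX
        have h2 := Finset.card_le_card hY
        have h3 : (X ∪ Y).card ≤ (Finset.univ \ C).card :=
          Finset.card_le_card (Finset.union_subset hX hY)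
        rw [Finset.card_union_of_disjoint (Finset.disjoint_left.2 fun v hv hv' =>
          (hXY v hv v hv').ne rfl)] at h3
        omega)
    obtain ⟨H, hH, h⟩ := exists_minor_of_packing tri hC (M := ∅)
      ⟨by simp, by simp⟩ (by simp) (F := F) (by simpa using hF) (m := m)
      (by
        simp only [Finset.card_empty]
        omega)
    refine ⟨H, hH, h.trans ?_⟩
    simp only [Finset.product_empty, Finset.filter_empty, Finset.card_empty, badPairs,
      mul_zero, add_zero]
    -- Up to 40 gulls are lacking, and one branch set is lost between `n/2` rounded down and `m`.
    have : m * (m - (C.card + F.card)) ≤ m * 41 := Nat.mul_le_mul_left m (by omega)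
    omega

end Construction

/-! ### Estimating the expected number of missing pairs -/

section CostEstimate

/-- The difference factors through `1/(d + x) - 1/(d + y)`; the cofactor is nonnegative because both
reciprocals are at most `1/d` and `h` holds. In the application `x` counts the non-edges between the
clique and its complement. -/
lemma cost_mono {d s t q x y : ℝ} (hd : 0 < d) (hs : 0 ≤ s) (ht : 0 ≤ t) (hq : 0 ≤ q)
    (hx : 0 ≤ x) (hxy : x ≤ y) (h : t * q * (s + d) ≤ d ^ 2) :
    2 * t * q * x / (d + x) + t ^ 2 * q ^ 2 * (s - x) / (d + x) ^ 2 ≤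
      2 * t * q * y / (d + y) + t ^ 2 * q ^ 2 * (s - y) / (d + y) ^ 2 := by
  have hdx : 0 < d + x := by linarith
  have hdy : 0 < d + y := by linarith
  have hab : 1 / (d + y) ≤ 1 / (d + x) := one_div_le_one_div_of_le hdx (by linarith)
  have ha : 1 / (d + x) ≤ 1 / d := one_div_le_one_div_of_le hd (by linarith)
  have e : 2 * t * q * y / (d + y) + t ^ 2 * q ^ 2 * (s - y) / (d + y) ^ 2 -
      (2 * t * q * x / (d + x) + t ^ 2 * q ^ 2 * (s - x) / (d + x) ^ 2) =
      t * q * (1 / (d + x) - 1 / (d + y)) *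
        (2 * d + t * q - t * q * (s + d) * (1 / (d + x) + 1 / (d + y))) := by
    field_simp
    ring
  have htq : 0 ≤ t * q := mul_nonneg ht hq
  have h1 : t * q * (s + d) * (1 / (d + x) + 1 / (d + y)) ≤ 2 * d := by
    calc _ ≤ t * q * (s + d) * (1 / d + 1 / d) :=
          mul_le_mul_of_nonneg_left (by linarith) (by positivity)
      _ = 2 * (t * q * (s + d)) / d := by ring
      _ ≤ 2 * d := by
          rw [div_le_iff₀ hd]
          linarith
  rw [← sub_nonneg, e]
  exact mul_nonneg (mul_nonneg htq (by linarith)) (by linarith)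

/-- The extreme case `x = q²`, where the denominator becomes `n² (1 - 3z + 3z²)` with `z = q/n`. -/
lemma cost_at_square {n q v t : ℝ} (hn : 0 < n) (hv : v = n - q) (ht : t = (n - 4 * q) / 2)
    (hg : 0 < v * (v - q) + q ^ 2) :
    2 * t * q * q ^ 2 / (v * (v - q) + q ^ 2) +
      t ^ 2 * q ^ 2 * (q * v - q ^ 2) / (v * (v - q) + q ^ 2) ^ 2 =
      missingDensity (q / n) * n ^ 2 / 4 := by
  subst hv ht
  have h : 1 - 3 * (q / n) + 3 * (q / n) ^ 2 = ((n - q) * (n - q - q) + q ^ 2) / n ^ 2 := by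
    field_simp
    ring
  rw [missingDensity, h]
  have := hg.ne'
  set d := (n - q) * (n - q - q) + q ^ 2 with hd
  field_simp
  rw [hd]
  ring

/-- Monotonicity pushes `x` up to `q²`. Its condition reduces to `t q ≤ (v - q)²`, which follows
from `t ≤ n/2`, `q ≤ n/4` and `v - q ≥ n/2`. -/
lemma cost_main_le {n q v x t δ : ℝ} (hn : 0 < n) (hq : 0 ≤ q) (hqn : 4 * q ≤ n)
    (hv : v = n - q) (hx : 0 ≤ x) (hxq : x ≤ q ^ 2) (ht : t = (n - 4 * q) / 2)
    (hδ : missingDensity (q / n) ≤ δ) :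
    2 * t * q * x / (v * (v - q) + x) + t ^ 2 * q ^ 2 * (q * v - x) / (v * (v - q) + x) ^ 2 ≤
      δ * n ^ 2 / 4 := by
  have hvq : n / 2 ≤ v - q := by linarith
  have hv0 : 0 < v := by linarith
  have hd0 : 0 < v * (v - q) := mul_pos hv0 (by linarith)
  have ht0 : 0 ≤ t := by linarith
  have m := cost_mono (d := v * (v - q)) (s := q * v) (t := t) hd0 (by positivity) ht0 hq hx hxq (by
    have e1 : q * v + v * (v - q) = v ^ 2 := by ring
    have e2 : (v * (v - q)) ^ 2 = (v - q) ^ 2 * v ^ 2 := by ring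
    rw [e1, e2]
    refine mul_le_mul_of_nonneg_right ?_ (sq_nonneg v)
    have h1 : (n / 2) ^ 2 ≤ (v - q) ^ 2 := by gcongr
    have h2 : t * q ≤ n / 2 * (n / 4) := mul_le_mul (by linarith) (by linarith) hq (by linarith)
    nlinarith)
  refine m.trans ?_
  rw [cost_at_square hn hv ht (by positivity)]
  have := mul_le_mul_of_nonneg_right hδ (sq_nonneg n)
  linarith

lemma correction_le {y : ℝ} (h0 : 0 ≤ y) (h : y ≤ 1 / 8) :
    (1 + 4 * y) ^ 2 * (1 + 8 * y) ≤ 1 + 28 * y := by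
  have h2 : y ^ 2 ≤ 1 / 8 * y := by nlinarith
  have h3 : y ^ 3 ≤ 1 / 64 * y := by nlinarith
  linarith [show (1 + 4 * y) ^ 2 * (1 + 8 * y) = 1 + 16 * y + 80 * y ^ 2 + 128 * y ^ 3 by ring]

-- Since `P/(v (v - 1)) ≤ t/g` and `g ≥ v (v - q) + x - v`, the expectation exceeds the main term by
-- a factor at most `1 + 28/n`. The main term is at most `n²/4`, so the excess is at most `7n`.
set_option maxHeartbeats 800000 in
lemma cost_le {n q v x e g t P δ : ℝ} (hn : 8 ≤ n) (hq : 0 ≤ q) (hqn : 4 * q ≤ n)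
    (hv : v = n - q) (hx : 0 ≤ x) (hxq : x ≤ q ^ 2) (he : 0 ≤ e) (hex : e ≤ q * v - x)
    (hg : g = v * (v - 1) - e) (ht : t = (n - 4 * q) / 2) (hP : 0 ≤ P) (hPv : 2 * P ≤ v)
    (hPg : P * g ≤ t * (v * (v - 1))) (hδ : missingDensity (q / n) ≤ δ) (hδ1 : δ ≤ 1) :
    2 * P * (q * x / (v * (v - 1))) + P * (P - 1) *
      (q ^ 2 * e / (v * (v - 1) * (v - 2) * (v - 3))) ≤ δ * n ^ 2 / 4 + 7 * n := by
  have hv6 : 6 ≤ v := by linarith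
  have h0 : 0 < v := by linarith
  have h1 : 0 < v - 1 := by linarith
  have h2 : 0 < v - 2 := by linarith
  have h3 : 0 < v - 3 := by linarith
  have ht0 : 0 ≤ t := by rw [ht]; linarith
  have hvq : n / 2 ≤ v - q := by linarith
  have hvn : 3 / 4 * n ≤ v := by linarith
  set d := v * (v - q) with hd
  have hdn : 3 / 8 * n ^ 2 ≤ d := by
    calc 3 / 8 * n ^ 2 = 3 / 4 * n * (n / 2) := by ring
      _ ≤ v * (v - q) := mul_le_mul hvn hvq (by linarith) h0.le
  have hd0 : 0 < d := mul_pos h0 (by linarith)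
  have hdx : 0 < d + x := by linarith
  have hgv : (d + x) - v ≤ g := by rw [hg, hd]; linarith
  have hn0 : 0 < n := by linarith
  have hgn : n ^ 2 / 4 ≤ (d + x) - v := by
    have : 8 * n ≤ n ^ 2 := by rw [pow_two]; exact mul_le_mul_of_nonneg_right hn hn0.le
    linarith
  have hg0 : 0 < g := lt_of_lt_of_le (by positivity) (hgn.trans hgv)
  have hginv : 1 / g ≤ (1 + 4 / n) / (d + x) := by
    rw [div_le_div_iff₀ hg0 hdx]
    have : v ≤ 4 / n * g := by
      rw [div_mul_eq_mul_div, le_div_iff₀ hn0]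
      have : v * n ≤ n * n := mul_le_mul_of_nonneg_right (by linarith) hn0.le
      linarith
    linarith
  have hPt : P / (v * (v - 1)) ≤ t * (1 / g) := by
    rw [mul_one_div, div_le_div_iff₀ (by positivity) hg0]
    linarith
  have hPt' : P / (v * (v - 1)) ≤ t * ((1 + 4 / n) / (d + x)) :=
    hPt.trans (mul_le_mul_of_nonneg_left hginv ht0)
  set A₁ := 2 * t * q * x / (d + x) with hA₁
  set A₂ := t ^ 2 * q ^ 2 * (q * v - x) / (d + x) ^ 2 with hA₂
  have hA₁0 : 0 ≤ A₁ := by positivity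
  have hA₂0 : 0 ≤ A₂ := div_nonneg (mul_nonneg (by positivity) (by linarith)) (by positivity)
  have b1 : 2 * P * (q * x / (v * (v - 1))) ≤ A₁ * (1 + 4 / n) := by
    calc 2 * P * (q * x / (v * (v - 1))) = 2 * q * x * (P / (v * (v - 1))) := by ring
      _ ≤ 2 * q * x * (t * ((1 + 4 / n) / (d + x))) :=
          mul_le_mul_of_nonneg_left hPt' (by positivity)
      _ = A₁ * (1 + 4 / n) := by rw [hA₁]; ring
  have b2 : P * (P - 1) * (q ^ 2 * e / (v * (v - 1) * (v - 2) * (v - 3))) ≤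
      A₂ * ((1 + 4 / n) ^ 2 * (1 + 8 / n)) := by
    have c1 : P * (P - 1) ≤ P ^ 2 * ((v - 2) / v) := by
      rw [mul_div_assoc', le_div_iff₀ h0]
      nlinarith [mul_nonneg hP (sub_nonneg.2 hPv)]
    have c2 : (v - 1) / (v - 3) ≤ 1 + 8 / n := by
      rw [div_le_iff₀ h3]
      have : 2 ≤ 8 / n * (v - 3) := by
        rw [div_mul_eq_mul_div, le_div_iff₀ hn0]
        linarith
      linarith
    calc _ ≤ P ^ 2 * ((v - 2) / v) * (q ^ 2 * e / (v * (v - 1) * (v - 2) * (v - 3))) :=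
          mul_le_mul_of_nonneg_right c1 (by positivity)
      _ = q ^ 2 * e * (P / (v * (v - 1))) ^ 2 * ((v - 1) / (v - 3)) := by
          field_simp
      _ ≤ q ^ 2 * (q * v - x) * (t * ((1 + 4 / n) / (d + x))) ^ 2 * (1 + 8 / n) := by
          have : 0 ≤ q * v - x := by linarith
          gcongr
      _ = A₂ * ((1 + 4 / n) ^ 2 * (1 + 8 / n)) := by
          rw [hA₂]
          generalize d + x = D
          generalize 1 + 4 / n = r
          ring
  have hA : A₁ + A₂ ≤ δ * n ^ 2 / 4 := cost_main_le hn0 hq hqn hv hx hxq ht hδ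
  have hy : 1 / n ≤ 1 / 8 := one_div_le_one_div_of_le (by norm_num) hn
  have hy0 : 0 < 1 / n := by positivity
  have c4 : 4 / n = 4 * (1 / n) := by ring
  have c8 : 8 / n = 8 * (1 / n) := by ring
  have hfac : (1 + 4 / n) ^ 2 * (1 + 8 / n) ≤ 1 + 28 * (1 / n) := by
    rw [c4, c8]
    exact correction_le hy0.le hy
  have hfac1 : 1 + 4 / n ≤ 1 + 28 * (1 / n) := by rw [c4]; linarith
  have hAn : A₁ + A₂ ≤ n ^ 2 / 4 := hA.trans (by
    have := mul_le_mul_of_nonneg_right hδ1 (sq_nonneg n)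
    linarith)
  calc _ ≤ A₁ * (1 + 28 * (1 / n)) + A₂ * (1 + 28 * (1 / n)) :=
        add_le_add (b1.trans (mul_le_mul_of_nonneg_left hfac1 hA₁0))
          (b2.trans (mul_le_mul_of_nonneg_left hfac hA₂0))
    _ = (A₁ + A₂) + 28 * (A₁ + A₂) / n := by ring
    _ ≤ δ * n ^ 2 / 4 + 28 * (n ^ 2 / 4) / n := by gcongr
    _ = δ * n ^ 2 / 4 + 7 * n := by field_simp; ring

end CostEstimate

/-! ### The case of a small clique -/

section SmallClique

open scoped Classical

variable {V : Type*} {G : SimpleGraph V}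

lemma badPairs_subset {M M' : Finset (Finset V)} (h : M' ⊆ M) :
    badPairs G M' ⊆ badPairs G M :=
  Finset.filter_subset_filter _ (Finset.product_subset_product h h)

lemma BranchSets.mono {M M' : Finset (Finset V)} (hM : BranchSets G M) (h : M' ⊆ M) :
    BranchSets G M' :=
  ⟨fun S hS => hM.conn S (h hS), fun S hS S' hS' => hM.disj S (h hS) S' (h hS')⟩

/-- A sparse random matching outside a small maximum clique, with its size under control. -/
lemma exists_matching_of_small_clique [Fintype V]
    (tri : ∀ a b c, Gᶜ.Adj a b → Gᶜ.Adj b c → ¬ Gᶜ.Adj a c) {C : Finset V}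
    (hmax : ∀ I : Finset V, (∀ u ∈ I, ∀ v ∈ I, ¬ Gᶜ.Adj u v) → I.card ≤ C.card)
    (h4 : 4 * C.card < Fintype.card V) {n w δ : ℝ} (hn : n = Fintype.card V) (h8 : 8 ≤ n)
    (hw : 1 ≤ w) (hwn : w ^ 4 = n)
    (hδ : ∀ z ∈ Set.Icc (0 : ℝ) (1 / 4), missingDensity z ≤ δ) (hδ1 : δ ≤ 1) :
    ∃ M : Finset (Finset V), BranchSets G M ∧ (∀ S ∈ M, S ⊆ Finset.univ \ C ∧ S.card = 2) ∧
      2 * (((C ×ˢ M).filter (fun p => ¬ Touches G {p.1} p.2)).card : ℝ) + (badPairs G M).card ≤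
        δ * n ^ 2 / 4 + 7 * n + 2 * w ^ 6 ∧
      2 * M.card + 4 * C.card ≤ Fintype.card V ∧
      (n - 4 * C.card) / 2 - 1 - 4 * w ^ 3 ≤ M.card := by
  have hLc : (Finset.univ \ C).card + C.card = Fintype.card V := by
    rw [Finset.card_sdiff_add_card_eq_card (Finset.subset_univ _), Finset.card_univ]
  set W := Finset.univ \ C with hW
  have hCW : Disjoint C W := Finset.disjoint_sdiff
  obtain ⟨q, hq⟩ : ∃ q : ℝ, q = C.card := ⟨_, rfl⟩
  obtain ⟨v, hv⟩ : ∃ v : ℝ, v = W.card := ⟨_, rfl⟩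
  have hvn : v = n - q := by
    rw [hn, ← hLc, hv, hq]
    push_cast
    ring
  have hq0 : 0 ≤ q := hq ▸ Nat.cast_nonneg _
  have hqn : 4 * q ≤ n := by rw [hn, hq]; exact_mod_cast h4.le
  have hdeg := card_neighbors_le tri hmax
  have hx : (nonEdges G C W : ℝ) ≤ q ^ 2 := by
    rw [pow_two, hq]; exact_mod_cast nonEdges_le C W hdeg
  have he : (nonEdges G W W : ℝ) ≤ q * v - nonEdges G C W := by
    rw [le_sub_iff_add_le, hq, hv]
    exact_mod_cast nonEdges_add_le hCW hdeg
  have hx0 : (0 : ℝ) ≤ nonEdges G C W := Nat.cast_nonneg _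
  have he0 : (0 : ℝ) ≤ nonEdges G W W := Nat.cast_nonneg _
  obtain ⟨g, hg⟩ : ∃ g, g = v * (v - 1) - nonEdges G W W := ⟨_, rfl⟩
  obtain ⟨t, ht⟩ : ∃ t, t = (n - 4 * q) / 2 := ⟨_, rfl⟩
  have ht0 : 0 ≤ t := by linarith
  have hv6 : 6 ≤ v := by linarith
  have hvv : 0 < v * (v - 1) := mul_pos (by linarith) (by linarith)
  have hqv : q * v ≤ v / 3 * v := mul_le_mul_of_nonneg_right (by linarith) (by linarith)
  have hv2 : 6 * v ≤ v * v := mul_le_mul_of_nonneg_right hv6 (by linarith)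
  have hg0 : 0 < g := by linarith
  have hgle : g ≤ v * (v - 1) := by linarith
  -- A random pair is an edge with probability `g/(v (v - 1))`, so this many pairs yield `t` edges
  -- on average, up to one.
  set P := ⌊t * (v * (v - 1)) / g⌋₊ with hP
  have hP1 : (P : ℝ) ≤ t * (v * (v - 1)) / g := Nat.floor_le (by positivity)
  have hPg : (P : ℝ) * g ≤ t * (v * (v - 1)) := (le_div_iff₀ hg0).1 hP1
  have hP2 : t * (v * (v - 1)) / g - 1 ≤ P := (Nat.sub_one_lt_floor _).le
  have hPv : 2 * (P : ℝ) ≤ v := by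
    have : t * (v * (v - 1)) / g ≤ v / 2 := by
      rw [div_le_iff₀ hg0]
      have e1 : t = (v - 3 * q) / 2 := by rw [ht, hvn]; ring
      have e2 : q * v ≤ 3 * q * (v - 1) := by
        have : 6 * q ≤ v * q := mul_le_mul_of_nonneg_right hv6 hq0
        linarith
      have e3 : (v - 3 * q) * (v - 1) ≤ g := by linarith
      have e4 := mul_le_mul_of_nonneg_left e3 (show 0 ≤ v / 2 by linarith)
      rw [e1]
      linarith
    linarith
  obtain ⟨μ, hμ⟩ : ∃ μ, μ = P * (g / (v * (v - 1))) := ⟨_, rfl⟩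
  have hμt : t - 1 ≤ μ := by
    have h1 : g / (v * (v - 1)) ≤ 1 := (div_le_one hvv).2 hgle
    have h2 : (t * (v * (v - 1)) / g - 1) * (g / (v * (v - 1))) ≤ μ := by
      rw [hμ]
      exact mul_le_mul_of_nonneg_right hP2 (by positivity)
    have h3 : (t * (v * (v - 1)) / g - 1) * (g / (v * (v - 1))) = t - g / (v * (v - 1)) := by
      have := hvv.ne'
      set z := v * (v - 1)
      field_simp
    linarith
  -- With penalty weight `w² = √n`, a deviation of `4w³` would cost `16 w⁸ = 16n²`, more than the
  -- whole bound, while the penalty itself adds only `2w⁶`.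
  have hlam : (0 : ℝ) ≤ w ^ 2 := sq_nonneg w
  obtain ⟨M, hM, hMW, hMb⟩ := exists_matching hCW hdeg
    (by rw [hv] at hv6; exact_mod_cast hv6) (P := P) (by rw [hv] at hPv; exact_mod_cast hPv)
    hv hg hμ hlam
  rw [← hq] at hMb
  have hcost := cost_le h8 hq0 hqn hvn hx0 hx he0 he hg ht (Nat.cast_nonneg P) hPv hPg
    (hδ (q / n) ⟨by positivity, by rw [div_le_div_iff₀ (by linarith) (by norm_num)]; linarith⟩) hδ1
  have hw2 : w ^ 2 * (2 * v) ≤ 2 * w ^ 6 := by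
    have : w ^ 2 * v ≤ w ^ 2 * w ^ 4 := mul_le_mul_of_nonneg_left (by linarith) hlam
    linarith [show w ^ 2 * w ^ 4 = w ^ 6 by ring]
  have htot := hMb.trans (add_le_add hcost hw2)
  have hdev : μ - 4 * w ^ 3 ≤ M.card := by
    by_contra! hlt
    have hw0 : 0 < w := by linarith
    have h1 : (4 * w ^ 3) ^ 2 ≤ (μ - M.card) ^ 2 := by
      have : 4 * w ^ 3 ≤ μ - M.card := by linarith
      gcongr
    have h2 : w ^ 2 * (4 * w ^ 3) ^ 2 ≤ w ^ 2 * (M.card - μ) ^ 2 := by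
      rw [← neg_sub μ, neg_sq]
      exact mul_le_mul_of_nonneg_left h1 hlam
    have h3 : δ * n ^ 2 ≤ w ^ 8 := by
      have := mul_le_mul_of_nonneg_right hδ1 (sq_nonneg n)
      have e : n ^ 2 = w ^ 8 := by rw [← hwn]; ring
      linarith
    have h4 : n ≤ w ^ 8 := by
      rw [← hwn]; exact pow_le_pow_right₀ hw (by norm_num)
    have h6 : w ^ 6 ≤ w ^ 8 := pow_le_pow_right₀ hw (by norm_num)
    have h7 : 0 < w ^ 8 := by positivity
    have h5 : w ^ 2 * (4 * w ^ 3) ^ 2 = 16 * w ^ 8 := by ring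
    have h9 : (0 : ℝ) ≤ (((C ×ˢ M).filter (fun p => ¬ Touches G {p.1} p.2)).card : ℝ) :=
      Nat.cast_nonneg _
    have h10 : (0 : ℝ) ≤ ((badPairs G M).card : ℝ) := Nat.cast_nonneg _
    linarith
  -- Cutting the matching down to at most `t` edges keeps three vertices per clique vertex for the
  -- gulls.
  obtain ⟨M', hM', hM'c⟩ := Finset.exists_subset_card_eq (min_le_left M.card ⌊t⌋₊)
  refine ⟨M', hM.mono hM', fun S hS => hMW S (hM' hS), ?_, ?_, ?_⟩
  · have h1 : (((C ×ˢ M').filter (fun p => ¬ Touches G {p.1} p.2)).card : ℝ) ≤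
        ((C ×ˢ M).filter (fun p => ¬ Touches G {p.1} p.2)).card := by
      refine Nat.cast_le.2 (Finset.card_le_card
        (Finset.filter_subset_filter _ (Finset.product_subset_product le_rfl hM')))
    have h2 : ((badPairs G M').card : ℝ) ≤ (badPairs G M).card := by
      exact_mod_cast Finset.card_le_card (badPairs_subset hM')
    have h3 : 0 ≤ w ^ 2 * (M.card - μ) ^ 2 := by positivity
    linarith
  · have h1 : (M'.card : ℝ) ≤ t := by
      rw [hM'c]
      exact (Nat.cast_le.2 (min_le_right _ _)).trans (Nat.floor_le ht0)
    have h2 : 2 * (M'.card : ℝ) + 4 * q ≤ n := by linarith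
    rw [hn, hq] at h2
    exact_mod_cast h2
  · rw [hM'c, ← hq, ← ht, Nat.cast_min, le_min_iff]
    have hw3 : 0 < w ^ 3 := pow_pos (by linarith) 3
    exact ⟨by linarith, by linarith [Nat.sub_one_lt_floor t]⟩

/-- At least `3q` vertices remain outside `C` and the matching, and each side of a biclique lies in
a neighbourhood, so has at most `q` vertices. Hence neither obstruction prevents packing `q` gulls
up to the constant 40. -/
lemma exists_minor_of_small_clique [Fintype V]
    (tri : ∀ a b c, Gᶜ.Adj a b → Gᶜ.Adj b c → ¬ Gᶜ.Adj a c) {C : Finset V}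
    (hC : ∀ u ∈ C, ∀ v ∈ C, ¬ Gᶜ.Adj u v)
    (hmax : ∀ I : Finset V, (∀ u ∈ I, ∀ v ∈ I, ¬ Gᶜ.Adj u v) → I.card ≤ C.card)
    (h4 : 4 * C.card < Fintype.card V) {n w δ : ℝ} (hn : n = Fintype.card V) (h8 : 8 ≤ n)
    (hw : 1 ≤ w) (hwn : w ^ 4 = n)
    (hδ : ∀ z ∈ Set.Icc (0 : ℝ) (1 / 4), missingDensity z ≤ δ) (hδ1 : δ ≤ 1)
    {m : ℕ} (hm : 2 * m ≤ Fintype.card V + 1) :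
    ∃ H : SimpleGraph (Fin m), H.IsMinor G ∧
      (m * (m - 1) : ℝ) ≤ 2 * H.edgeSet.ncard + (δ * n ^ 2 / 4 + 7 * n + 2 * w ^ 6) +
        2 * (m * (42 + 4 * w ^ 3)) := by
  obtain ⟨M, hM, hMC, hcost, hMle, hMge⟩ :=
    exists_matching_of_small_clique tri hmax h4 hn h8 hw hwn hδ hδ1
  have hLc : (Finset.univ \ C).card + C.card = Fintype.card V := by
    rw [Finset.card_sdiff_add_card_eq_card (Finset.subset_univ _), Finset.card_univ]
  have hMsub : M.biUnion id ⊆ Finset.univ \ C :=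
    Finset.biUnion_subset.2 fun S hS => (hMC S hS).1
  have hMu := card_biUnion_id_eq (fun S hS => (hMC S hS).2) hM.disj
  have hL := Finset.card_sdiff_add_card_eq_card hMsub
  have hdeg := card_neighbors_le tri hmax
  obtain ⟨F, hF, hFk, hkF⟩ := exists_gullPacking tri (L := (Finset.univ \ C) \ M.biUnion id)
    (k := C.card) (by omega)
    (fun I _ hI => by
      have := hmax I hI
      omega)
    (fun X hX Y hY ⟨x, hx⟩ ⟨y, hy⟩ hXY => by
      have h1 : X.card ≤ C.card := (Finset.card_le_card fun u hu => by
        simpa using (hXY u hu y hy).symm).trans (hdeg y)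
      have h2 : Y.card ≤ C.card := (Finset.card_le_card fun u hu => by
        simpa using hXY x hx u hu).trans (hdeg x)
      omega)
  obtain ⟨H, hH, h⟩ := exists_minor_of_packing tri hC hM hMC hF (m := m) (by omega)
  refine ⟨H, hH, ?_⟩
  have h' : ((m * (m - 1) : ℕ) : ℝ) ≤ 2 * H.edgeSet.ncard +
        (2 * (((C ×ˢ M).filter (fun p => ¬ Touches G {p.1} p.2)).card : ℝ) +
          (badPairs G M).card) +
        2 * (m * ((m - (C.card + M.card + F.card) : ℕ) : ℝ)) := by exact_mod_cast h
  have hmm : ((m * (m - 1) : ℕ) : ℝ) = m * (m - 1) := by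
    rcases Nat.eq_zero_or_pos m with h | h
    · simp [h]
    · push_cast [Nat.cast_sub h]
      ring
  -- The shortfall is at most 40 gulls, `1 + 4w³` matching edges and one half from rounding `n/2`.
  have hj : ((m - (C.card + M.card + F.card) : ℕ) : ℝ) ≤ 42 + 4 * w ^ 3 := by
    have hw3 : 0 < w ^ 3 := pow_pos (by linarith) 3
    rcases le_total m (C.card + M.card + F.card) with h | h
    · rw [Nat.sub_eq_zero_of_le h]
      push_cast
      linarith
    · rw [Nat.cast_sub h]
      push_cast
      have h1 : 2 * (m : ℝ) ≤ n + 1 := by rw [hn]; exact_mod_cast hm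
      have h2 : (C.card : ℝ) ≤ F.card + 40 := by exact_mod_cast hkF
      linarith
  have hj' := mul_le_mul_of_nonneg_left hj (Nat.cast_nonneg (α := ℝ) m)
  rw [hmm] at h'
  linarith

end SmallClique
-- The maximum of `missingDensity`
section Extremum

lemma denominator_pos (z : ℝ) : 0 < 1 - 3 * z + 3 * z ^ 2 := by nlinarith [sq_nonneg (2 * z - 1)]

lemma continuous_missingDensity : Continuous missingDensity := by
  unfold missingDensity
  exact Continuous.div (by fun_prop) (by fun_prop) fun z => (pow_pos (denominator_pos z) 2).ne'

lemma missingDensity_le {z : ℝ} (hz : z ∈ Set.Icc (0 : ℝ) (1 / 4)) :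
    missingDensity z ≤ 0.013118 := by
  obtain ⟨h0, h1⟩ := hz
  rw [missingDensity, div_le_iff₀ (pow_pos (denominator_pos z) 2)]
  -- The quartic is the quotient of `0.013118 * (1 - 3z + 3z²)²` minus the numerator by `(z -
  -- 0.194)²`. The remainder is linear, tiny and positive at `0.194`; where it is negative, `0.3 *
  -- (z - 0.194)²` outweighs it.
  have hq : 0.3 ≤ 43583264837 / 125000000000 + 187823867 / 125000000 * z +
      5727351 / 500000 * z ^ 2 - 1524 / 25 * z ^ 3 + 80 * z ^ 4 := by
    have h2 : z ^ 2 ≤ 1 / 4 * z := by nlinarith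
    have h3 : z ^ 3 ≤ 1 / 4 * z ^ 2 := by nlinarith [sq_nonneg z]
    have h4 : 0 ≤ z ^ 4 := by positivity
    linarith
  have key := mul_le_mul_of_nonneg_right hq (sq_nonneg (z - 0.194))
  nlinarith [sq_nonneg (z - 0.19)]

lemma exists_isGreatest_missingDensity :
    ∃ γ : ℝ, IsGreatest (missingDensity '' Set.Icc (0 : ℝ) (1 / 4)) (1 - γ) ∧
      0.986882 ≤ γ ∧ γ < 0.986883 := by
  obtain ⟨M, hM⟩ := (isCompact_Icc.image continuous_missingDensity).exists_isGreatest
    ((Set.nonempty_Icc.2 (by norm_num : (0 : ℝ) ≤ 1 / 4)).image missingDensity)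
  refine ⟨1 - M, by rwa [sub_sub_cancel], ?_, ?_⟩
  · obtain ⟨z, hz, h⟩ := hM.1
    have := missingDensity_le hz
    linarith
  · have h : missingDensity 0.194 ≤ M := hM.2 ⟨0.194, by norm_num, rfl⟩
    have : (0.013117 : ℝ) < missingDensity 0.194 := by norm_num [missingDensity]
    linarith

end Extremum

/-! ### Combining the two cases -/

section Main

open scoped Classical

lemma SimpleGraph.compl_triangleFree {V : Type*} {G : SimpleGraph V} [Finite V]
    (h : G.indepNum ≤ 2) : ∀ a b c, Gᶜ.Adj a b → Gᶜ.Adj b c → ¬ Gᶜ.Adj a c := by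
  intro a b c hab hbc hac
  cases nonempty_fintype V
  have hI : G.IsIndepSet (({a, b, c} : Finset V) : Set V) := by
    rw [SimpleGraph.compl_adj] at hab hbc hac
    intro x hx y hy hxy
    simp only [Finset.coe_insert, Finset.coe_singleton, Set.mem_insert_iff,
      Set.mem_singleton_iff] at hx hy
    rcases hx with rfl | rfl | rfl <;> rcases hy with rfl | rfl | rfl <;>
      simp_all [SimpleGraph.adj_comm]
  have h3 : ({a, b, c} : Finset V).card = 3 :=
    Finset.card_eq_three.2 ⟨a, b, c, hab.ne, hac.ne, hbc.ne, rfl⟩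
  have := hI.card_le_indepNum
  omega

lemma exists_dense_minor {V : Type*} [Fintype V] {G : SimpleGraph V}
    (tri : ∀ a b c, Gᶜ.Adj a b → Gᶜ.Adj b c → ¬ Gᶜ.Adj a c) {δ w : ℝ}
    (hδ : ∀ z ∈ Set.Icc (0 : ℝ) (1 / 4), missingDensity z ≤ δ) (hδ1 : δ ≤ 1) (hδ0 : 0 ≤ δ)
    (hw : 1 ≤ w) (hwn : w ^ 4 = Fintype.card V) {m : ℕ} (hm : Fintype.card V ≤ 2 * m)
    (hm' : 2 * m ≤ Fintype.card V + 1) :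
    ∃ H : SimpleGraph (Fin m), H.IsMinor G ∧
      (1 - δ - 500 / w) * m.choose 2 ≤ H.edgeSet.ncard := by
  have hw0 : 0 < w := by linarith
  have hm0 : (0 : ℝ) ≤ m := Nat.cast_nonneg _
  have hnm : w ^ 4 ≤ 2 * m := by rw [hwn]; exact_mod_cast hm
  have hnm' : 2 * m ≤ w ^ 4 + 1 := by rw [hwn]; exact_mod_cast hm'
  rcases lt_or_ge (w ^ 4) 8 with h8 | h8
  -- For fewer than eight vertices `500 / w ≥ 1`, so the bound is void and any minor will do.
  · have B : BranchSets G ∅ := ⟨by simp, by simp⟩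
    obtain ⟨H, hH, -⟩ := B.exists_minor (m := m) (by
      simp only [Finset.card_empty, Finset.biUnion_empty, Finset.sdiff_empty, Finset.card_univ]
      have : (0 : ℝ) < Fintype.card V := by rw [← hwn]; positivity
      have : 0 < Fintype.card V := by exact_mod_cast this
      omega)
    refine ⟨H, hH, (mul_nonpos_of_nonpos_of_nonneg ?_ (Nat.cast_nonneg _)).trans
      (Nat.cast_nonneg _)⟩
    have hw2 : w ≤ 2 := by
      by_contra! h
      have : (2 : ℝ) ^ 4 < w ^ 4 := by gcongr
      linarith
    have : 1 ≤ 500 / w := by rw [le_div_iff₀ hw0]; linarith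
    linarith
  -- In units of `m w³`: 84 + 8 from `2m (42 + 4w³)`, 4 from `2w⁶`, 14 from `7n`, and 1 from passing
  -- from `n²/4` to `m (m - 1)`. As `m - 1 ≥ w⁴/4`, the constant 500 exceeds the required `4 * 111`.
  · suffices h : ∃ H : SimpleGraph (Fin m), H.IsMinor G ∧
        (m * (m - 1) : ℝ) ≤ 2 * H.edgeSet.ncard + δ * (m * (m - 1)) + 111 * (m * w ^ 3) by
      obtain ⟨H, hH, h⟩ := h
      refine ⟨H, hH, ?_⟩
      rw [Nat.cast_choose_two]
      have h1 : 500 / w * (m * (m - 1)) ≥ 111 * (m * w ^ 3) := by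
        rw [ge_iff_le, div_mul_eq_mul_div, le_div_iff₀ hw0]
        have : w ^ 4 / 4 ≤ m - 1 := by linarith
        have := mul_le_mul_of_nonneg_left this hm0
        have : 0 ≤ m * w ^ 4 := by positivity
        linarith [show 111 * (m * w ^ 3) * w = 111 * (m * w ^ 4) by ring]
      linarith
    have hw3 : 1 ≤ w ^ 3 := one_le_pow₀ hw
    have hw23 : w ^ 2 ≤ w ^ 3 := pow_le_pow_right₀ hw (by norm_num)
    have e1 : m * 1 ≤ m * w ^ 3 := mul_le_mul_of_nonneg_left hw3 hm0
    have e2 : m * w ^ 2 ≤ m * w ^ 3 := mul_le_mul_of_nonneg_left hw23 hm0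
    have hmm : 0 ≤ (m : ℝ) * (m - 1) := mul_nonneg hm0 (by linarith)
    obtain ⟨C, hC, hmax⟩ := exists_max_clique G
    rcases le_or_gt (Fintype.card V) (4 * C.card) with h4 | h4
    · obtain ⟨H, hH, h⟩ := exists_minor_of_large_clique tri hC hmax h4 hm hm'
      refine ⟨H, hH, ?_⟩
      have h' : ((m * (m - 1) : ℕ) : ℝ) ≤ 2 * H.edgeSet.ncard + 82 * m := by exact_mod_cast h
      have h1 : 1 ≤ m := by
        have : (1 : ℝ) ≤ m := by linarith
        exact_mod_cast this
      push_cast [h1] at h'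
      have := mul_nonneg hδ0 hmm
      linarith
    · obtain ⟨H, hH, h⟩ := exists_minor_of_small_clique tri hC hmax h4 hwn h8 hw rfl hδ hδ1 hm'
      refine ⟨H, hH, h.trans ?_⟩
      have a1 : w ^ 6 ≤ 2 * m * w ^ 2 := by
        have := mul_le_mul_of_nonneg_right hnm (sq_nonneg w)
        linarith [show w ^ 4 * w ^ 2 = w ^ 6 by ring]
      have a2 : δ * (w ^ 4) ^ 2 / 4 ≤ δ * (m * (m - 1)) + m := by
        have b1 : (w ^ 4) ^ 2 ≤ (2 * m) ^ 2 := by gcongr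
        have b2 := mul_le_mul_of_nonneg_left b1 hδ0
        have b3 := mul_le_mul_of_nonneg_right hδ1 hm0
        linarith
      linarith

end Main

theorem theorem1 :
    ∃ γ : ℝ,
      IsGreatest (missingDensity '' Set.Icc (0 : ℝ) (1 / 4)) (1 - γ) ∧
      0.986882 ≤ γ ∧ γ < 0.986883 ∧
      ∃ ε : ℕ → ℝ, Tendsto ε atTop (𝓝 0) ∧
        ∀ (V : Type*) [Finite V] (G : SimpleGraph V), G.indepNum ≤ 2 →
          ∃ (m : ℕ) (H : SimpleGraph (Fin m)),
            m = ⌈(Nat.card V : ℝ) / 2⌉₊ ∧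
            H.IsMinor G ∧
            (γ - ε (Nat.card V)) * (m.choose 2 : ℝ) ≤ (H.edgeSet.ncard : ℝ) := by
  obtain ⟨γ, hγ, h1, h2⟩ := exists_isGreatest_missingDensity
  refine ⟨γ, hγ, h1, h2, fun n => 500 / √(√(n : ℝ)), ?_, fun V _ G hG => ?_⟩
  · exact Tendsto.const_div_atTop (Real.tendsto_sqrt_atTop.comp
      (Real.tendsto_sqrt_atTop.comp tendsto_natCast_atTop_atTop)) _
  · cases nonempty_fintype V
    rw [Nat.card_eq_fintype_card]
    set n := Fintype.card V with hn
    have hc : n ≤ 2 * ⌈(n : ℝ) / 2⌉₊ := by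
      have : (n : ℝ) ≤ 2 * ⌈(n : ℝ) / 2⌉₊ := by linarith [Nat.le_ceil ((n : ℝ) / 2)]
      exact_mod_cast this
    have hc' : 2 * ⌈(n : ℝ) / 2⌉₊ < n + 2 := by
      have : 2 * (⌈(n : ℝ) / 2⌉₊ : ℝ) < n + 2 := by
        linarith [Nat.ceil_lt_add_one (show 0 ≤ (n : ℝ) / 2 by positivity)]
      exact_mod_cast this
    refine ⟨⌈(n : ℝ) / 2⌉₊, ?_⟩
    generalize ⌈(n : ℝ) / 2⌉₊ = m at hc hc'
    rcases Nat.eq_zero_or_pos n with h0 | h0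
    · obtain rfl : m = 0 := by omega
      -- The empty graph is separate because `exists_dense_minor` needs `w ≥ 1`.
      refine ⟨⊥, rfl, ⟨fun i => i.elim0, fun i => i.elim0, fun i => i.elim0, fun i => i.elim0⟩, by simp⟩
    · obtain ⟨H, hH, h⟩ := exists_dense_minor (SimpleGraph.compl_triangleFree hG) (δ := 1 - γ)
        (w := √(√(n : ℝ))) (fun z hz => hγ.2 ⟨z, hz, rfl⟩) (by linarith) (by linarith)
        (by
          rw [Real.one_le_sqrt, Real.one_le_sqrt]
          exact_mod_cast h0)
        (by
          rw [show (4 : ℕ) = 2 * 2 from rfl, pow_mul, Real.sq_sqrt (Real.sqrt_nonneg _),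
            Real.sq_sqrt (Nat.cast_nonneg _)]) hc (by omega)
      refine ⟨H, rfl, hH, ?_⟩
      rwa [sub_sub_cancel] at h
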